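/- **Setting.** For every $n\ge 1$ let $\Sigma=\Sigma_n$ be a finite non-empty alphabet (it may depend on $n$; its symbols are numbered $0,\dots,|\Sigma_n|-1$), and let $f=(f_n)$, $f_n:\Sigma^n\to\Sigma$, be symmetric, i.e. invariant under permutations of its $n$ arguments. A *streaming algorithm* is a pair $(\sigma,\eta)$ with $\sigma:Q\times\Sigma\to Q$ and $\eta:Q\to\Sigma$, where $Q=Q_n=\{0,\dots,|Q_n|-1\}$ is a finite set of states with starting state $0$. It computes $f$ if $\eta(\sigma(\dots\sigma(\sigma(0,x_1),x_2)\dots,x_n))=f(x)$ for all $n \ge 1$ and $x\in\Sigma^n$. A *mud algorithm* is a triple $(\Phi,\oplus,\eta)$ with $\Phi:\Sigma\to Q$, $\oplus:Q\times Q\to Q$ and $\eta:Q\to\Sigma$, where $Q=Q_n=\{0,\dots,|Q_n|-1\}$ is a finite set of messages. For a binary tree $\mathcal T$ with $n$ leaves, to which the positions $1,\dots,n$ are assigned by an arbitrary permutation, $m_{\mathcal T}(x)\in Q$ is the result of applying $\oplus$ along $\mathcal T$ to the messages $\Phi(x_i)$ at its leaves. The algorithm computes $f$ if $\eta(m_{\mathcal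 T}(x))=f(x)$ for all $n\ge 1$, all $x\in\Sigma^n$ and all such $\mathcal T$. An algorithm of either kind uses $c(n)$ *communication* if $\log_2|Q_n|\le c(n)$ for all $n\ge 1$. It uses $g(n)$ *space* if each of its component functions is computed by one deterministic (multi-stack) Turing machine, the same for all $n \ge 1$, which is given $n$, $|\Sigma_n|$ and the arguments of the function in binary and uses at most $g(n)$ memory cells, the cells that hold its input and its output included. $\mathrm{MUD}$ (resp. $\mathrm{SS}$) is the class of symmetric $f$ that are computed by a mud (resp. streaming) algorithm with $\mathrm{polylog}(n)$ communication and $\mathrm{polylog}(n)$ space, where $\mathrm{polylog}(n)$ means $O((\log n)^d)$ for some constant $d$. **Theorem.** Let $f$ be symmetric and computed by a $g(n)$-space, $c(n)$-communication streaming algorithm, where $g(n)=\Omega(\log n)$ and $c(n)=\Omega(\log n)$. Then there is an $O(c(n))$-communication, $O(g(n)^2)$-space mud algorithm that also computes $f$. Moreover $\mathrm{MUD}=\mathrm{SS}$. -/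

import Mathlib

open Filter Asymptotics

namespace MudStreaming

/-! ### Symmetric functions `Σ ^ n → Σ` -/

/-- A symmetric function `f : Σ ^ n → Σ`, as a family indexed by the input length `n`. The finite
non-empty alphabet `Σ` may depend on `n`; its symbols are numbered `0, …, card n - 1`. -/
structure SymmFun where
  /-- the size of the alphabet for inputs of length `n` -/
  card : ℕ → ℕ
  card_pos : ∀ n, 0 < card n
  /-- the function on inputs of length `n` -/
  toFun : ∀ n, (Fin n → Fin (card n)) → Fin (card n)
  symm : ∀ (n : ℕ) (π : Equiv.Perm (Fin n)) (x : Fin n → Fin (card n)),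
    toFun n (x ∘ π) = toFun n x

/-! ### Space on Turing machines -/

/-- A list of natural numbers as a word over the alphabet `{0, 1, separator}`: each number is
written in binary and followed by the separator `none`. -/
def encodeNats (l : List ℕ) : List (Option Bool) :=
  l.flatMap fun a => (Nat.bits a).map some ++ [none]

/-- A Turing machine (Mathlib's machines with finitely many stacks) whose input and output words
are over the alphabet `{0, 1, separator}`. -/
abbrev Machine := Turing.TM2ComputableAux (Option Bool) (Option Bool)

/-- The number of memory cells in use in a configuration: the total length of all stacks,
the input and output stacks included. -/
def cellsUsed (M : Turing.FinTM2) (c : M.Cfg) : ℕ :=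
  letI := M.kFin
  ∑ k : M.K, (Turing.TM2.Cfg.stk c k).length

/-- The machine `M`, started on the arguments `input`, halts with the output `output`, and never
uses more than `s` memory cells on the way. -/
def RunsInSpace (M : Machine) (input : List ℕ) (output : ℕ) (s : ℝ) : Prop :=
  Nonempty (Turing.TM2Outputs M.tm ((encodeNats input).map M.inputAlphabet.symm)
      (some ((encodeNats [output]).map M.outputAlphabet.symm))) ∧
    ∀ c : M.tm.Cfg,
      StateTransition.Reaches M.tm.step
        (Turing.initList M.tm ((encodeNats input).map M.inputAlphabet.symm)) c →
      (cellsUsed M.tm c : ℝ) ≤ s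

/-! ### Streaming algorithms -/

/-- A streaming algorithm `(σ, η)` over the alphabets `{0, …, k n - 1}`. For inputs of length `n`
its set of states is `Q = {0, …, size n - 1}`, and `0` is the starting state. -/
structure StreamAlg (k : ℕ → ℕ) where
  /-- the number of states -/
  size : ℕ → ℕ
  size_pos : ∀ n, 0 < size n
  /-- the operator applied repeatedly to the input stream -/
  σ : ∀ n, Fin (size n) → Fin (k n) → Fin (size n)
  /-- the conversion of the final state to the output -/
  η : ∀ n, Fin (size n) → Fin (k n)

namespace StreamAlg

variable {k : ℕ → ℕ}

/-- The state `s^q(x)` reached from the state `q` by reading the items of `x` in order. -/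
def run (s : StreamAlg k) (n : ℕ) (q : Fin (s.size n)) (x : List (Fin (k n))) : Fin (s.size n) :=
  x.foldl (s.σ n) q

/-- The algorithm computes `f`: its output on every non-empty input `x` is `η (s^0(x)) = f x`. -/
def Computes (s : StreamAlg k) (f : ∀ n, (Fin n → Fin (k n)) → Fin (k n)) : Prop :=
  ∀ n, 0 < n → ∀ x : Fin n → Fin (k n),
    s.η n (s.run n ⟨0, s.size_pos n⟩ (List.ofFn x)) = f n x

/-- The algorithm is a `c(n)`-communication algorithm: `log₂ |Q| ≤ c n`. -/
def HasCommunication (s : StreamAlg k) (c : ℕ → ℝ) : Prop :=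
  ∀ n, 0 < n → Real.logb 2 (s.size n) ≤ c n

/-- The algorithm is a `g(n)`-space algorithm: each of `σ` and `η` is computed, for all `n`, by one
Turing machine within `g n` memory cells. The machines know the length `n` and the size `k n` of
the alphabet. -/
def HasSpace (s : StreamAlg k) (g : ℕ → ℝ) : Prop :=
  (∃ M : Machine, ∀ n, 0 < n → ∀ (q : Fin (s.size n)) (x : Fin (k n)),
      RunsInSpace M [n, k n, q, x] (s.σ n q x) (g n)) ∧
    (∃ M : Machine, ∀ n, 0 < n → ∀ q : Fin (s.size n),
      RunsInSpace M [n, k n, q] (s.η n q) (g n))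

end StreamAlg

/-! ### Mud algorithms -/

/-- Binary trees with leaves labelled by `α`. -/
inductive BinTree (α : Type) : Type
  | leaf (a : α) : BinTree α
  | node (l r : BinTree α) : BinTree α

namespace BinTree

variable {α β : Type}

/-- The leaf labels from left to right. -/
def leaves : BinTree α → List α
  | leaf a => [a]
  | node l r => l.leaves ++ r.leaves

/-- Apply `φ` at the leaves and the binary operation `op` at the internal nodes. -/
def eval (φ : α → β) (op : β → β → β) : BinTree α → β
  | leaf a => φ a
  | node l r => op (l.eval φ op) (r.eval φ op)

/-- A computation tree for inputs of length `n`: a binary tree with `n` leaves, to which the `n`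
positions of the input are assigned by an arbitrary permutation. -/
def IsComputationTree {n : ℕ} (t : BinTree (Fin n)) : Prop :=
  t.leaves.Perm (List.finRange n)

end BinTree

/-- A mud algorithm `(Φ, ⊕, η)` over the alphabets `{0, …, k n - 1}`. For inputs of length `n` its
set of messages is `Q = {0, …, size n - 1}`. -/
structure MudAlg (k : ℕ → ℕ) where
  /-- the number of messages -/
  size : ℕ → ℕ
  /-- the local function -/
  Φ : ∀ n, Fin (k n) → Fin (size n)
  /-- the aggregator `⊕` -/
  op : ∀ n, Fin (size n) → Fin (size n) → Fin (size n)
  /-- the post-processing operator -/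
  η : ∀ n, Fin (size n) → Fin (k n)

namespace MudAlg

variable {k : ℕ → ℕ}

/-- The message `m_T(x)` that results from applying `⊕` to `Φ(x₁), …, Φ(xₙ)` along the tree `T`. -/
def run (m : MudAlg k) (n : ℕ) (T : BinTree (Fin n)) (x : Fin n → Fin (k n)) : Fin (m.size n) :=
  T.eval (fun i => m.Φ n (x i)) (m.op n)

/-- The algorithm computes `f`: `η (m_T(x)) = f x` for all inputs and all computation trees. -/
def Computes (m : MudAlg k) (f : ∀ n, (Fin n → Fin (k n)) → Fin (k n)) : Prop :=
  ∀ n, 0 < n → ∀ x : Fin n → Fin (k n), ∀ T : BinTree (Fin n), T.IsComputationTree →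
    m.η n (m.run n T x) = f n x

/-- The algorithm is a `c(n)`-communication algorithm: `log₂ |Q| ≤ c n`. -/
def HasCommunication (m : MudAlg k) (c : ℕ → ℝ) : Prop :=
  ∀ n, 0 < n → Real.logb 2 (m.size n) ≤ c n

/-- The algorithm is a `g(n)`-space algorithm: each of `Φ`, `⊕` and `η` is computed, for all `n`,
by one Turing machine within `g n` memory cells. The machines know the length `n` and the size
`k n` of the alphabet. -/
def HasSpace (m : MudAlg k) (g : ℕ → ℝ) : Prop :=
  (∃ M : Machine, ∀ n, 0 < n → ∀ x : Fin (k n),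
      RunsInSpace M [n, k n, x] (m.Φ n x) (g n)) ∧
    (∃ M : Machine, ∀ n, 0 < n → ∀ p q : Fin (m.size n),
      RunsInSpace M [n, k n, p, q] (m.op n p q) (g n)) ∧
    (∃ M : Machine, ∀ n, 0 < n → ∀ q : Fin (m.size n),
      RunsInSpace M [n, k n, q] (m.η n q) (g n))

end MudAlg

/-! ### The classes `MUD` and `SS` -/

/-- `h(n) = polylog(n)`. -/
def IsPolylog (h : ℕ → ℝ) : Prop :=
  ∃ d : ℕ, h =O[atTop] fun n : ℕ => Real.log n ^ d

/-- The symmetric functions computed by a `polylog(n)`-communication, `polylog(n)`-space mud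
algorithm. -/
def MUD : Set SymmFun :=
  {f | ∃ m : MudAlg f.card, m.Computes f.toFun ∧
    (∃ c, IsPolylog c ∧ m.HasCommunication c) ∧ ∃ g, IsPolylog g ∧ m.HasSpace g}

/-- The symmetric functions computed by a `polylog(n)`-communication, `polylog(n)`-space streaming
algorithm. -/
def SS : Set SymmFun :=
  {f | ∃ s : StreamAlg f.card, s.Computes f.toFun ∧
    (∃ c, IsPolylog c ∧ s.HasCommunication c) ∧ ∃ g, IsPolylog g ∧ s.HasSpace g}

end MudStreaming

/-! The substance is the simulation of a streaming algorithm by a mud algorithm. A message is a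
state together with the number of items read; it stands for some string of that length that leads
from the initial state to that state. To merge a message `u` with a message `v` of state `q` and
count `j`, some string of length `j` that leads from the initial state to `q` is found and made to
act on the state of `u`. It need not be the string that was really read. By symmetry the block in
question can be moved to the front of the input, where two strings with the same final state are
interchangeable (`Represents.merge`). Symmetry is available only for inputs of length exactly `n`,
so interchangeability refers to completions to length `n`, and for this reason the count belongs to
the message. It costs a factor `n + 1` in the number of messages, which `c(n) = Ω(log n)` absorbs.

The string itself is too long to be stored. Pairs of messages form a graph in which an edge lets
both components read the same item, and merging asks for a `w` such that the pair `(v, w)` can be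
reached from the pair of the initial message and `u`. With `S` messages there are `S * S` vertices
and walks of length at most `n` suffice, so Savitch's recursive halving decides this with depth
`Nat.clog 2 n` (`merge_spec`, `HalvingLoop.call`, `CmpP.halving`). Taking the least such `w` makes
`⊕` a function. Since space includes the input cells, the logarithms of `n`, of the alphabet size
and of the number of states are at most `g(n) + 1`. The recursion stack thus has `O(g)` entries of
`O(g)` bits each, which is the bound `O(g ^ 2)`.

For the machines, programs on number registers (`Cmd`) are compiled into stack machines that may
call given machines as subroutines; a bound on the numbers that occur becomes a bound on space
(`Cmd.exists_machine`). The predicate `Cmp` is a calculus of functions computed by such programs,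
closed under case distinction, loops, bounded search and arithmetic, as long as all values stay
below a prescribed bound. `Cmp.exists_machine` converts it into space `O(G ^ 2)`.

Conversely, a mud algorithm is evaluated on a stream along the left comb tree, with one additional
state for the empty prefix. Polylogarithmic bounds survive squaring and the addition of `log n`, so
the two classes agree. -/

open Turing StateTransition Function

namespace MudStreaming

/-! ### Program fragments for machines with several stacks -/

section Frag

variable {K : Type} [DecidableEq K] {Γ : K → Type} {σ : Type}

/-- Every stack has at most `s` elements. -/
def StkBdd (s : ℕ) (S : ∀ k, List (Γ k)) : Prop := ∀ k, (S k).length ≤ s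

/-- A step between configurations all of whose stacks have at most `s` elements. -/
def BddStep {Λ : Type} (s : ℕ) (m : Λ → TM2.Stmt Γ Λ σ) (a b : TM2.Cfg Γ Λ σ) : Prop :=
  TM2.step m a = some b ∧ StkBdd s a.stk ∧ StkBdd s b.stk

/-- A run through configurations all of whose stacks have at most `s` elements. -/
abbrev BddRun {Λ : Type} (s : ℕ) (m : Λ → TM2.Stmt Γ Λ σ) :
    TM2.Cfg Γ Λ σ → TM2.Cfg Γ Λ σ → Prop :=
  Relation.ReflTransGen (BddStep s m)

/-- The statement that replaces `halt` when control is to be passed to `x`. -/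
def exitStmt {Λ : Type} : Option Λ → TM2.Stmt Γ Λ σ
  | none => .halt
  | some l => .goto fun _ => l

/-- Rename the labels of a statement along `e`, and pass control to `x` instead of halting. -/
def relabel {Λ Λ' : Type} (e : Λ → Λ') (x : Option Λ') :
    TM2.Stmt Γ Λ σ → TM2.Stmt Γ Λ' σ
  | .push k f q => .push k f (relabel e x q)
  | .peek k f q => .peek k f (relabel e x q)
  | .pop k f q => .pop k f (relabel e x q)
  | .load f q => .load f (relabel e x q)
  | .branch f q₁ q₂ => .branch f (relabel e x q₁) (relabel e x q₂)
  | .goto f => .goto fun v => e (f v)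
  | .halt => exitStmt x

/-- Rename the label of a configuration. -/
def relabelCfg {Λ Λ' : Type} (e : Λ → Λ') (x : Option Λ') (c : TM2.Cfg Γ Λ σ) :
    TM2.Cfg Γ Λ' σ :=
  ⟨c.l.elim x fun l => some (e l), c.var, c.stk⟩

theorem stepAux_relabel {Λ Λ' : Type} (e : Λ → Λ') (x : Option Λ') (q : TM2.Stmt Γ Λ σ) :
    ∀ (v : σ) (S : ∀ k, List (Γ k)),
      TM2.stepAux (relabel e x q) v S = relabelCfg e x (TM2.stepAux q v S) := by
  induction q with
  | push k f q ih => intro v S; simp [relabel, ih]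
  | peek k f q ih => intro v S; simp [relabel, ih]
  | pop k f q ih => intro v S; simp [relabel, ih]
  | load f q ih => intro v S; simp [relabel, ih]
  | branch f q₁ q₂ ih₁ ih₂ =>
    intro v S
    simp only [relabel, TM2.stepAux, ih₁, ih₂]
    cases f v <;> rfl
  | goto f => intro v S; simp [relabel, relabelCfg]
  | halt => intro v S; cases x <;> simp [relabel, relabelCfg, exitStmt]

/-- Halting becomes a jump to the exit `x`, so the image of a complete run ends exactly where the
next fragment takes over. -/
theorem BddRun.relabel {Λ Λ' : Type} {s : ℕ} {m : Λ → TM2.Stmt Γ Λ σ}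
    {m' : Λ' → TM2.Stmt Γ Λ' σ} {e : Λ → Λ'} {x : Option Λ'}
    (h : ∀ l, m' (e l) = relabel e x (m l)) {c c' : TM2.Cfg Γ Λ σ} (hc : BddRun s m c c') :
    BddRun s m' (relabelCfg e x c) (relabelCfg e x c') := by
  refine Relation.ReflTransGen.lift (relabelCfg e x) ?_ _ _ hc
  rintro ⟨l, v, S⟩ b ⟨h1, h2, h3⟩
  cases l with
  | none => simp at h1
  | some l =>
    refine ⟨?_, h2, h3⟩
    simp only [TM2.step, Option.some.injEq] at h1
    simp [relabelCfg, h, stepAux_relabel, ← h1]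

variable (K Γ σ) in
/-- A program fragment: control enters at `main`, and halting means falling through. -/
structure Frag where
  Λ : Type
  [fin : Fintype Λ]
  main : Λ
  m : Λ → TM2.Stmt Γ Λ σ

namespace Frag

/-- Started on the stacks `S`, the fragment halts with the stacks `S'`, in an internal state that
satisfies `Q`; no stack ever has more than `s` elements. -/
def Exec (F : Frag K Γ σ) (s : ℕ) (S S' : ∀ k, List (Γ k)) (Q : σ → Prop := fun _ => True) :
    Prop :=
  StkBdd s S' ∧ ∀ v, ∃ v', Q v' ∧ BddRun s F.m ⟨some F.main, v, S⟩ ⟨none, v', S'⟩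

/-- Sequential composition. -/
def seq (F G : Frag K Γ σ) : Frag K Γ σ :=
  letI := F.fin
  letI := G.fin
  { Λ := F.Λ ⊕ G.Λ
    main := .inl F.main
    m := Sum.elim (fun l => relabel Sum.inl (some (.inr G.main)) (F.m l))
      (fun l => relabel Sum.inr none (G.m l)) }

/-- `Exec` is a statement about all initial internal states, so nothing has to be known about the
state in which `F` leaves the machine. -/
theorem Exec.seq {F G : Frag K Γ σ} {s : ℕ} {S S₁ S₂ : ∀ k, List (Γ k)} {Q P : σ → Prop}
    (h₁ : F.Exec s S S₁ P) (h₂ : G.Exec s S₁ S₂ Q) : (F.seq G).Exec s S S₂ Q := by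
  refine ⟨h₂.1, fun v => ?_⟩
  obtain ⟨v₁, -, r₁⟩ := h₁.2 v
  obtain ⟨v₂, hQ, r₂⟩ := h₂.2 v₁
  refine ⟨v₂, hQ, ?_⟩
  have r₁' := BddRun.relabel (m' := (F.seq G).m) (e := Sum.inl) (x := some (.inr G.main))
    (fun l => rfl) r₁
  have r₂' := BddRun.relabel (m' := (F.seq G).m) (e := Sum.inr) (x := none)
    (fun l => rfl) r₂
  exact r₁'.trans r₂'

/-- Run `T`, then `F` or `G`, according to the test `p`. -/
def ite (p : σ → Bool) (T F G : Frag K Γ σ) : Frag K Γ σ :=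
  letI := T.fin
  letI := F.fin
  letI := G.fin
  { Λ := Option (T.Λ ⊕ F.Λ ⊕ G.Λ)
    main := some (.inl T.main)
    m := fun l => l.elim
      (.branch p (.goto fun _ => some (.inr (.inl F.main))) (.goto fun _ => some (.inr (.inr G.main))))
      (Sum.elim (fun l => relabel (fun l => some (.inl l)) (some none) (T.m l))
        (Sum.elim (fun l => relabel (fun l => some (.inr (.inl l))) none (F.m l))
          (fun l => relabel (fun l => some (.inr (.inr l))) none (G.m l)))) }

theorem Exec.ite {p : σ → Bool} {T F G : Frag K Γ σ} {s : ℕ} {S S₁ S₂ : ∀ k, List (Γ k)} {b : Bool}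
    (h₁ : T.Exec s S S₁ fun v => p v = b) (h₂ : (cond b F G).Exec s S₁ S₂) :
    (Frag.ite p T F G).Exec s S S₂ := by
  refine ⟨h₂.1, fun v => ?_⟩
  obtain ⟨v₁, hp, r₁⟩ := h₁.2 v
  obtain ⟨v₂, hQ, r₂⟩ := h₂.2 v₁
  refine ⟨v₂, hQ, ?_⟩
  have r₁' := BddRun.relabel (m' := (Frag.ite p T F G).m) (e := fun l => some (.inl l))
    (x := some none) (fun l => rfl) r₁
  cases b with
  | true =>
    have r₂' := BddRun.relabel (m' := (Frag.ite p T F G).m) (e := fun l => some (.inr (.inl l)))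
      (x := none) (fun l => rfl) r₂
    refine r₁'.trans (Relation.ReflTransGen.head ⟨?_, h₁.1, ?_⟩ r₂')
    · simp [relabelCfg, Frag.ite, hp]
    · exact h₁.1
  | false =>
    have r₂' := BddRun.relabel (m' := (Frag.ite p T F G).m) (e := fun l => some (.inr (.inr l)))
      (x := none) (fun l => rfl) r₂
    refine r₁'.trans (Relation.ReflTransGen.head ⟨?_, h₁.1, ?_⟩ r₂')
    · simp [relabelCfg, Frag.ite, hp]
    · exact h₁.1

/-- Run `T`, and while the test `p` then succeeds, run `F` and `T`. -/
def loop (p : σ → Bool) (T F : Frag K Γ σ) : Frag K Γ σ :=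
  letI := T.fin
  letI := F.fin
  { Λ := Option (T.Λ ⊕ F.Λ)
    main := some (.inl T.main)
    m := fun l => l.elim
      (.branch p (.goto fun _ => some (.inr F.main)) .halt)
      (Sum.elim (fun l => relabel (fun l => some (.inl l)) (some none) (T.m l))
        (fun l => relabel (fun l => some (.inr l)) (some (some (.inl T.main))) (F.m l))) }

theorem Exec.loop_halt {p : σ → Bool} {T F : Frag K Γ σ} {s : ℕ} {S S₁ : ∀ k, List (Γ k)}
    (h₁ : T.Exec s S S₁ fun v => p v = false) : (Frag.loop p T F).Exec s S S₁ := by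
  refine ⟨h₁.1, fun v => ?_⟩
  obtain ⟨v₁, hp, r₁⟩ := h₁.2 v
  refine ⟨v₁, trivial, ?_⟩
  have r₁' := BddRun.relabel (m' := (Frag.loop p T F).m) (e := fun l => some (.inl l))
    (x := some none) (fun l => rfl) r₁
  refine r₁'.tail ⟨?_, h₁.1, h₁.1⟩
  simp [relabelCfg, Frag.loop, hp]

theorem Exec.loop_next {p : σ → Bool} {T F : Frag K Γ σ} {s : ℕ} {S S₁ S₂ S₃ : ∀ k, List (Γ k)}
    (h₁ : T.Exec s S S₁ fun v => p v = true) (h₂ : F.Exec s S₁ S₂)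
    (h₃ : (Frag.loop p T F).Exec s S₂ S₃) : (Frag.loop p T F).Exec s S S₃ := by
  refine ⟨h₃.1, fun v => ?_⟩
  obtain ⟨v₁, hp, r₁⟩ := h₁.2 v
  obtain ⟨v₂, -, r₂⟩ := h₂.2 v₁
  obtain ⟨v₃, -, r₃⟩ := h₃.2 v₂
  refine ⟨v₃, trivial, ?_⟩
  have r₁' := BddRun.relabel (m' := (Frag.loop p T F).m) (e := fun l => some (.inl l))
    (x := some none) (fun l => rfl) r₁
  have r₂' := BddRun.relabel (m' := (Frag.loop p T F).m) (e := fun l => some (.inr l))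
    (x := some (some (.inl T.main))) (fun l => rfl) r₂
  refine r₁'.trans (Relation.ReflTransGen.head ⟨?_, h₁.1, ?_⟩ (r₂'.trans r₃))
  · simp [relabelCfg, Frag.loop, hp]
  · exact h₁.1

/-- Change the internal state. -/
def load (f : σ → σ) : Frag K Γ σ where
  Λ := Unit
  main := ()
  m := fun _ => .load f .halt

theorem Exec.load {f : σ → σ} {s : ℕ} {S : ∀ k, List (Γ k)} {Q : σ → Prop} (hS : StkBdd s S)
    (hQ : ∀ v, Q (f v)) : (Frag.load (K := K) (Γ := Γ) f).Exec s S S Q :=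
  ⟨hS, fun v => ⟨f v, hQ v, .single ⟨by simp [Frag.load], hS, hS⟩⟩⟩

theorem Exec.mono {F : Frag K Γ σ} {s : ℕ} {S S' : ∀ k, List (Γ k)} {Q P : σ → Prop}
    (h : F.Exec s S S' Q) (hQP : ∀ v, Q v → P v) : F.Exec s S S' P :=
  ⟨h.1, fun v => let ⟨v', h1, h2⟩ := h.2 v; ⟨v', hQP _ h1, h2⟩⟩

end Frag

/-- In a deterministic system, all configurations reachable from the start of a run to a halting
configuration lie on the run. -/
theorem BddRun.bdd_of_reaches {Λ : Type} {s : ℕ} {m : Λ → TM2.Stmt Γ Λ σ}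
    {c c' d : TM2.Cfg Γ Λ σ} (h : BddRun s m c c') (hc : StkBdd s c.stk) (hc' : TM2.step m c' = none)
    (hd : Reaches (TM2.step m) c d) : StkBdd s d.stk := by
  suffices StkBdd s d.stk ∧ BddRun s m d c' from this.1
  induction hd with
  | refl => exact ⟨hc, h⟩
  | tail _ hbd ih =>
    rcases Relation.ReflTransGen.cases_head ih.2 with rfl | ⟨e, he, hec⟩
    · rw [Option.mem_def, hc'] at hbd; cases hbd
    · rw [Option.mem_def, he.1, Option.some.injEq] at hbd
      subst hbd
      exact ⟨he.2.2, hec⟩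

theorem BddRun.reaches {Λ : Type} {s : ℕ} {m : Λ → TM2.Stmt Γ Λ σ}
    {c c' : TM2.Cfg Γ Λ σ} (h : BddRun s m c c') : Reaches (TM2.step m) c c' :=
  Relation.ReflTransGen.mono (fun _ _ h => h.1) _ _ h

theorem nonempty_evalsTo_iff {α : Type} {f : α → Option α} {a b : α} :
    Nonempty (EvalsTo f a (some b)) ↔ Reaches f a b := by
  constructor
  · rintro ⟨n, h⟩
    induction n generalizing a with
    | zero => cases h; exact .refl
    | succ n ih =>
      rw [iterate_succ_apply] at h
      change (flip Bind.bind f)^[n] (f a) = _ at h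
      cases hfa : f a with
      | none =>
        rw [hfa] at h
        -- Once the iteration has reached `none` it stays there and cannot end in `some b`.
        have : ∀ n, (flip Bind.bind f)^[n] (none : Option α) = none := fun n => by
          induction n with
          | zero => rfl
          | succ n ih => rw [iterate_succ_apply]; exact ih
        rw [this] at h
        cases h
      | some a' =>
        rw [hfa] at h
        exact .head hfa (ih h)
  · intro h
    induction h using Relation.ReflTransGen.head_induction_on with
    | refl => exact ⟨0, rfl⟩
    | head h _ ih =>
      obtain ⟨n, hn⟩ := ih
      refine ⟨n + 1, ?_⟩
      rw [iterate_succ_apply]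
      change (flip Bind.bind f)^[n] (f _) = _
      rw [h]
      exact hn

end Frag

/-! ### Register machines on stacks: layout and elementary operations -/

theorem StkBdd.update {K : Type} [DecidableEq K] {Γ : K → Type} {s : ℕ} {S : ∀ k, List (Γ k)}
    (hS : StkBdd s S) {k : K} {l : List (Γ k)} (hl : l.length ≤ s) :
    StkBdd s (Function.update S k l) := by
  intro k'
  rcases eq_or_ne k' k with rfl | h
  · simpa using hl
  · simpa [h] using hS k'

/-- The stacks of a register machine besides those of its subroutines. -/
inductive Loc (N : ℕ) : Type
  | reg (i : Fin N)
  | tmp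
  | io
  deriving DecidableEq, Fintype

section Regs

variable {J : Type} [DecidableEq J] (M : J → Machine) (N : ℕ)

/-- The stacks of a machine with `N` registers and the subroutines `M`. -/
abbrev Stk : Type := Loc N ⊕ Σ j, (M j).tm.K

/-- The alphabets of the stacks. -/
@[reducible] def Sym : Stk M N → Type
  | .inl _ => Option Bool
  | .inr p => (M p.1).tm.Γ p.2

/-- The internal states: two cells for symbols, a flag, and the states of the subroutines. -/
abbrev Store : Type :=
  (Option (Option Bool) × Option (Option Bool) × Bool) × ∀ j, (M j).tm.σ

/-- The contents of the stacks. -/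
def stks (R : Fin N → List (Option Bool)) (T L : List (Option Bool))
    (W : ∀ p : Σ j, (M j).tm.K, List ((M p.1).tm.Γ p.2)) : ∀ k, List (Sym M N k)
  | .inl (.reg i) => R i
  | .inl .tmp => T
  | .inl .io => L
  | .inr p => W p

/-- A stack with an identification of its alphabet with `{0, 1, separator}`. -/
structure Port where
  k : Stk M N
  e : Sym M N k ≃ Option Bool

variable {M N}

namespace Port

/-- A register. -/
abbrev reg (i : Fin N) : Port M N := ⟨.inl (.reg i), Equiv.refl _⟩
/-- The auxiliary stack. -/
abbrev tmp : Port M N := ⟨.inl .tmp, Equiv.refl _⟩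
/-- The input and output stack. -/
abbrev io : Port M N := ⟨.inl .io, Equiv.refl _⟩
/-- The input stack of a subroutine. -/
abbrev inp (j : J) : Port M N := ⟨.inr ⟨j, (M j).tm.k₀⟩, (M j).inputAlphabet⟩
/-- The output stack of a subroutine. -/
abbrev out (j : J) : Port M N := ⟨.inr ⟨j, (M j).tm.k₁⟩, (M j).outputAlphabet⟩

end Port

section stks

variable {R : Fin N → List (Option Bool)} {T L : List (Option Bool)}
    {W : ∀ p : Σ j, (M j).tm.K, List ((M p.1).tm.Γ p.2)}

@[simp] theorem update_stks_reg (i : Fin N) (l : List (Option Bool)) :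
    update (stks M N R T L W) (.inl (.reg i)) l = stks M N (update R i l) T L W := by
  funext k
  rcases k with (j | _ | _) | p
  · rcases eq_or_ne j i with rfl | h
    · simp [stks]
    · simp [stks, h]
  all_goals simp [stks]

@[simp] theorem update_stks_tmp (l : List (Option Bool)) :
    update (stks M N R T L W) (.inl .tmp) l = stks M N R l L W := by
  funext k
  rcases k with (j | _ | _) | p <;> simp [stks]

@[simp] theorem update_stks_io (l : List (Option Bool)) :
    update (stks M N R T L W) (.inl .io) l = stks M N R T l W := by
  funext k
  rcases k with (j | _ | _) | p <;> simp [stks]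

@[simp] theorem update_stks_sub (p : Σ j, (M j).tm.K) (l : List ((M p.1).tm.Γ p.2)) :
    update (stks M N R T L W) (.inr p) l = stks M N R T L (update W p l) := by
  funext k
  rcases k with (j | _ | _) | q
  iterate 3 simp [stks]
  rcases eq_or_ne q p with rfl | h
  · simp [stks]
  · simp [stks, h]

end stks

namespace Frag

/-- Move symbols from `A` to `B` until a separator, which is removed, or the end of `A`. -/
def move (A B : Port M N) : Frag (Stk M N) (Sym M N) (Store M) where
  Λ := Unit
  main := ()
  m := fun _ => .pop A.k (fun v a => ((a.map A.e, v.1.2), v.2))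
    (.branch (fun v => v.1.1.join.isSome)
      (.push B.k (fun v => B.e.symm v.1.1.join) (.goto fun _ => ())) .halt)

/-- The transfer reverses the word. The remainder `r` covers both reasons to stop: the stack is
exhausted, as for a register, or a separator follows, as on the stacks for input and output. -/
theorem exec_move {A B : Port M N} {s : ℕ} (hAB : A.k ≠ B.k) (r : List (Option Bool))
    (hr : r = [] ∨ ∃ r', r = none :: r') (l : List Bool) (S : ∀ k, List (Sym M N k))
    (hS : StkBdd s S) (hA : S A.k = (l.map some ++ r).map A.e.symm)
    (hs : l.length + (S B.k).length ≤ s) :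
    (move A B).Exec s S (update (update S A.k (r.tail.map A.e.symm)) B.k
      ((l.reverse.map some).map B.e.symm ++ S B.k)) := by
  induction l generalizing S with
  | nil =>
    have hb : StkBdd s (update (update S A.k (r.tail.map A.e.symm)) B.k
      ((([] : List Bool).reverse.map some).map B.e.symm ++ S B.k)) := by
      refine (hS.update ?_).update ?_
      · have := hS A.k
        rw [hA] at this
        simp at this ⊢
        lia
      · simpa using hs
    refine ⟨hb, fun v => ⟨((r.head?, v.1.2), v.2), trivial, .single ⟨?_, hS, hb⟩⟩⟩
    · have : update S A.k (S A.k).tail = update (update S A.k (r.tail.map A.e.symm)) B.k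
          ((([] : List Bool).reverse.map some).map B.e.symm ++ S B.k) := by
        funext k
        rcases eq_or_ne k B.k with rfl | h
        · simp [hAB.symm]
        · rcases eq_or_ne k A.k with rfl | h'
          · simp [hAB, hA]
          · simp [h, h']
      simp only [TM2.step, move, TM2.stepAux, this]
      rw [hA]
      rcases hr with rfl | ⟨r', rfl⟩ <;> simp
  | cons b l ih =>
    set S₁ : ∀ k, List (Sym M N k) :=
      update (update S A.k ((l.map some ++ r).map A.e.symm)) B.k (B.e.symm (some b) :: S B.k) with hS₁
    have hA₁ : S₁ A.k = (l.map some ++ r).map A.e.symm := by simp [hS₁, hAB]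
    have hB₁ : S₁ B.k = B.e.symm (some b) :: S B.k := by simp [hS₁]
    have hb₁ : StkBdd s S₁ := by
      refine (hS.update ?_).update ?_
      · have := hS A.k
        rw [hA] at this
        simp at this ⊢
        lia
      · simp at hs ⊢
        lia
    have := ih S₁ hb₁ hA₁ (by rw [hB₁]; simp at hs ⊢; lia)
    have he : update (update S₁ A.k (r.tail.map A.e.symm)) B.k
          ((l.reverse.map some).map B.e.symm ++ S₁ B.k) =
        update (update S A.k (r.tail.map A.e.symm)) B.k
          ((((b :: l).reverse).map some).map B.e.symm ++ S B.k) := by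
      funext k
      rcases eq_or_ne k B.k with rfl | h
      · simp [hB₁]
      · rcases eq_or_ne k A.k with rfl | h'
        · simp [hAB]
        · simp [h, h', hS₁]
    rw [he] at this
    refine ⟨this.1, fun v => ?_⟩
    obtain ⟨v', -, hv⟩ := this.2 ((some (some b), v.1.2), v.2)
    refine ⟨v', trivial, hv.head ⟨?_, hS, hb₁⟩⟩
    simp only [TM2.step, move, TM2.stepAux, hA]
    simp [hAB.symm, hS₁]

/-- The symbols of the binary expansion of `n`. -/
abbrev _root_.MudStreaming.symBits (n : ℕ) : List (Option Bool) := (Nat.bits n).map some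

/-- Push a symbol. -/
def push (A : Port M N) (a : Option Bool) : Frag (Stk M N) (Sym M N) (Store M) where
  Λ := Unit
  main := ()
  m := fun _ => .push A.k (fun _ => A.e.symm a) .halt

theorem exec_push {A : Port M N} {a : Option Bool} {s : ℕ} {S : ∀ k, List (Sym M N k)}
    (hS : StkBdd s S) (hs : (S A.k).length + 1 ≤ s) :
    (push A a).Exec s S (update S A.k (A.e.symm a :: S A.k)) := by
  have hb : StkBdd s (update S A.k (A.e.symm a :: S A.k)) := hS.update (by simpa using hs)
  exact ⟨hb, fun v => ⟨v, trivial, .single ⟨by simp [push], hS, hb⟩⟩⟩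

/-- Move the number in a register to the top of the stack `A`. -/
def put (i : Fin N) (A : Port M N) : Frag (Stk M N) (Sym M N) (Store M) :=
  (push A none).seq ((move (.reg i) .tmp).seq (move .tmp A))

/-- Move the number at the top of the stack `A` to an empty register. -/
def get (i : Fin N) (A : Port M N) : Frag (Stk M N) (Sym M N) (Store M) :=
  (move A .tmp).seq (move .tmp (.reg i))

variable {s : ℕ} {R : Fin N → List (Option Bool)} {L : List (Option Bool)}
    {W : ∀ p : Σ j, (M j).tm.K, List ((M p.1).tm.Γ p.2)}

/-- Two reversals through the auxiliary stack restore the order of the digits. The separator is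
pushed first because it has to lie below them. -/
theorem exec_put {i : Fin N} {A : Port M N} {n : ℕ} (hA : A.k ≠ .inl .tmp)
    (hA' : A.k ≠ .inl (.reg i)) (hS : StkBdd s (stks M N R [] L W)) (hR : R i = symBits n)
    (hs : (stks M N R [] L W A.k).length + (Nat.bits n).length + 1 ≤ s) :
    (put i A).Exec s (stks M N R [] L W) (update (stks M N (update R i []) [] L W) A.k
      ((encodeNats [n]).map A.e.symm ++ stks M N R [] L W A.k)) := by
  set S := stks M N R [] L W with hSdef
  have h1 := exec_push (A := A) (a := none) hS (by lia)
  set S₁ := update S A.k (A.e.symm none :: S A.k) with hS₁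
  have h1r : S₁ (.inl (.reg i)) = symBits n := by
    simpa [hS₁, hA'.symm, hSdef, stks] using hR
  have h1t : S₁ (.inl .tmp) = [] := by
    simp [hS₁, hA.symm, hSdef, stks]
  have h2 := exec_move (A := .reg i) (B := .tmp) (s := s) (by simp) [] (by simp) (Nat.bits n) S₁ h1.1
    (by simp [h1r]) (by simp [h1t]; lia)
  refine h1.seq (h2.seq ?_)
  set S₂ := update (update S₁ (Port.reg (M := M) i).k _) (Port.tmp (M := M) (N := N)).k _ with hS₂
  have h2A : S₂ A.k = A.e.symm none :: S A.k := by simp [hS₂, hA, hA', hS₁]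
  have h3 := exec_move (A := .tmp) (B := A) (s := s) hA.symm [] (by simp) (Nat.bits n).reverse S₂ h2.1
    (by simp [hS₂, h1t]) (by rw [h2A]; simp; lia)
  convert h3 using 1
  funext k
  rcases eq_or_ne k A.k with rfl | h
  · simp [h2A, encodeNats]
  · rcases k with (j | _ | _) | q
    · rcases eq_or_ne j i with rfl | h'
      · simp [h, stks, hS₂, hS₁, hSdef]
      · simp [h, h', stks, hS₂, hS₁, hSdef]
    all_goals simp [h, stks, hS₂, hS₁, hSdef]

theorem exec_get {i : Fin N} {A : Port M N} {n : ℕ} {l : List (Option Bool)} (hA : A.k ≠ .inl .tmp)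
    (hA' : A.k ≠ .inl (.reg i)) (hS : StkBdd s (stks M N R [] L W)) (hR : R i = [])
    (hl : stks M N R [] L W A.k = (encodeNats [n] ++ l).map A.e.symm) :
    (get i A).Exec s (stks M N R [] L W) (update (stks M N (update R i (symBits n)) [] L W) A.k
      (l.map A.e.symm)) := by
  set S := stks M N R [] L W with hSdef
  have hlen := hS A.k
  rw [hl] at hlen
  simp [encodeNats] at hlen
  have hr : S (.inl (.reg i)) = [] := by simpa [hSdef, stks] using hR
  have ht : S (.inl .tmp) = [] := by simp [hSdef, stks]
  have h1 := exec_move (A := A) (B := .tmp) (s := s) hA (none :: l) (by simp) (Nat.bits n) S hS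
    (by simp [hl, encodeNats]) (by simp [ht]; lia)
  refine h1.seq ?_
  set S₂ := update (update S A.k _) (Port.tmp (M := M) (N := N)).k _ with hS₂
  have h3 := exec_move (A := .tmp) (B := .reg i) (s := s) (by simp) [] (by simp) (Nat.bits n).reverse
    S₂ h1.1 (by simp [hS₂, ht]) (by simp [hS₂, hA'.symm, hr]; lia)
  convert h3 using 1
  funext k
  rcases eq_or_ne k A.k with rfl | h
  · simp [hS₂, hA, hA']
  · rcases k with (j | _ | _) | q
    · rcases eq_or_ne j i with rfl | h'
      · simp [h, stks, hS₂, hSdef, hR]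
      · simp [h, h', stks, hS₂, hSdef]
    all_goals simp [h, stks, hS₂, hSdef]

/-- Empty a register. -/
def clear (i : Fin N) : Frag (Stk M N) (Sym M N) (Store M) where
  Λ := Unit
  main := ()
  m := fun _ => .pop (.inl (.reg i)) (fun v a => ((a, v.1.2), v.2))
    (.branch (fun v => v.1.1.isSome) (.goto fun _ => ()) .halt)

theorem exec_clear {i : Fin N} {T : List (Option Bool)} (hS : StkBdd s (stks M N R T L W)) :
    (clear i).Exec s (stks M N R T L W) (stks M N (update R i []) T L W) := by
  generalize hl : R i = l
  induction l generalizing R with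
  | nil =>
    have : update R i [] = R := by rw [← hl, update_eq_self]
    rw [this]
    refine ⟨hS, fun v => ⟨((none, v.1.2), v.2), trivial, .single ⟨?_, hS, hS⟩⟩⟩
    simp only [TM2.step, clear, TM2.stepAux, update_stks_reg]
    simp [stks, hl, this]
  | cons a l ih =>
    have hb : StkBdd s (stks M N (update R i l) T L W) := by
      rw [← update_stks_reg]
      have := hS (.inl (.reg i))
      simp [stks, hl] at this
      exact hS.update (by lia)
    have h := ih (R := update R i l) hb (by simp)
    rw [update_idem] at h
    refine ⟨h.1, fun v => ?_⟩
    obtain ⟨v', -, hv⟩ := h.2 ((some a, v.1.2), v.2)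
    refine ⟨v', trivial, hv.head ⟨?_, hS, hb⟩⟩
    simp only [TM2.step, clear, TM2.stepAux, update_stks_reg]
    simp [stks, hl]

/-- Increment a register. -/
def inc (i : Fin N) : Frag (Stk M N) (Sym M N) (Store M) where
  Λ := Bool
  main := false
  m := fun
    | false => .pop (.inl (.reg i)) (fun v a => ((a, v.1.2), v.2))
        (.branch (fun v => v.1.1 == some (some true))
          (.push (.inl .tmp) (fun _ => some true) (.goto fun _ => false))
          (.push (.inl (.reg i)) (fun _ => some true) (.goto fun _ => true)))
    | true => .pop (.inl .tmp) (fun v a => ((a, v.1.2), v.2))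
        (.branch (fun v => v.1.1.isSome)
          (.push (.inl (.reg i)) (fun _ => some false) (.goto fun _ => true)) .halt)

/-- Second phase of the increment: each digit one that the carry has passed, now on the auxiliary
stack, comes back as a zero. -/
theorem run_inc_true {i : Fin N} (T l : List (Option Bool)) (v : Store M)
    (hS : StkBdd s (stks M N (update R i l) T L W)) (hs : T.length + l.length ≤ s) :
    StkBdd s (stks M N (update R i (List.replicate T.length (some false) ++ l)) [] L W) ∧
    ∃ v', BddRun s (inc (M := M) i).m ⟨some true, v, stks M N (update R i l) T L W⟩
      ⟨none, v', stks M N (update R i (List.replicate T.length (some false) ++ l)) [] L W⟩ := by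
  induction T generalizing l v with
  | nil =>
    refine ⟨by simpa using hS, ((none, v.1.2), v.2), .single ⟨?_, hS, by simpa using hS⟩⟩
    simp only [TM2.step, inc, TM2.stepAux, update_stks_tmp]
    simp [stks]
  | cons a T ih =>
    have hb : StkBdd s (stks M N (update R i (some false :: l)) T L W) := by
      have := (hS.update (k := .inl .tmp) (l := T) (by simp at hs; lia)).update (k := .inl (.reg i))
        (l := some false :: l) (by simp at hs ⊢; lia)
      simpa using this
    obtain ⟨h1, v', h2⟩ := ih (some false :: l) ((some a, v.1.2), v.2) hb (by simp at hs ⊢; lia)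
    have he : List.replicate T.length (some false) ++ some false :: l =
        List.replicate (a :: T).length (some false) ++ l := by
      rw [List.length_cons, List.replicate_succ']
      simp
    rw [he] at h1 h2
    refine ⟨h1, v', h2.head ⟨?_, hS, hb⟩⟩
    simp only [TM2.step, inc, TM2.stepAux, update_stks_tmp]
    simp [stks]

/-- First phase of the increment. The lowest digit is on top; the carry moves ones to the auxiliary
stack `T` until it meets a zero or the end. The recursion follows the binary digits of `n`. -/
theorem run_inc_false {i : Fin N} (n : ℕ) : ∀ (T : List (Option Bool)) (v : Store M),
    StkBdd s (stks M N (update R i (symBits n)) T L W) →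
    T.length + (Nat.bits (n + 1)).length ≤ s →
    StkBdd s (stks M N (update R i (List.replicate T.length (some false) ++ symBits (n + 1)))
      [] L W) ∧
    ∃ v', BddRun s (inc (M := M) i).m ⟨some false, v, stks M N (update R i (symBits n)) T L W⟩
      ⟨none, v', stks M N (update R i (List.replicate T.length (some false) ++ symBits (n + 1)))
        [] L W⟩ := by
  -- Here the carry stops: the register is empty or its lowest digit is zero, and in both cases a
  -- one is put on top.
  have key : ∀ (n : ℕ) (l : List (Option Bool)) (T : List (Option Bool)) (v : Store M),
      symBits n = [] ∨ symBits n = some false :: l.tail → symBits (n + 1) = some true :: l.tail →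
      ((symBits n).tail = l.tail) →
      StkBdd s (stks M N (update R i (symBits n)) T L W) →
      T.length + (Nat.bits (n + 1)).length ≤ s →
      StkBdd s (stks M N (update R i (List.replicate T.length (some false) ++ symBits (n + 1)))
        [] L W) ∧
      ∃ v', BddRun s (inc (M := M) i).m ⟨some false, v, stks M N (update R i (symBits n)) T L W⟩
        ⟨none, v', stks M N (update R i (List.replicate T.length (some false) ++ symBits (n + 1)))
          [] L W⟩ := by
    intro n l T v h0 h1 h2 hS hs
    have hlen : (symBits (n + 1)).length = (Nat.bits (n + 1)).length := by simp
    have hb : StkBdd s (stks M N (update R i (symBits (n + 1))) T L W) := by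
      have := hS.update (k := .inl (.reg i)) (l := symBits (n + 1)) (by lia)
      simpa using this
    obtain ⟨h3, v', h4⟩ := run_inc_true (i := i) (R := R) T (symBits (n + 1))
      (((symBits n).head?, v.1.2), v.2) hb (by lia)
    refine ⟨h3, v', h4.head ⟨?_, hS, hb⟩⟩
    have hst : stks M N (update R i (symBits n)) T L W (.inl (.reg i)) = symBits n := by
      simp [stks]
    simp only [TM2.step, inc, TM2.stepAux]
    rw [hst]
    have hne : ((symBits n).head? == some (some true)) = false := by
      rcases h0 with h0 | h0 <;> rw [h0] <;> simp
    rw [hne]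
    simp only [cond_false, update_stks_reg, update_idem]
    congr 5
    simp [stks, h2, h1]
  induction n using Nat.binaryRec' with
  | zero => exact fun T v => key 0 [] T v (by simp) (by simp) (by simp [symBits])
  | bit b n hn ih =>
    cases b with
    | false =>
      intro T v
      have h0 : symBits (Nat.bit false n) = some false :: symBits n := by
        rw [symBits, Nat.bits_append_bit _ _ hn]; rfl
      have h1 : symBits (Nat.bit false n + 1) = some true :: symBits n := by
        rw [symBits, show Nat.bit false n + 1 = Nat.bit true n from rfl,
          Nat.bits_append_bit _ _ (by simp)]; rfl
      exact key _ (none :: symBits n) T v (.inr (by simpa using h0)) (by simpa using h1) (by rw [h0]; rfl)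
    | true =>
      intro T v hS hs
      have h0 : symBits (Nat.bit true n) = some true :: symBits n := by
        rw [symBits, Nat.bits_append_bit _ _ hn]; rfl
      have h1' : Nat.bits (Nat.bit true n + 1) = false :: Nat.bits (n + 1) := by
        rw [show Nat.bit true n + 1 = Nat.bit false (n + 1) by simp [Nat.bit]; lia,
          Nat.bits_append_bit _ _ (by simp)]
      have h1 : symBits (Nat.bit true n + 1) = some false :: symBits (n + 1) := by
        rw [symBits, h1']; rfl
      rw [h1'] at hs
      simp only [List.length_cons] at hs
      have hb : StkBdd s (stks M N (update R i (symBits n)) (some true :: T) L W) := by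
        have h3 : (symBits n).length ≤ s := by
          have := hS (.inl (.reg i))
          simp only [stks, update_self, h0] at this
          simp at this ⊢
          lia
        have := (hS.update (k := .inl (.reg i)) (l := symBits n) h3).update (k := .inl .tmp)
          (l := some true :: T) (by simp; lia)
        simpa using this
      obtain ⟨h3, v', h4⟩ := ih (some true :: T) ((some (some true), v.1.2), v.2) hb
        (by simp; lia)
      have he : List.replicate (some true :: T).length (some false) ++ symBits (n + 1) =
          List.replicate T.length (some false) ++ symBits (Nat.bit true n + 1) := by
        rw [h1, List.length_cons, List.replicate_succ']
        simp
      rw [he] at h3 h4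
      refine ⟨h3, v', h4.head ⟨?_, hS, hb⟩⟩
      have hst : stks M N (update R i (symBits (Nat.bit true n))) T L W (.inl (.reg i)) =
        some true :: symBits n := by simp only [stks, update_self, h0]
      simp only [TM2.step, inc, TM2.stepAux]
      rw [hst]
      simp [stks]

theorem exec_inc {i : Fin N} {n : ℕ} (hS : StkBdd s (stks M N R [] L W)) (hR : R i = symBits n)
    (hs : (Nat.bits (n + 1)).length ≤ s) :
    (inc i).Exec s (stks M N R [] L W) (stks M N (update R i (symBits (n + 1))) [] L W) := by
  have hu : update R i (symBits n) = R := by rw [← hR, update_eq_self]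
  have h := fun v => run_inc_false (M := M) (s := s) (R := R) (L := L) (W := W) (i := i) n [] v
    (by rwa [hu]) (by simpa using hs)
  simp only [hu, List.length_nil, List.replicate_zero, List.nil_append] at h
  refine ⟨(h ((none, none, false), fun j => (M j).tm.initialState)).1, fun v => ?_⟩
  obtain ⟨v', hv'⟩ := (h v).2
  exact ⟨v', trivial, hv'⟩

end Frag

end Regs

/-! ### Comparison of registers and calls of other machines -/

section Regs

variable {J : Type} [DecidableEq J] {M : J → Machine} {N : ℕ}
variable {s : ℕ} {R : Fin N → List (Option Bool)} {L : List (Option Bool)}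
    {W : ∀ p : Σ j, (M j).tm.K, List ((M p.1).tm.Γ p.2)}

namespace Frag

/-- Compare two registers, and set the flag accordingly. -/
def eq (i j : Fin N) : Frag (Stk M N) (Sym M N) (Store M) where
  Λ := Bool
  main := false
  m := fun
    | false => .pop (.inl (.reg i)) (fun v a => ((a, v.1.2), v.2))
        (.pop (.inl (.reg j)) (fun v a => ((v.1.1, a, v.1.2.2), v.2))
          (.branch (fun v => v.1.1 == v.1.2.1)
            (.branch (fun v => v.1.1.isNone)
              (.load (fun v => ((v.1.1, v.1.2.1, true), v.2)) (.goto fun _ => true))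
              (.push (.inl .tmp) (fun v => v.1.1.join) (.goto fun _ => false)))
            (.branch (fun v => v.1.1.isSome)
              (.push (.inl (.reg i)) (fun v => v.1.1.join)
                (.branch (fun v => v.1.2.1.isSome)
                  (.push (.inl (.reg j)) (fun v => v.1.2.1.join)
                    (.load (fun v => ((v.1.1, v.1.2.1, false), v.2)) (.goto fun _ => true)))
                  (.load (fun v => ((v.1.1, v.1.2.1, false), v.2)) (.goto fun _ => true))))
              (.branch (fun v => v.1.2.1.isSome)
                (.push (.inl (.reg j)) (fun v => v.1.2.1.join)
                  (.load (fun v => ((v.1.1, v.1.2.1, false), v.2)) (.goto fun _ => true)))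
                (.load (fun v => ((v.1.1, v.1.2.1, false), v.2)) (.goto fun _ => true))))))
    | true => .pop (.inl .tmp) (fun v a => ((a, v.1.2), v.2))
        (.branch (fun v => v.1.1.isSome)
          (.push (.inl (.reg i)) (fun v => v.1.1.join)
            (.push (.inl (.reg j)) (fun v => v.1.1.join) (.goto fun _ => true))) .halt)

/-- Restoring phase: the common prefix, kept on the auxiliary stack, returns to both registers, and
the flag survives. -/
theorem run_eq_true {i j : Fin N} (hij : i ≠ j) (T x y : List (Option Bool)) (v : Store M)
    (hS : StkBdd s (stks M N (update (update R i x) j y) T L W))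
    (hx : T.length + x.length ≤ s) (hy : T.length + y.length ≤ s) :
    ∃ v', v'.1.2.2 = v.1.2.2 ∧ BddRun s (eq (M := M) i j).m
      ⟨some true, v, stks M N (update (update R i x) j y) T L W⟩
      ⟨none, v', stks M N (update (update R i (T.reverse ++ x)) j (T.reverse ++ y)) [] L W⟩ := by
  induction T generalizing x y v with
  | nil =>
    refine ⟨((none, v.1.2), v.2), rfl, .single ⟨?_, hS, by simpa using hS⟩⟩
    simp only [TM2.step, eq, TM2.stepAux, update_stks_tmp]
    simp [stks]
  | cons a T ih =>
    simp only [List.length_cons] at hx hy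
    have hu : update (update (update (update R i x) j y) i (a :: x)) j (a :: y) =
        update (update R i (a :: x)) j (a :: y) := by
      rw [update_comm hij, update_idem, update_comm hij.symm, update_idem]
    have hb : StkBdd s (stks M N (update (update R i (a :: x)) j (a :: y)) T L W) := by
      have := ((hS.update (k := .inl .tmp) (l := T) (by lia)).update (k := .inl (.reg i))
        (l := a :: x) (by simp; lia)).update (k := .inl (.reg j)) (l := a :: y) (by simp; lia)
      simpa [hu] using this
    obtain ⟨v', h1, h2⟩ := ih (a :: x) (a :: y) ((some a, v.1.2), v.2) hb (by simp; lia)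
      (by simp; lia)
    refine ⟨v', h1, Relation.ReflTransGen.head ⟨?_, hS, hb⟩ (by simpa using h2)⟩
    simp only [TM2.step, eq, TM2.stepAux, update_stks_tmp]
    simp [stks, hij, hu, hij.symm]

/-- Comparing phase: equal digits are moved to the auxiliary stack in a single copy. At the first
difference, or at a common end, the flag is set and any digits just removed are put back. -/
theorem run_eq_false {i j : Fin N} (hij : i ≠ j) (x : List Bool) :
    ∀ (y T : List Bool) (v : Store M),
    StkBdd s (stks M N (update (update R i (x.map some)) j (y.map some)) (T.map some) L W) →
    T.length + x.length ≤ s → T.length + y.length ≤ s →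
    ∃ v', v'.1.2.2 = decide (x = y) ∧ BddRun s (eq (M := M) i j).m
      ⟨some false, v, stks M N (update (update R i (x.map some)) j (y.map some)) (T.map some) L W⟩
      ⟨none, v', stks M N (update (update R i ((T.reverse ++ x).map some)) j
        ((T.reverse ++ y).map some)) [] L W⟩ := by
  have key : ∀ (x y T : List Bool) (v v' : Store M),
      StkBdd s (stks M N (update (update R i (x.map some)) j (y.map some)) (T.map some) L W) →
      T.length + x.length ≤ s → T.length + y.length ≤ s → v'.1.2.2 = decide (x = y) →
      TM2.stepAux ((eq (M := M) i j).m false) v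
        (stks M N (update (update R i (x.map some)) j (y.map some)) (T.map some) L W) =
        ⟨some true, v', stks M N (update (update R i (x.map some)) j (y.map some)) (T.map some) L W⟩ →
      ∃ v', v'.1.2.2 = decide (x = y) ∧ BddRun s (eq (M := M) i j).m
        ⟨some false, v, stks M N (update (update R i (x.map some)) j (y.map some)) (T.map some) L W⟩
        ⟨none, v', stks M N (update (update R i ((T.reverse ++ x).map some)) j
          ((T.reverse ++ y).map some)) [] L W⟩ := by
    intro x y T v v' hS hx hy hv' h
    obtain ⟨w, h1, h2⟩ := run_eq_true (M := M) (R := R) (L := L) (W := W) hij (T.map some)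
      (x.map some) (y.map some) v' hS (by simpa using hx) (by simpa using hy)
    refine ⟨w, h1.trans hv', Relation.ReflTransGen.head ⟨?_, hS, hS⟩ (by simpa using h2)⟩
    simp only [TM2.step, h]
  have hu : ∀ x y x' y' : List (Option Bool),
      update (update (update (update R i x) j y) i x') j y' = update (update R i x') j y' := by
    intro x y x' y'
    rw [update_comm hij, update_idem, update_comm hij.symm, update_idem]
  have hu' : ∀ x y x' : List (Option Bool),
      update (update (update R i x) j y) i x' = update (update R i x') j y := by
    intro x y x'
    rw [update_comm hij, update_idem, update_comm hij.symm]
  induction x with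
  | nil =>
    intro y T v hS hx hy
    cases y with
    | nil =>
      refine key [] [] T v ((none, none, true), v.2) hS hx hy (by simp) ?_
      simp only [eq, TM2.stepAux]
      simp [stks, hij, hij.symm, hu]
    | cons b y =>
      refine key [] (b :: y) T v ((none, some (some b), false), v.2) hS hx hy (by simp) ?_
      simp only [eq, TM2.stepAux]
      simp [stks, hij, hij.symm, hu]
  | cons a x ih =>
    intro y T v hS hx hy
    cases y with
    | nil =>
      refine key (a :: x) [] T v ((some (some a), none, false), v.2) hS hx hy (by simp) ?_
      simp only [eq, TM2.stepAux]
      simp [stks, hij, hij.symm, hu']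
    | cons b y =>
      rcases eq_or_ne a b with rfl | hab
      · simp only [List.length_cons] at hx hy
        have hb : StkBdd s (stks M N (update (update R i (x.map some)) j (y.map some))
            ((a :: T).map some) L W) := by
          have := ((hS.update (k := .inl .tmp) (l := (a :: T).map some) (by simp; lia)).update
            (k := .inl (.reg i)) (l := x.map some) (by simp; lia)).update (k := .inl (.reg j))
            (l := y.map some) (by simp; lia)
          simpa [hu] using this
        obtain ⟨v', h1, h2⟩ := ih y (a :: T) ((some (some a), some (some a), v.1.2.2), v.2) hb
          (by simp; lia) (by simp; lia)
        refine ⟨v', by simpa using h1, Relation.ReflTransGen.head ⟨?_, hS, hb⟩ (by simpa using h2)⟩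
        simp only [TM2.step, eq, TM2.stepAux]
        simp [stks, hij, hij.symm, hu]
      · refine key (a :: x) (b :: y) T v ((some (some a), some (some b), false), v.2) hS hx hy
          (by simp [hab]) ?_
        simp only [eq, TM2.stepAux]
        simp [stks, hij, hij.symm, hu, beq_eq_false_iff_ne.2 hab]

theorem exec_eq {i j : Fin N} (hij : i ≠ j) {a b : ℕ} (hS : StkBdd s (stks M N R [] L W))
    (hi : R i = symBits a) (hj : R j = symBits b) :
    (eq i j).Exec s (stks M N R [] L W) (stks M N R [] L W)
      fun v => v.1.2.2 = decide (a = b) := by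
  refine ⟨hS, fun v => ?_⟩
  have hu : update (update R i (symBits a)) j (symBits b) = R := by
    rw [← hi, update_eq_self, ← hj, update_eq_self]
  have hx := hS (.inl (.reg i))
  have hy := hS (.inl (.reg j))
  simp only [stks, hi, hj] at hx hy
  obtain ⟨v', h1, h2⟩ := run_eq_false (M := M) (R := R) (L := L) (W := W) (s := s) hij (Nat.bits a)
    (Nat.bits b) [] v (by simpa only [List.map_nil, hu] using hS) (by simpa using hx)
    (by simpa using hy)
  simp only [List.map_nil, List.reverse_nil, List.nil_append, hu] at h2
  refine ⟨v', ?_, h2⟩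
  refine h1.trans ?_
  congr 1
  refine propext ⟨fun h => ?_, fun h => by rw [h]⟩
  -- A number is recovered from its binary digits, so equal digit lists belong to equal numbers.
  have := congrArg (fun l : List Bool => Nat.ofDigits 2 (l.map fun b => cond b 1 0)) h
  simpa only [← Nat.digits_two_eq_bits, Nat.ofDigits_digits] using this

/-! ### Calls of subroutines -/

/-- The stacks of the subroutines, all empty but those of `j`. -/
def subStks (j : J) (S : ∀ k, List ((M j).tm.Γ k)) : ∀ p : Σ j, (M j).tm.K, List ((M p.1).tm.Γ p.2) :=
  fun p => if h : p.1 = j then cast (by cases p; subst h; rfl) (S (cast (by rw [h]) p.2)) else []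

@[simp] theorem subStks_self (j : J) (S : ∀ k, List ((M j).tm.Γ k)) (k : (M j).tm.K) :
    subStks j S ⟨j, k⟩ = S k := by
  simp [subStks]

@[simp] theorem update_subStks (j : J) (S : ∀ k, List ((M j).tm.Γ k)) (k : (M j).tm.K)
    (l : List ((M j).tm.Γ k)) :
    update (subStks j S) ⟨j, k⟩ l = subStks j (update S k l) := by
  funext ⟨j', k'⟩
  rcases eq_or_ne j' j with rfl | h
  · rcases eq_or_ne k' k with rfl | h
    · simp
    · simp [h]
  · simp [subStks, h]

theorem subStks_nil (j : J) : subStks (M := M) j (fun _ => []) = fun _ => [] := by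
  funext ⟨j', k'⟩
  rcases eq_or_ne j' j with rfl | h
  · simp
  · simp [subStks, h]

variable (M N) in
/-- A statement of a subroutine as a statement of the whole machine. -/
def liftStmt (j : J) : TM2.Stmt (M j).tm.Γ (M j).tm.Λ (M j).tm.σ →
    TM2.Stmt (Sym M N) (M j).tm.Λ (Store M)
  | .push k f q => .push (.inr ⟨j, k⟩) (fun v => f (v.2 j)) (liftStmt j q)
  | .peek k f q => .peek (.inr ⟨j, k⟩) (fun v a => (v.1, update v.2 j (f (v.2 j) a))) (liftStmt j q)
  | .pop k f q => .pop (.inr ⟨j, k⟩) (fun v a => (v.1, update v.2 j (f (v.2 j) a))) (liftStmt j q)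
  | .load f q => .load (fun v => (v.1, update v.2 j (f (v.2 j)))) (liftStmt j q)
  | .branch f q₁ q₂ => .branch (fun v => f (v.2 j)) (liftStmt j q₁) (liftStmt j q₂)
  | .goto f => .goto fun v => f (v.2 j)
  | .halt => .halt

/-- A configuration of a subroutine as a configuration of the whole machine. -/
def liftCfg (v : Store M) (R : Fin N → List (Option Bool)) (T L : List (Option Bool)) (j : J)
    (c : TM2.Cfg (M j).tm.Γ (M j).tm.Λ (M j).tm.σ) : TM2.Cfg (Sym M N) (M j).tm.Λ (Store M) :=
  ⟨c.l, (v.1, update v.2 j c.var), stks M N R T L (subStks j c.stk)⟩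

theorem stepAux_liftStmt (v : Store M) (T : List (Option Bool)) (j : J)
    (q : TM2.Stmt (M j).tm.Γ (M j).tm.Λ (M j).tm.σ) :
    ∀ (w : (M j).tm.σ) (S : ∀ k, List ((M j).tm.Γ k)),
    TM2.stepAux (liftStmt M N j q) (v.1, update v.2 j w) (stks M N R T L (subStks j S)) =
      liftCfg v R T L j (TM2.stepAux q w S) := by
  have h : ∀ (S : ∀ k, List ((M j).tm.Γ k)) k,
    stks M N R T L (subStks j S) (.inr ⟨j, k⟩) = S k := fun S k => subStks_self j S k
  induction q with
  | push k f q ih =>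
    intro w S
    simp only [liftStmt, TM2.stepAux, h, update_stks_sub, update_subStks, ← ih, update_self]
  | peek k f q ih =>
    intro w S
    simp only [liftStmt, TM2.stepAux, h, ← ih, update_self, update_idem]
  | pop k f q ih =>
    intro w S
    simp only [liftStmt, TM2.stepAux, h, update_stks_sub, update_subStks, ← ih, update_self,
      update_idem]
  | load f q ih =>
    intro w S
    simp only [liftStmt, TM2.stepAux, ← ih, update_self, update_idem]
  | branch f q₁ q₂ ih₁ ih₂ =>
    intro w S
    simp only [liftStmt, TM2.stepAux, ih₁, ih₂, update_self]
    cases f w <;> rfl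
  | goto f => intro w S; simp [liftStmt, liftCfg]
  | halt => intro w S; simp [liftStmt, liftCfg]

theorem stkBdd_stks_iff {T : List (Option Bool)} : StkBdd s (stks M N R T L W) ↔
    (∀ i, (R i).length ≤ s) ∧ T.length ≤ s ∧ L.length ≤ s ∧ ∀ p, (W p).length ≤ s := by
  constructor
  · intro h
    exact ⟨fun i => h (.inl (.reg i)), h (.inl .tmp), h (.inl .io), fun p => h (.inr p)⟩
  · rintro ⟨h1, h2, h3, h4⟩ ((i | _ | _) | p)
    exacts [h1 i, h2, h3, h4 p]

theorem length_subStks_le {j : J} {S : ∀ k, List ((M j).tm.Γ k)} (h : StkBdd s S) (p) :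
    (subStks j S p).length ≤ s := by
  obtain ⟨j', k'⟩ := p
  rcases eq_or_ne j' j with rfl | h'
  · simpa using h k'
  · simp [subStks, h']

theorem BddRun.lift {T : List (Option Bool)} (hR : ∀ i, (R i).length ≤ s) (hT : T.length ≤ s)
    (hL : L.length ≤ s) (v : Store M) (j : J)
    {c c' : TM2.Cfg (M j).tm.Γ (M j).tm.Λ (M j).tm.σ} (h : BddRun s (M j).tm.m c c') :
    BddRun s (fun l => liftStmt M N j ((M j).tm.m l)) (liftCfg v R T L j c)
      (liftCfg v R T L j c') := by
  refine Relation.ReflTransGen.lift (liftCfg v R T L j) ?_ _ _ h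
  rintro ⟨l, w, S⟩ b ⟨h1, h2, h3⟩
  cases l with
  | none => simp at h1
  | some l =>
    refine ⟨?_, stkBdd_stks_iff.2 ⟨hR, hT, hL, length_subStks_le h2⟩,
      stkBdd_stks_iff.2 ⟨hR, hT, hL, length_subStks_le h3⟩⟩
    simp only [TM2.step, Option.some.injEq] at h1
    simp only [liftCfg, TM2.step, stepAux_liftStmt, ← h1]

variable (M N) in
/-- Run the subroutine `j`. -/
def sub (j : J) : Frag (Stk M N) (Sym M N) (Store M) :=
  letI := (M j).tm.ΛFin
  { Λ := Option (M j).tm.Λ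
    main := none
    m := fun l => l.elim
      (.load (fun v => (v.1, update v.2 j (M j).tm.initialState)) (.goto fun _ => some (M j).tm.main))
      fun l => relabel some none (liftStmt M N j ((M j).tm.m l)) }

/-- The internal state of the subroutine is reset on entry, so the run can start whatever earlier
calls or the surrounding program have left there. -/
theorem exec_sub {j : J} {S S' : ∀ k, List ((M j).tm.Γ k)} {w : (M j).tm.σ} {T : List (Option Bool)}
    (hS : StkBdd s (stks M N R T L (subStks j S))) (hS' : StkBdd s S')
    (h : BddRun s (M j).tm.m ⟨some (M j).tm.main, (M j).tm.initialState, S⟩ ⟨none, w, S'⟩) :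
    (sub M N j).Exec s (stks M N R T L (subStks j S)) (stks M N R T L (subStks j S')) := by
  obtain ⟨hR, hT, hL, -⟩ := stkBdd_stks_iff.1 hS
  refine ⟨stkBdd_stks_iff.2 ⟨hR, hT, hL, length_subStks_le hS'⟩, fun v => ?_⟩
  have h1 := BddRun.relabel (m' := (sub M N j).m) (e := some) (x := none) (fun l => rfl)
    (BddRun.lift (N := N) (R := R) (T := T) (L := L) hR hT hL v j h)
  refine ⟨_, trivial, Relation.ReflTransGen.head ⟨?_, hS, ?_⟩ h1⟩
  · simp [sub, relabelCfg, liftCfg]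
  · exact hS

/-- The total number of cells bounds each single stack, and every configuration of the halting run
is reachable. -/
theorem RunsInSpace.bddRun {M : Machine} {l : List ℕ} {r : ℕ} {g : ℝ} (h : RunsInSpace M l r g)
    (hs : g ≤ s) :
    BddRun s M.tm.m
      ⟨some M.tm.main, M.tm.initialState,
        update (fun _ => []) M.tm.k₀ ((encodeNats l).map M.inputAlphabet.symm)⟩
      ⟨none, M.tm.initialState,
        update (fun _ => []) M.tm.k₁ ((encodeNats [r]).map M.outputAlphabet.symm)⟩ := by
  have h0 : (⟨some M.tm.main, M.tm.initialState,
        update (fun _ => []) M.tm.k₀ ((encodeNats l).map M.inputAlphabet.symm)⟩ : M.tm.Cfg) =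
      initList M.tm ((encodeNats l).map M.inputAlphabet.symm) := by
    rw [initList]
    congr 1
    funext k
    by_cases hk : k = M.tm.k₀
    · subst hk; simp
    · simp [hk]
  have h1 : (⟨none, M.tm.initialState,
        update (fun _ => []) M.tm.k₁ ((encodeNats [r]).map M.outputAlphabet.symm)⟩ : M.tm.Cfg) =
      haltList M.tm ((encodeNats [r]).map M.outputAlphabet.symm) := by
    rw [haltList]
    congr 1
    funext k
    by_cases hk : k = M.tm.k₁
    · subst hk; simp
    · simp [hk]
  erw [h0, h1]
  obtain ⟨h2, h3⟩ := h
  replace h2 := nonempty_evalsTo_iff.1 h2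
  have hb : ∀ c : M.tm.Cfg, Reaches M.tm.step
      (initList M.tm ((encodeNats l).map M.inputAlphabet.symm)) c → StkBdd s (TM2.Cfg.stk c) := by
    intro c hc k
    have h4 := h3 c hc
    have h5 : (cellsUsed M.tm c : ℝ) ≤ s := h4.trans hs
    rw [Nat.cast_le] at h5
    let := M.tm.kFin
    exact (Finset.single_le_sum (f := fun k => (TM2.Cfg.stk c k).length) (fun _ _ => Nat.zero_le _)
      (Finset.mem_univ k)).trans h5
  clear h3 h0 h1
  generalize haltList M.tm ((encodeNats [r]).map M.outputAlphabet.symm) = d at h2 ⊢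
  induction h2 with
  | refl => exact .refl
  | tail hab hbc ih => exact Relation.ReflTransGen.tail ih ⟨hbc, hb _ hab, hb _ (hab.tail hbc)⟩

end Frag

end Regs

/-! ### Register programs -/

/-- Programs on registers that hold natural numbers, with subroutines indexed by `J`. -/
inductive Cmd (J : Type) : Type
  | zero (v : ℕ)
  | inc (v : ℕ)
  | seq (a b : Cmd J)
  | ifEq (u v : ℕ) (a b : Cmd J)
  | whileNe (u v : ℕ) (a : Cmd J)
  | call (j : J) (e m : ℕ)

namespace Cmd

variable {J : Type}

/-- Running the program changes the registers from the first to the second argument, and all numbers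
that are computed are at most `B`. The relation `O j l r` says that the subroutine `j` may be called
with the arguments `l` and returns `r`. -/
inductive Exec (O : J → List ℕ → ℕ → Prop) (B : ℕ) : Cmd J → (ℕ → ℕ) → (ℕ → ℕ) → Prop
  | zero (v st) : Exec O B (.zero v) st (update st v 0)
  | inc (v st) (h : st v + 1 ≤ B) : Exec O B (.inc v) st (update st v (st v + 1))
  | seq {a b st₁ st₂ st₃} (h₁ : Exec O B a st₁ st₂) (h₂ : Exec O B b st₂ st₃) :
      Exec O B (.seq a b) st₁ st₃
  | ifEq_pos {u v a b st st'} (huv : u ≠ v) (h : st u = st v) (ha : Exec O B a st st') :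
      Exec O B (.ifEq u v a b) st st'
  | ifEq_neg {u v a b st st'} (huv : u ≠ v) (h : st u ≠ st v) (hb : Exec O B b st st') :
      Exec O B (.ifEq u v a b) st st'
  | whileNe_halt {u v a st} (huv : u ≠ v) (h : st u = st v) : Exec O B (.whileNe u v a) st st
  | whileNe_next {u v a st₁ st₂ st₃} (huv : u ≠ v) (h : st₁ u ≠ st₁ v) (h₁ : Exec O B a st₁ st₂)
      (h₂ : Exec O B (.whileNe u v a) st₂ st₃) : Exec O B (.whileNe u v a) st₁ st₃
  | call {j e m st r} (hm : 0 < m) (h : O j ((List.range m).map fun i => st (e + i)) r)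
      (hr : r ≤ B) :
      Exec O B (.call j e m) st fun v => if v = e then r else if e ≤ v ∧ v < e + m then 0 else st v

/-- All registers of the program are below its width. -/
def width : Cmd J → ℕ
  | zero v => v + 1
  | inc v => v + 1
  | seq a b => max a.width b.width
  | ifEq u v a b => max (max (u + 1) (v + 1)) (max a.width b.width)
  | whileNe u v a => max (max (u + 1) (v + 1)) a.width
  | call _ e m => max (e + 1) (e + m)

end Cmd

/-! ### From register programs to Turing machines -/

theorem length_bits_mono {a b : ℕ} (h : a ≤ b) : (Nat.bits a).length ≤ (Nat.bits b).length := by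
  simpa only [Nat.size_eq_bits_len] using Nat.size_le_size h

section Regs

variable {J : Type} [DecidableEq J] {M : J → Machine} {N : ℕ}
variable {s : ℕ} {L : List (Option Bool)}

theorem RunsInSpace.length_le {M : Machine} {l : List ℕ} {r : ℕ} {g : ℝ} (h : RunsInSpace M l r g) :
    ((encodeNats l).length : ℝ) ≤ g := by
  refine le_trans ?_ (h.2 _ .refl)
  rw [Nat.cast_le]
  let := M.tm.kFin
  refine le_trans ?_ (Finset.single_le_sum (s := Finset.univ) (a := M.tm.k₀)
    (f := fun k => (TM2.Cfg.stk (initList M.tm ((encodeNats l).map M.inputAlphabet.symm)) k).length)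
    (fun _ _ => Nat.zero_le _) (Finset.mem_univ _))
  simp [initList]

theorem encodeNats_cons (a : ℕ) (l : List ℕ) :
    encodeNats (a :: l) = encodeNats [a] ++ encodeNats l := by
  simp [encodeNats]

/-- The contents of the registers. -/
def regs (N : ℕ) (st : ℕ → ℕ) : Fin N → List (Option Bool) := fun i => symBits (st i)

theorem update_regs (st : ℕ → ℕ) (i : Fin N) (n : ℕ) :
    update (regs N st) i (symBits n) = regs N (update st i n) := by
  funext k
  rcases eq_or_ne k i with rfl | h
  · simp [regs]
  · have : (k : ℕ) ≠ i := fun h' => h (Fin.ext h')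
    simp [regs, h, this]

theorem update_regs_nil (st : ℕ → ℕ) (i : Fin N) :
    update (regs N st) i [] = regs N (update st i 0) := by
  rw [← update_regs]; simp [symBits]

variable (M) in
/-- The stacks when the registers contain the numbers `st`. -/
abbrev regStks (N : ℕ) (st : ℕ → ℕ) (L : List (Option Bool)) : ∀ k, List (Sym M N k) :=
  stks M N (regs N st) [] L fun _ => []

theorem stkBdd_regStks {B : ℕ} {st : ℕ → ℕ} (hst : ∀ v < N, st v ≤ B)
    (hB : (Nat.bits B).length ≤ s) (hL : L.length ≤ s) : StkBdd s (regStks M N st L) := by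
  refine Frag.stkBdd_stks_iff.2 ⟨fun i => ?_, by simp, hL, by simp⟩
  simpa [regs] using (length_bits_mono (hst i i.2)).trans hB

namespace Frag

/-- Move the numbers in the registers `is` to `A`, so that the first of them is on top. -/
def putAll (A : Port M N) : List (Fin N) → Frag (Stk M N) (Sym M N) (Store M)
  | [] => load id
  | i :: is => (putAll A is).seq (put i A)

/-- The arguments are pushed from the last to the first, and each transfer empties its register.
This is why a call destroys its arguments. -/
theorem exec_putAll {j : J} (st : ℕ → ℕ) (is : List (Fin N)) (his : is.Nodup)
    (hS : StkBdd s (regStks M N st L))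
    (hs : (encodeNats (is.map fun i : Fin N => st i)).length ≤ s) :
    (putAll (Port.inp j) is).Exec s (regStks M N st L)
      (stks M N (fun i => if i ∈ is then [] else regs N st i) [] L
        (subStks j (update (fun _ => []) (M j).tm.k₀
          ((encodeNats (is.map fun i : Fin N => st i)).map (M j).inputAlphabet.symm)))) := by
  induction is with
  | nil =>
    have : update (fun _ => []) (M j).tm.k₀ ([] : List ((M j).tm.Γ (M j).tm.k₀)) = fun _ => [] := by
      funext k
      rcases eq_or_ne k (M j).tm.k₀ with rfl | h
      · simp
      · simp [h]
    simpa [encodeNats, this, subStks_nil, putAll] using Exec.load (Q := fun _ => True) hS fun _ => trivial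
  | cons i is ih =>
    rw [List.map_cons, encodeNats_cons, List.length_append] at hs
    rw [List.nodup_cons] at his
    have h1 := ih his.2 (by lia)
    refine h1.seq ?_
    have h2 := exec_put (i := i) (A := Port.inp j) (n := st i) (by simp) (by simp) h1.1
      (by simp [his.1, regs]) (by
        simp [encodeNats] at hs
        simp [stks, encodeNats]
        lia)
    convert h2 using 1
    rw [update_stks_sub, update_subStks]
    congr 1
    · funext k
      rcases eq_or_ne k i with rfl | h
      · simp
      · simp [h]
    · rw [List.map_cons, encodeNats_cons]
      simp [stks]

/-- Call a subroutine. -/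
def call (j : J) (is : List (Fin N)) (o : Fin N) : Frag (Stk M N) (Sym M N) (Store M) :=
  (putAll (.inp j) is).seq ((sub M N j).seq (get o (.out j)))

/-- A halting subroutine leaves nothing but its output. Once this has been fetched, all its stacks
are empty again and the next call finds the configuration that it needs. -/
theorem exec_call {j : J} {g : ℝ} (st : ℕ → ℕ) {is : List (Fin N)} (his : is.Nodup) {o : Fin N}
    (ho : o ∈ is) (hS : StkBdd s (regStks M N st L)) {r : ℕ}
    (hr : RunsInSpace (M j) (is.map fun i : Fin N => st i) r g) (hg : g ≤ s) :
    (call j is o).Exec s (regStks M N st L)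
      (stks M N (update (fun i => if i ∈ is then [] else regs N st i) o (symBits r)) [] L
        fun _ => []) := by
  have hlen : (encodeNats (is.map fun i : Fin N => st i)).length ≤ s := by
    have := hr.length_le.trans hg
    exact_mod_cast this
  have h1 := exec_putAll (M := M) (j := j) st is his hS hlen
  refine h1.seq ?_
  have hrun := RunsInSpace.bddRun hr hg
  have hout : StkBdd s (update (fun _ => []) (M j).tm.k₁
      ((encodeNats [r]).map (M j).outputAlphabet.symm)) := by
    rcases Relation.ReflTransGen.cases_tail hrun with h | ⟨_, -, h⟩
    · cases h
    · exact h.2.2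
  have h2 := exec_sub (s := s) h1.1 hout hrun
  refine h2.seq ?_
  have h3 := exec_get (i := o) (A := Port.out j) (n := r) (l := []) (by simp) (by simp) h2.1
    (by simp [ho]) (by simp [stks])
  convert h3 using 1
  rw [update_stks_sub, update_subStks, List.map_nil, update_idem]
  have : update (fun _ => []) (M j).tm.k₁ ([] : List ((M j).tm.Γ (M j).tm.k₁)) = fun _ => [] := by
    funext k
    rcases eq_or_ne k (M j).tm.k₁ with rfl | h
    · simp
    · simp [h]
  rw [this, subStks_nil]

end Frag

variable (M N) in
/-- The fragment for a register program. -/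
def Cmd.compile [NeZero N] : Cmd J → Frag (Stk M N) (Sym M N) (Store M)
  | .zero v => .clear (Fin.ofNat N v)
  | .inc v => .inc (Fin.ofNat N v)
  | .seq a b => (compile a).seq (compile b)
  | .ifEq u v a b => .ite (fun v => v.1.2.2) (.eq (Fin.ofNat N u) (Fin.ofNat N v)) (compile a)
      (compile b)
  | .whileNe u v a => .loop (fun v => !v.1.2.2) (.eq (Fin.ofNat N u) (Fin.ofNat N v)) (compile a)
  | .call j e m => .call j ((List.range m).map fun i => Fin.ofNat N (e + i)) (Fin.ofNat N e)

theorem val_ofNat [NeZero N] {v : ℕ} (h : v < N) : ((Fin.ofNat N v : Fin N) : ℕ) = v := by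
  simp [Nat.mod_eq_of_lt h]

/-- Induction on the execution. The registers keep numbers up to `B`, so none of their stacks is
longer than the expansion of `B`; during a call the bound `g` of the subroutine takes over. -/
theorem Cmd.Exec.compile [NeZero N] {O : J → List ℕ → ℕ → Prop} {B : ℕ} {g : ℝ}
    (hO : ∀ j l r, O j l r → RunsInSpace (M j) l r g) (hg : g ≤ s) (hB : (Nat.bits B).length ≤ s)
    (hL : L.length ≤ s) {c : Cmd J} {st st' : ℕ → ℕ} (h : c.Exec O B st st') (hc : c.width ≤ N)
    (hst : ∀ v < N, st v ≤ B) :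
    (∀ v < N, st' v ≤ B) ∧ (c.compile M N).Exec s (regStks M N st L) (regStks M N st' L) := by
  have hbdd : ∀ {st : ℕ → ℕ}, (∀ v < N, st v ≤ B) → StkBdd s (regStks M N st L) :=
    fun h => stkBdd_regStks h hB hL
  have hupd : ∀ {st : ℕ → ℕ} {v n : ℕ}, (∀ v < N, st v ≤ B) → n ≤ B →
      ∀ u < N, update st v n u ≤ B := by
    intro st v n h hn u hu
    rcases eq_or_ne u v with rfl | h'
    · simpa using hn
    · simpa [h'] using h u hu
  have heq : ∀ {st : ℕ → ℕ} {u v : ℕ}, (∀ v < N, st v ≤ B) → u ≠ v → u < N → v < N →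
      (Frag.eq (M := M) (Fin.ofNat N u) (Fin.ofNat N v)).Exec s (regStks M N st L)
        (regStks M N st L) fun w => w.1.2.2 = decide (st u = st v) := by
    intro st u v h huv hu hv
    have hne : Fin.ofNat N u ≠ Fin.ofNat N v := fun h' => huv <| by
      rw [← val_ofNat hu, ← val_ofNat hv, h']
    exact Frag.exec_eq hne (hbdd h) (by simp only [regs, val_ofNat hu])
      (by simp only [regs, val_ofNat hv])
  induction h with
  | zero v st =>
    simp only [width] at hc
    refine ⟨hupd hst (Nat.zero_le _), ?_⟩
    have h1 := Frag.exec_clear (i := Fin.ofNat N v) (hbdd hst)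
    rwa [update_regs_nil, val_ofNat (by lia)] at h1
  | inc v st h =>
    simp only [width] at hc
    refine ⟨hupd hst h, ?_⟩
    have h1 := Frag.exec_inc (i := Fin.ofNat N v) (n := st v) (hbdd hst)
      (by simp only [regs, val_ofNat (show v < N by lia)]) ((length_bits_mono h).trans hB)
    rwa [update_regs, val_ofNat (by lia)] at h1
  | seq h₁ h₂ ih₁ ih₂ =>
    simp only [width] at hc
    obtain ⟨h3, h4⟩ := ih₁ (by lia) hst
    obtain ⟨h5, h6⟩ := ih₂ (by lia) h3
    exact ⟨h5, h4.seq h6⟩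
  | ifEq_pos huv h ha ih =>
    simp only [width] at hc
    obtain ⟨h3, h4⟩ := ih (by lia) hst
    refine ⟨h3, Frag.Exec.ite (b := true) ((heq hst huv (by lia) (by lia)).mono ?_) h4⟩
    intro v hv
    rw [hv, decide_eq_true h]
  | ifEq_neg huv h ha ih =>
    simp only [width] at hc
    obtain ⟨h3, h4⟩ := ih (by lia) hst
    refine ⟨h3, Frag.Exec.ite (b := false) ((heq hst huv (by lia) (by lia)).mono ?_) h4⟩
    intro v hv
    rw [hv, decide_eq_false h]
  | whileNe_halt huv h =>
    simp only [width] at hc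
    refine ⟨hst, Frag.Exec.loop_halt ((heq hst huv (by lia) (by lia)).mono ?_)⟩
    intro v hv
    rw [hv, decide_eq_true h]; rfl
  | whileNe_next huv h h₁ h₂ ih₁ ih₂ =>
    have hc' := hc
    simp only [width] at hc'
    obtain ⟨h3, h4⟩ := ih₁ (by lia) hst
    obtain ⟨h5, h6⟩ := ih₂ hc h3
    refine ⟨h5, Frag.Exec.loop_next ((heq hst huv (by lia) (by lia)).mono ?_) h4 h6⟩
    intro v hv
    rw [hv, decide_eq_false h]; rfl
  | @call j e m st r hm h hr =>
    simp only [width] at hc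
    refine ⟨fun v hv => ?_, ?_⟩
    · dsimp only
      split_ifs
      exacts [hr, Nat.zero_le _, hst v hv]
    · set is : List (Fin N) := (List.range m).map fun i => Fin.ofNat N (e + i) with his
      have hmem : ∀ k : Fin N, k ∈ is ↔ e ≤ k ∧ k < e + m := by
        intro k
        simp only [his, List.mem_map, List.mem_range]
        constructor
        · rintro ⟨i, hi, rfl⟩
          rw [val_ofNat (by lia)]
          lia
        · rintro ⟨h1, h2⟩
          exact ⟨k - e, by lia, Fin.ext (by rw [val_ofNat (by lia)]; lia)⟩
      have hnd : is.Nodup := by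
        refine List.Nodup.map_on ?_ List.nodup_range
        intro a ha b hb hab
        rw [List.mem_range] at ha hb
        have := congrArg Fin.val hab
        rw [val_ofNat (by lia), val_ofNat (by lia)] at this
        lia
      have hmap : (is.map fun i : Fin N => st i) = (List.range m).map fun i => st (e + i) := by
        rw [his, List.map_map]
        refine List.map_congr_left fun i hi => ?_
        rw [List.mem_range] at hi
        simp only [comp_apply, val_ofNat (show e + i < N by lia)]
      have h1 := Frag.exec_call (M := M) (L := L) (s := s) (j := j) (g := g) (r := r) st hnd
        (o := Fin.ofNat N e) ((hmem _).2 (by rw [val_ofNat (by lia)]; lia)) (hbdd hst)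
        (hmap ▸ hO _ _ _ h) hg
      have hreg : update (fun i => if i ∈ is then [] else regs N st i) (Fin.ofNat N e) (symBits r) =
          regs N fun v => if v = e then r else if e ≤ v ∧ v < e + m then 0 else st v := by
        funext k
        rcases eq_or_ne k (Fin.ofNat N e) with rfl | hk
        · simp only [regs, val_ofNat (show e < N by lia), if_true, update_self]
        · have : (k : ℕ) ≠ e := fun h => hk (Fin.ext (by rw [val_ofNat (by lia), h]))
          simp only [regs, this, if_false, update_of_ne hk, hmem]
          split_ifs <;> simp [symBits]
      rw [hreg] at h1
      exact h1

namespace Frag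

/-- Move numbers from `A` to the empty registers `is`. -/
def getAll (A : Port M N) : List (Fin N) → Frag (Stk M N) (Sym M N) (Store M)
  | [] => load id
  | i :: is => (get i A).seq (getAll A is)

theorem exec_getAll (is : List (Fin N)) (his : is.Nodup) (st st' : ℕ → ℕ)
    (hst : ∀ i ∈ is, st i = 0) (hst' : ∀ i : Fin N, st' i = st i ∨ i ∈ is)
    (hS : StkBdd s (regStks M N st (encodeNats (is.map fun i : Fin N => st' i)))) :
    (getAll .io is).Exec s (regStks M N st (encodeNats (is.map fun i : Fin N => st' i)))
      (regStks M N st' []) := by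
  induction is generalizing st with
  | nil =>
    have : regs N st = regs N st' := by
      funext i
      rcases hst' i with h | h
      · simp [regs, h]
      · simp at h
    simp only [regStks, this] at hS ⊢
    exact Exec.load hS fun _ => trivial
  | cons i is ih =>
    rw [List.nodup_cons] at his
    have h1 := exec_get (i := i) (A := Port.io) (n := st' i)
      (l := encodeNats (is.map fun i : Fin N => st' i)) (by simp) (by simp) hS
      (by simp [regs, hst i (by simp), symBits]) (by
        rw [List.map_cons, encodeNats_cons]
        simp [stks])
    rw [update_stks_io, update_regs] at h1
    have h2 : (encodeNats (is.map fun i : Fin N => st' i)).map (Port.io (M := M) (N := N)).e.symm =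
      encodeNats (is.map fun i : Fin N => st' i) := by simp
    rw [h2] at h1
    refine h1.seq (ih his.2 (update st i (st' i)) ?_ ?_ h1.1)
    · intro k hk
      have hki : (k : ℕ) ≠ i := fun h => his.1 (by rwa [← Fin.ext h])
      simpa [hki] using hst k (by simp [hk])
    · intro k
      rcases eq_or_ne k i with rfl | h
      · simp
      · have hki : (k : ℕ) ≠ i := fun h' => h (Fin.ext h')
        simpa [hki, h] using hst' k

/-- Empty registers. -/
def clearAll : List (Fin N) → Frag (Stk M N) (Sym M N) (Store M)
  | [] => load id
  | i :: is => (clear i).seq (clearAll is)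

theorem exec_clearAll (is : List (Fin N)) (st : ℕ → ℕ)  (hS : StkBdd s (regStks M N st L)) :
    (clearAll is).Exec s (regStks M N st L)
      (regStks M N (fun v => if ∃ i ∈ is, (i : ℕ) = v then 0 else st v) L) := by
  induction is generalizing st with
  | nil => simpa [clearAll] using Exec.load (Q := fun _ => True) hS fun _ => trivial
  | cons i is ih =>
    have h1 := exec_clear (i := i) hS
    rw [update_regs_nil] at h1
    refine h1.seq ?_
    have h2 := ih _ h1.1
    convert h2 using 3
    rename_i v
    rcases eq_or_ne v i with rfl | h
    · simp
    · simp [h, h.symm]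

variable (M N) in
/-- The machine that computes a function of `m` arguments with the program `c`, which leaves the
result in the register `d`. -/
def withInOut [NeZero N] (c : Cmd J) (m d : ℕ) : Frag (Stk M N) (Sym M N) (Store M) :=
  (getAll .io ((List.range m).map (Fin.ofNat N))).seq
    ((c.compile M N).seq
      ((clearAll ((List.finRange N).filter fun i => i.val ≠ d)).seq
        ((put (Fin.ofNat N d) .io).seq
          (load fun _ => ((none, none, false), fun j => (M j).tm.initialState)))))

end Frag

variable (M N) in
/-- The Turing machine for a program fragment. -/
def Frag.toMachine [Fintype J] (F : Frag (Stk M N) (Sym M N) (Store M)) : Machine :=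
  letI := F.fin
  letI := fun j => (M j).tm.kFin
  letI := fun j => (M j).tm.σFin
  { tm :=
    { K := Stk M N
      k₀ := .inl .io
      k₁ := .inl .io
      Γ := Sym M N
      Λ := F.Λ
      main := F.main
      σ := Store M
      initialState := ((none, none, false), fun j => (M j).tm.initialState)
      Γk₀Fin := inferInstanceAs (Fintype (Option Bool))
      m := F.m }
    inputAlphabet := Equiv.refl (Option Bool)
    outputAlphabet := Equiv.refl (Option Bool) }

/-- By determinism the reachable configurations are those on the halting run, where each of the
finitely many stacks has at most `s` cells. -/
theorem Frag.Exec.runsInSpace [Fintype J] {F : Frag (Stk M N) (Sym M N) (Store M)} {l : List ℕ}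
    {r : ℕ} (hS : StkBdd s (regStks M N (fun _ => 0) (encodeNats l)))
    (h : F.Exec s (regStks M N (fun _ => 0) (encodeNats l)) (regStks M N (fun _ => 0) (encodeNats [r]))
      fun v => v = ((none, none, false), fun j => (M j).tm.initialState)) :
    letI := (Frag.toMachine M N F).tm.kFin
    RunsInSpace (Frag.toMachine M N F) l r
      (Fintype.card (Frag.toMachine M N F).tm.K * s : ℕ) := by
  obtain ⟨v', rfl, h1⟩ := h.2 ((none, none, false), fun j => (M j).tm.initialState)
  have hst : ∀ L : List (Option Bool), regStks M N (fun _ => 0) L = fun k =>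
      @dite (List (Sym M N k)) (k = .inl .io) (instDecidableEqSum k (.inl .io))
        (fun h => by rw [h]; exact L) fun _ => [] := by
    intro L
    funext k
    rcases k with (i | _ | _) | p
    · simp [stks, regs, symBits]
    · simp [stks]
    · simp [stks]
    · simp [stks]
  have h0 : (⟨some F.main, ((none, none, false), fun j => (M j).tm.initialState),
        regStks M N (fun _ => 0) (encodeNats l)⟩ : (F.toMachine M N).tm.Cfg) =
      initList (F.toMachine M N).tm ((encodeNats l).map (F.toMachine M N).inputAlphabet.symm) := by
    rw [hst, show (encodeNats l).map (F.toMachine M N).inputAlphabet.symm = encodeNats l from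
      List.map_id _]
    rfl
  have h2 : (⟨none, ((none, none, false), fun j => (M j).tm.initialState),
        regStks M N (fun _ => 0) (encodeNats [r])⟩ : (F.toMachine M N).tm.Cfg) =
      haltList (F.toMachine M N).tm
        ((encodeNats [r]).map (F.toMachine M N).outputAlphabet.symm) := by
    rw [hst, show (encodeNats [r]).map (F.toMachine M N).outputAlphabet.symm = encodeNats [r] from
      List.map_id _]
    rfl
  refine ⟨nonempty_evalsTo_iff.2 ?_, fun c hc => ?_⟩
  · rw [← h0, ← h2]
    exact BddRun.reaches h1
  · rw [← h0] at hc
    have hb : StkBdd s (TM2.Cfg.stk c) := BddRun.bdd_of_reaches h1 hS rfl hc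
    rw [Nat.cast_le]
    refine (Finset.sum_le_card_nsmul _ _ s fun k _ => hb k).trans ?_
    simp [Finset.card_univ]

variable (M) in
/-- Every register program is carried out by a Turing machine. -/
theorem Cmd.exists_machine [Fintype J] (c : Cmd J) (m d : ℕ) : ∃ (X : Machine) (C : ℕ),
    ∀ (O : J → List ℕ → ℕ → Prop) (B s : ℕ) (g : ℝ) (l : List ℕ) (st' : ℕ → ℕ), l.length = m →
      (∀ j l r, O j l r → RunsInSpace (M j) l r g) → g ≤ s → (Nat.bits B).length + 1 ≤ s →
      (encodeNats l).length ≤ s → (∀ x ∈ l, x ≤ B) →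
      c.Exec O B (fun v => l.getD v 0) st' → RunsInSpace X l (st' d) (C * s : ℕ) := by
  let N := max (max c.width (m + 1)) (d + 1)
  have hN : m < N ∧ d < N ∧ c.width ≤ N := by
    refine ⟨?_, ?_, ?_⟩ <;> simp only [N] <;> lia
  have : NeZero N := ⟨by lia⟩
  refine ⟨Frag.toMachine M N (Frag.withInOut M N c m d),
    letI := (Frag.toMachine M N (Frag.withInOut M N c m d)).tm.kFin
    Fintype.card (Frag.toMachine M N (Frag.withInOut M N c m d)).tm.K, ?_⟩
  intro O B s g l st' hl hO hg hB hls hlB hc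
  have hS : StkBdd s (regStks M N (fun _ => 0) (encodeNats l)) :=
    stkBdd_regStks (B := B) (fun _ _ => Nat.zero_le _) (by lia) hls
  refine Frag.Exec.runsInSpace hS ?_
  have hmap : (((List.range m).map (Fin.ofNat N)).map fun i : Fin N => l.getD i 0) = l := by
    rw [List.map_map]
    refine List.ext_getElem (by simp [hl]) fun i h1 h2 => ?_
    have h3 : i < m := by simpa using h1
    simp only [List.getElem_map, List.getElem_range, comp_apply, val_ofNat (show i < N by lia)]
    rw [List.getD_eq_getElem _ _ h2]
  have h1 := Frag.exec_getAll (M := M) (s := s) ((List.range m).map (Fin.ofNat N)) (by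
      refine List.Nodup.map_on ?_ List.nodup_range
      intro a ha b hb hab
      rw [List.mem_range] at ha hb
      have := congrArg Fin.val hab
      rwa [val_ofNat (by lia), val_ofNat (by lia)] at this) (fun _ => 0) (fun v => l.getD v 0)
    (fun _ _ => rfl) (fun i => by
      rcases lt_or_ge i.val m with h | h
      · right
        simp only [List.mem_map, List.mem_range]
        exact ⟨i, h, Fin.ext (val_ofNat (by lia))⟩
      · left
        exact List.getD_eq_default _ _ (by lia)) (by rwa [hmap])
  rw [hmap] at h1
  refine h1.seq ?_
  obtain ⟨h2, h3⟩ := hc.compile (M := M) (N := N) (s := s) (L := []) hO hg (by lia) (by simp) hN.2.2 (by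
    intro v _
    rcases lt_or_ge v l.length with h | h
    · rw [List.getD_eq_getElem _ _ h]
      exact hlB _ (List.getElem_mem _)
    · rw [List.getD_eq_default _ _ h]
      exact Nat.zero_le _)
  refine h3.seq ?_
  -- An output configuration has the initial internal state and no symbols outside the output stack.
  -- Hence all other registers are cleared and the internal state is reset at the end.
  have h4 := Frag.exec_clearAll (M := M) ((List.finRange N).filter fun i => i.val ≠ d) st' h3.1
  refine h4.seq ?_
  have h5 := Frag.exec_put (i := Fin.ofNat N d) (A := Port.io) (n := st' d) (by simp) (by simp) h4.1
    (by simp [regs, Nat.mod_eq_of_lt hN.2.1]) (by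
      have := length_bits_mono (h2 d hN.2.1)
      simp only [stks, List.length_nil]
      lia)
  rw [update_stks_io, update_regs_nil] at h5
  have h6 : regs N (update (fun v => if ∃ i ∈ (List.finRange N).filter fun i => i.val ≠ d,
      (i : ℕ) = v then 0 else st' v) ((Fin.ofNat N d : Fin N) : ℕ) 0) = regs N fun _ => 0 := by
    funext k
    rcases eq_or_ne k.val d with h | h
    · simp [regs, Nat.mod_eq_of_lt hN.2.1, h]
    · have : ∃ i : Fin N, ¬ i.val = d ∧ i.val = k.val := ⟨k, h, rfl⟩
      simp [regs, Nat.mod_eq_of_lt hN.2.1, h, this]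
  have h7 : ((encodeNats [st' d]).map (Port.io (M := M) (N := N)).e.symm ++ stks M N (regs N
      fun v => if ∃ i ∈ (List.finRange N).filter fun i => i.val ≠ d, (i : ℕ) = v then 0 else st' v)
      [] [] (fun _ => []) (Port.io (M := M) (N := N)).k) = encodeNats [st' d] := by
    simp [stks]
  rw [h6, h7] at h5
  exact h5.seq (Frag.Exec.load h5.1 fun _ => rfl)

end Regs

/-! ### Functions that are computed by register programs -/

namespace Cmd

variable {J : Type} {O : J → List ℕ → ℕ → Prop} {B : ℕ}

/-- Copy the register `v` to `u`. -/
def copy (u v : ℕ) : Cmd J := .seq (.zero u) (.whileNe u v (.inc u))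

theorem exec_copy {u v : ℕ} (huv : u ≠ v) {st : ℕ → ℕ} (h : st v ≤ B) :
    Exec O B (copy u v) st (update st u (st v)) := by
  refine .seq (.zero u st) ?_
  have key : ∀ k n, n + k = st v →
      Exec O B (.whileNe u v (.inc u)) (update st u n) (update st u (st v)) := by
    intro k
    induction k with
    | zero =>
      rintro n rfl
      exact .whileNe_halt huv (by simp [huv.symm])
    | succ k ih =>
      intro n hn
      refine .whileNe_next huv (by simp [huv.symm]; lia) (.inc u _ (by simp; lia)) ?_
      simpa using ih (n + 1) (by lia)
  exact key (st v) 0 (by simp)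

end Cmd

/-- A context: values `a : A`, of which those with `P a` occur, are represented in the registers
below `d`; subroutines may be called according to `O`, and numbers up to `b` may be computed. -/
structure Ctx (J A : Type) where
  O : A → J → List ℕ → ℕ → Prop
  b : A → ℕ
  P : A → Prop
  d : ℕ
  R : A → (ℕ → ℕ) → Prop
  R_congr : ∀ a st st', (∀ i < d, st' i = st i) → R a st → R a st'
  one_le : ∀ a, P a → 1 ≤ b a

namespace Ctx

variable {J A : Type}

/-- The context with one more variable, in the register `e`. -/
def ext (F : Ctx J A) (e : ℕ) (I : A → ℕ → Prop) : Ctx J (A × ℕ) where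
  O p := F.O p.1
  b p := F.b p.1
  P p := F.P p.1 ∧ I p.1 p.2 ∧ p.2 ≤ F.b p.1
  d := max F.d (e + 1)
  R p st := F.R p.1 st ∧ st e = p.2
  R_congr p st st' h hR :=
    ⟨F.R_congr _ _ _ (fun i hi => h i (by lia)) hR.1, by rw [h e (by lia), hR.2]⟩
  one_le p h := F.one_le _ h.1

/-- The context restricted to the values with `Q a`. -/
def restrict (F : Ctx J A) (Q : A → Prop) : Ctx J A where
  O := F.O
  b := F.b
  P a := F.P a ∧ Q a
  d := F.d
  R := F.R
  R_congr := F.R_congr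
  one_le a h := F.one_le a h.1

/-- The context with two more variables, in the registers `e` and `e + 1`. -/
abbrev ext₂ (F : Ctx J A) (e : ℕ) (I : A → ℕ → ℕ → Prop) : Ctx J ((A × ℕ) × ℕ) :=
  (F.ext e fun _ _ => True).ext (e + 1) fun p t => I p.1 p.2 t

end Ctx

/-- The function `f` is computed by a register program, the result of which is found in the first
of the registers that the program may change. -/
def Cmp {J A : Type} (F : Ctx J A) (f : A → ℕ) : Prop :=
  ∃ c : ℕ → Cmd J, ∀ e, F.d ≤ e → ∀ a st, F.P a → F.R a st → f a ≤ F.b a ∧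
    ∃ st', (c e).Exec (F.O a) (F.b a) st st' ∧ (∀ i < e, st' i = st i) ∧ st' e = f a

/-- The loop `while c s t ≠ 0, (s, t) := (h₁ s t, h₂ s t)`, started with `(s, t)`, ends with the
second component `r`, and all pairs on the way satisfy `I`. -/
inductive LoopTo (c h₁ h₂ : ℕ → ℕ → ℕ) (I : ℕ → ℕ → Prop) : ℕ → ℕ → ℕ → Prop
  | halt {s t} (hI : I s t) (hc : c s t = 0) : LoopTo c h₁ h₂ I s t t
  | next {s t r} (hI : I s t) (hc : c s t ≠ 0) (h : LoopTo c h₁ h₂ I (h₁ s t) (h₂ s t) r) :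
      LoopTo c h₁ h₂ I s t r

theorem LoopTo.inv {c h₁ h₂ : ℕ → ℕ → ℕ} {I : ℕ → ℕ → Prop} {s t r : ℕ}
    (h : LoopTo c h₁ h₂ I s t r) : I s t := by
  cases h <;> assumption

namespace Cmp

variable {J A : Type} {F : Ctx J A} {f g : A → ℕ}

theorem le (h : Cmp F f) {a : A} (ha : F.P a) {st : ℕ → ℕ} (hst : F.R a st) : f a ≤ F.b a :=
  (h.choose_spec F.d le_rfl a st ha hst).1

theorem congr (h : Cmp F f) (hfg : ∀ a, F.P a → f a = g a) : Cmp F g := by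
  obtain ⟨c, hc⟩ := h
  refine ⟨c, fun e he a st ha hst => ?_⟩
  rw [← hfg a ha]
  exact hc e he a st ha hst

theorem restrict (h : Cmp F f) {Q : A → Prop} : Cmp (F.restrict Q) f := by
  obtain ⟨c, hc⟩ := h
  exact ⟨c, fun e he a st ha hst => hc e he a st ha.1 hst⟩

theorem ext (h : Cmp F f) {e : ℕ} {I : A → ℕ → Prop} : Cmp (F.ext e I) fun p => f p.1 := by
  obtain ⟨c, hc⟩ := h
  exact ⟨c, fun e' he p st hp hst =>
    hc e' (le_trans (le_max_left _ _) he) p.1 st hp.1 hst.1⟩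

theorem var {e : ℕ} {I : A → ℕ → Prop} : Cmp (F.ext e I) fun p => p.2 := by
  refine ⟨fun e' => .copy e' e, fun e' he p st hp hst => ⟨hp.2.2, _, Cmd.exec_copy ?_ ?_, ?_, ?_⟩⟩
  · have : e + 1 ≤ e' := le_trans (le_max_right _ _) he
    lia
  · rw [hst.2]; exact hp.2.2
  · intro i hi
    rw [update_of_ne hi.ne]
  · simp [hst.2]

theorem of_register (i : ℕ) (hi : i < F.d) (h : ∀ a, F.P a → f a ≤ F.b a)
    (hR : ∀ a st, F.P a → F.R a st → st i = f a) : Cmp F f := by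
  refine ⟨fun e' => .copy e' i, fun e' he p st hp hst => ⟨h p hp, _, Cmd.exec_copy ?_ ?_, ?_, ?_⟩⟩
  · lia
  · rw [hR _ _ hp hst]; exact h p hp
  · intro i hi
    rw [update_of_ne hi.ne]
  · simp [hR _ _ hp hst]

theorem zero : Cmp F fun _ => 0 :=
  ⟨fun e => .zero e, fun e he a st _ _ => ⟨Nat.zero_le _, _, .zero e st, fun i hi => by
    rw [update_of_ne hi.ne], by simp⟩⟩

theorem succ (hf : Cmp F f) (h : ∀ a, F.P a → f a + 1 ≤ F.b a) : Cmp F fun a => f a + 1 := by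
  obtain ⟨c, hc⟩ := hf
  refine ⟨fun e => .seq (c e) (.inc e), fun e he a st ha hst => ⟨h a ha, ?_⟩⟩
  obtain ⟨-, st', h1, h2, h3⟩ := hc e he a st ha hst
  refine ⟨_, h1.seq (.inc e st' (by rw [h3]; exact h a ha)), fun i hi => ?_, by simp [h3]⟩
  rw [update_of_ne hi.ne, h2 i hi]

theorem one : Cmp F fun _ => 1 := zero.succ F.one_le

theorem const (n : ℕ) (h : ∀ a, F.P a → n ≤ F.b a) : Cmp F fun _ => n := by
  induction n with
  | zero => exact zero
  | succ n ih => exact (ih fun a ha => by have := h a ha; lia).succ h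

theorem ifEq {h₁ h₂ : A → ℕ} (hf : Cmp F f) (hg : Cmp F g)
    (hh₁ : Cmp (F.restrict fun a => f a = g a) h₁) (hh₂ : Cmp (F.restrict fun a => f a ≠ g a) h₂) :
    Cmp F fun a => if f a = g a then h₁ a else h₂ a := by
  obtain ⟨cf, hcf⟩ := hf
  obtain ⟨cg, hcg⟩ := hg
  obtain ⟨c₁, hc₁⟩ := hh₁
  obtain ⟨c₂, hc₂⟩ := hh₂
  -- The value of `f` stays in the register `e` while that of `g` is computed from `e + 1` on. After
  -- the test both may be overwritten.
  refine ⟨fun e => .seq (cf e) (.seq (cg (e + 1)) (.ifEq e (e + 1) (c₁ e) (c₂ e))), ?_⟩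
  intro e he a st ha hst
  obtain ⟨-, st₁, r₁, p₁, v₁⟩ := hcf e he a st ha hst
  have hst₁ := F.R_congr a st st₁ (fun i hi => p₁ i (by lia)) hst
  obtain ⟨-, st₂, r₂, p₂, v₂⟩ := hcg (e + 1) (by lia) a st₁ ha hst₁
  have hst₂ := F.R_congr a st₁ st₂ (fun i hi => p₂ i (by lia)) hst₁
  have hv : st₂ e = f a := by rw [p₂ e (by lia), v₁]
  by_cases h : f a = g a
  · obtain ⟨b₃, st₃, r₃, p₃, v₃⟩ := hc₁ e he a st₂ ⟨ha, h⟩ hst₂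
    simp only [h, if_true]
    refine ⟨b₃, st₃, r₁.seq (r₂.seq (.ifEq_pos (by lia) (by rw [hv, v₂, h]) r₃)), fun i hi => ?_, v₃⟩
    rw [p₃ i hi, p₂ i (by lia), p₁ i hi]
  · obtain ⟨b₃, st₃, r₃, p₃, v₃⟩ := hc₂ e he a st₂ ⟨ha, h⟩ hst₂
    simp only [h, if_false]
    refine ⟨b₃, st₃, r₁.seq (r₂.seq (.ifEq_neg (by lia) (by rwa [hv, v₂]) r₃)), fun i hi => ?_, v₃⟩
    rw [p₃ i hi, p₂ i (by lia), p₁ i hi]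

/-- The values end up in consecutive registers, as a call expects its arguments. -/
theorem list (fs : List (A → ℕ)) (hfs : ∀ f ∈ fs, Cmp F f) : ∃ c : ℕ → Cmd J, ∀ e, F.d ≤ e →
    ∀ a st, F.P a → F.R a st → ∃ st', (c e).Exec (F.O a) (F.b a) st st' ∧ (∀ i < e, st' i = st i) ∧
      (List.range fs.length).map (fun i => st' (e + i)) = fs.map fun f => f a := by
  induction fs with
  | nil =>
    exact ⟨fun e => .zero e, fun e he a st _ _ => ⟨_, .zero e st, fun i hi => by
      rw [update_of_ne hi.ne], by simp⟩⟩
  | cons f fs ih =>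
    obtain ⟨cs, hcs⟩ := ih fun f hf => hfs f (by simp [hf])
    obtain ⟨c, hc⟩ := hfs f (by simp)
    refine ⟨fun e => .seq (c e) (cs (e + 1)), fun e he a st ha hst => ?_⟩
    obtain ⟨-, st₁, r₁, p₁, v₁⟩ := hc e he a st ha hst
    have hst₁ := F.R_congr a st st₁ (fun i hi => p₁ i (by lia)) hst
    obtain ⟨st₂, r₂, p₂, v₂⟩ := hcs (e + 1) (by lia) a st₁ ha hst₁
    refine ⟨st₂, r₁.seq r₂, fun i hi => by rw [p₂ i (by lia), p₁ i hi], ?_⟩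
    rw [List.length_cons, List.range_succ_eq_map, List.map_cons, List.map_map, List.map_cons, ← v₂]
    congr 1
    · rw [← v₁, ← p₂ e (by lia)]; rfl
    · refine List.map_congr_left fun i _ => ?_
      simp only [comp_apply]
      congr 1
      lia

theorem call {r : A → ℕ} (j : J) (fs : List (A → ℕ)) (hne : fs ≠ []) (hfs : ∀ f ∈ fs, Cmp F f)
    (h : ∀ a, F.P a → F.O a j (fs.map fun f => f a) (r a)) (hr : ∀ a, F.P a → r a ≤ F.b a) :
    Cmp F r := by
  obtain ⟨c, hc⟩ := list fs hfs
  refine ⟨fun e => .seq (c e) (.call j e fs.length), fun e he a st ha hst => ⟨hr a ha, ?_⟩⟩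
  obtain ⟨st₁, r₁, p₁, v₁⟩ := hc e he a st ha hst
  refine ⟨_, r₁.seq (.call (List.length_pos_of_ne_nil hne) (by rw [v₁]; exact h a ha) (hr a ha)), ?_,
    ?_⟩
  · intro i hi
    have h1 : i ≠ e := by lia
    have h2 : ¬ (e ≤ i ∧ i < e + fs.length) := by lia
    simp [h1, h2, p₁ i hi]
  · simp

/-- The pair is kept in `e` and `e + 1`, the value of the test in `e + 2`, and a zero to compare it
with in `e + 3`. The invariant `I` is offered to the programs for the test and the updates because
it is what keeps their values below the bound. -/
theorem loop {f₁ f₂ r : A → ℕ} {c h₁ h₂ : A → ℕ → ℕ → ℕ} (I : A → ℕ → ℕ → Prop)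
    (hf₁ : Cmp F f₁) (hf₂ : Cmp F f₂)
    (hc : ∀ e, F.d ≤ e → Cmp (F.ext₂ e I) fun p => c p.1.1 p.1.2 p.2)
    (hh₁ : ∀ e, F.d ≤ e → Cmp (F.ext₂ e fun a s t => I a s t ∧ c a s t ≠ 0)
      fun p => h₁ p.1.1 p.1.2 p.2)
    (hh₂ : ∀ e, F.d ≤ e → Cmp (F.ext₂ e fun a s t => I a s t ∧ c a s t ≠ 0)
      fun p => h₂ p.1.1 p.1.2 p.2)
    (hr : ∀ a, F.P a → LoopTo (c a) (h₁ a) (h₂ a) (I a) (f₁ a) (f₂ a) (r a)) : Cmp F r := by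
  obtain ⟨C₁, hC₁⟩ := hf₁
  obtain ⟨C₂, hC₂⟩ := hf₂
  have : Nonempty (ℕ → Cmd J) := ⟨C₁⟩
  choose! C hC using hc
  choose! D₁ hD₁ using hh₁
  choose! D₂ hD₂ using hh₂
  -- Both new components depend on both old ones, so they are computed in `e + 4` and `e + 5` before
  -- the old pair is overwritten.
  let body : ℕ → Cmd J := fun e => .seq (D₁ e (e + 4)) (.seq (D₂ e (e + 5)) (.seq (.copy e (e + 4))
    (.seq (.copy (e + 1) (e + 5)) (.seq (C e (e + 2)) (.zero (e + 3))))))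
  refine ⟨fun e => .seq (C₁ e) (.seq (C₂ (e + 1)) (.seq (C e (e + 2)) (.seq (.zero (e + 3))
    (.seq (.whileNe (e + 2) (e + 3) (body e)) (.copy e (e + 1)))))), ?_⟩
  intro e he a st ha hst
  have key : ∀ s t r, LoopTo (c a) (h₁ a) (h₂ a) (I a) s t r → s ≤ F.b a → t ≤ F.b a →
      ∀ st, F.R a st → st e = s → st (e + 1) = t → st (e + 2) = c a s t → st (e + 3) = 0 →
      r ≤ F.b a ∧ ∃ st', Cmd.Exec (F.O a) (F.b a) (.whileNe (e + 2) (e + 3) (body e)) st st' ∧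
        (∀ i < e, st' i = st i) ∧ st' (e + 1) = r := by
    intro s t r h
    induction h with
    | @halt s t hI hz =>
      intro hs ht st hst e0 e1 e2 e3
      exact ⟨ht, st, .whileNe_halt (by lia) (by rw [e2, e3, hz]), fun _ _ => rfl, e1⟩
    | @next s t r hI hz h ih =>
      intro hs ht st hst e0 e1 e2 e3
      have hP : (F.ext₂ e fun a s t => I a s t ∧ c a s t ≠ 0).P ((a, s), t) :=
        ⟨⟨ha, trivial, hs⟩, ⟨hI, hz⟩, ht⟩
      have hd : (F.ext₂ e fun a s t => I a s t ∧ c a s t ≠ 0).d = e + 2 := by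
        simp only [Ctx.ext]; lia
      have hd' : (F.ext₂ e I).d = e + 2 := by
        simp only [Ctx.ext]; lia
      obtain ⟨b₁, st₁, r₁, p₁, v₁⟩ := hD₁ e he (e + 4) (by lia) ((a, s), t) st hP ⟨⟨hst, e0⟩, e1⟩
      have hst₁ := F.R_congr a st st₁ (fun i hi => p₁ i (by lia)) hst
      obtain ⟨b₂, st₂, r₂, p₂, v₂⟩ := hD₂ e he (e + 5) (by lia) ((a, s), t) st₁ hP
        ⟨⟨hst₁, by rw [p₁ _ (by lia), e0]⟩, by rw [p₁ _ (by lia), e1]⟩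
      have hst₂ := F.R_congr a st₁ st₂ (fun i hi => p₂ i (by lia)) hst₁
      have w₁ : st₂ (e + 4) = h₁ a s t := by rw [p₂ _ (by lia), v₁]
      have w₂ : st₂ (e + 5) = h₂ a s t := v₂
      replace b₁ : h₁ a s t ≤ F.b a := b₁
      replace b₂ : h₂ a s t ≤ F.b a := b₂
      have r₃ := Cmd.exec_copy (O := F.O a) (B := F.b a) (u := e) (v := e + 4) (st := st₂) (by lia)
        (by rw [w₁]; exact b₁)
      rw [w₁] at r₃
      set st₃ := update st₂ e (h₁ a s t) with hst₃
      have w₃ : st₃ (e + 5) = h₂ a s t := by rw [hst₃, update_of_ne (by lia), w₂]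
      have r₄ := Cmd.exec_copy (O := F.O a) (B := F.b a) (u := e + 1) (v := e + 5) (st := st₃)
        (by lia) (by rw [w₃]; exact b₂)
      rw [w₃] at r₄
      set st₄ := update st₃ (e + 1) (h₂ a s t) with hst₄
      have q₄ : ∀ i < e, st₄ i = st₂ i := fun i hi => by
        rw [hst₄, update_of_ne (by lia), hst₃, update_of_ne (by lia)]
      have w₄ : st₄ e = h₁ a s t := by
        rw [hst₄, update_of_ne (by lia), hst₃, update_self]
      have w₄' : st₄ (e + 1) = h₂ a s t := by rw [hst₄, update_self]
      have hR₄ := F.R_congr a st₂ st₄ (fun i hi => q₄ i (by lia)) hst₂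
      have hI' : I a (h₁ a s t) (h₂ a s t) := h.inv
      obtain ⟨b₅, st₅, r₅, p₅, v₅⟩ := hC e he (e + 2) (by lia) ((a, h₁ a s t), h₂ a s t) st₄
        ⟨⟨ha, trivial, b₁⟩, hI', b₂⟩ ⟨⟨hR₄, w₄⟩, w₄'⟩
      have hR₅ := F.R_congr a st₄ st₅ (fun i hi => p₅ i (by lia)) hR₄
      have r₆ := Cmd.Exec.zero (O := F.O a) (B := F.b a) (e + 3) st₅
      set st₆ := update st₅ (e + 3) 0 with hst₆
      have q₆ : ∀ i < e + 3, st₆ i = st₅ i := fun i hi => by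
        rw [hst₆, update_of_ne (by lia)]
      have hR₆ := F.R_congr a st₅ st₆ (fun i hi => q₆ i (by lia)) hR₅
      obtain ⟨b₇, st₇, r₇, p₇, v₇⟩ := ih b₁ b₂ st₆ hR₆ (by rw [q₆ _ (by lia), p₅ _ (by lia), w₄])
        (by rw [q₆ _ (by lia), p₅ _ (by lia), w₄']) (by rw [q₆ _ (by lia), v₅])
        (by rw [hst₆, update_self])
      refine ⟨b₇, st₇, .whileNe_next (by lia) (by rw [e2, e3]; exact hz)
        (r₁.seq (r₂.seq (r₃.seq (r₄.seq (r₅.seq r₆))))) r₇, fun i hi => ?_, v₇⟩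
      rw [p₇ i hi, q₆ i (by lia), p₅ i (by lia), q₄ i hi, p₂ i (by lia), p₁ i (by lia)]
  have hd' : (F.ext₂ e I).d = e + 2 := by
    simp only [Ctx.ext]; lia
  obtain ⟨b₁, st₁, r₁, p₁, v₁⟩ := hC₁ e he a st ha hst
  have hst₁ := F.R_congr a st st₁ (fun i hi => p₁ i (by lia)) hst
  obtain ⟨b₂, st₂, r₂, p₂, v₂⟩ := hC₂ (e + 1) (by lia) a st₁ ha hst₁
  have hst₂ := F.R_congr a st₁ st₂ (fun i hi => p₂ i (by lia)) hst₁
  have w₂ : st₂ e = f₁ a := by rw [p₂ _ (by lia), v₁]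
  have hI : I a (f₁ a) (f₂ a) := (hr a ha).inv
  obtain ⟨b₃, st₃, r₃, p₃, v₃⟩ := hC e he (e + 2) (by lia) ((a, f₁ a), f₂ a) st₂
    ⟨⟨ha, trivial, b₁⟩, hI, b₂⟩ ⟨⟨hst₂, w₂⟩, v₂⟩
  have hst₃ := F.R_congr a st₂ st₃ (fun i hi => p₃ i (by lia)) hst₂
  have r₄ := Cmd.Exec.zero (O := F.O a) (B := F.b a) (e + 3) st₃
  set st₄ := update st₃ (e + 3) 0 with hst₄
  have q₄ : ∀ i < e + 3, st₄ i = st₃ i := fun i hi => by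
    rw [hst₄, update_of_ne (by lia)]
  have hR₄ := F.R_congr a st₃ st₄ (fun i hi => q₄ i (by lia)) hst₃
  obtain ⟨b₅, st₅, r₅, p₅, v₅⟩ := key _ _ _ (hr a ha) b₁ b₂ st₄ hR₄
    (by rw [q₄ _ (by lia), p₃ _ (by lia), w₂]) (by rw [q₄ _ (by lia), p₃ _ (by lia), v₂])
    (by rw [q₄ _ (by lia), v₃]) (by rw [hst₄, update_self])
  refine ⟨b₅, _, r₁.seq (r₂.seq (r₃.seq (r₄.seq (r₅.seq
    (Cmd.exec_copy (by lia) (by rw [v₅]; exact b₅)))))), fun i hi => ?_, by simp [v₅]⟩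
  rw [update_of_ne (by lia), p₅ i hi, q₄ i (by lia), p₃ i (by lia), p₂ i (by lia), p₁ i hi]

end Cmp

/-! ### Decidable predicates and search -/

open Classical in
/-- The predicate `Q` is decided by a register program. -/
def CmpP {J A : Type} (F : Ctx J A) (Q : A → Prop) : Prop := Cmp F fun a => if Q a then 1 else 0

namespace Cmp

variable {J A : Type} {F : Ctx J A} {f g : A → ℕ}

/-- The same program works in a context with more variables or with stronger assumptions; `π`
forgets what it does not use. -/
theorem map {A' : Type} {F' : Ctx J A'} (hf : Cmp F f) (π : A' → A) (hd : F.d ≤ F'.d)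
    (hP : ∀ a, F'.P a → F.P (π a)) (hR : ∀ a st, F'.P a → F'.R a st → F.R (π a) st)
    (hO : ∀ a, F.O (π a) = F'.O a) (hb : ∀ a, F.b (π a) = F'.b a) : Cmp F' fun a => f (π a) := by
  obtain ⟨c, hc⟩ := hf
  refine ⟨c, fun e he a st ha hst => ?_⟩
  rw [← hO, ← hb]
  exact hc e (hd.trans he) (π a) st (hP a ha) (hR a st ha hst)

theorem mono {Q Q' : A → Prop} (hf : Cmp (F.restrict Q) f) (h : ∀ a, F.P a → Q' a → Q a) :
    Cmp (F.restrict Q') f :=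
  hf.map id le_rfl (fun a ha => ⟨ha.1, h a ha.1 ha.2⟩) (fun _ _ _ h => h) (fun _ => rfl)
    fun _ => rfl

end Cmp

namespace CmpP

variable {J A : Type} {F : Ctx J A} {f g : A → ℕ} {Q Q' : A → Prop}

theorem cmp (h : CmpP F Q) [∀ a, Decidable (Q a)] : Cmp F fun a => if Q a then 1 else 0 :=
  Cmp.congr h fun _ _ => by congr

theorem congr (h : CmpP F Q) (hQ : ∀ a, F.P a → (Q a ↔ Q' a)) : CmpP F Q' := by
  classical
  refine Cmp.congr h fun a ha => ?_
  simp only [hQ a ha]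

theorem restrict (h : CmpP F Q) : CmpP (F.restrict Q') Q := Cmp.restrict h

theorem eq (hf : Cmp F f) (hg : Cmp F g) : CmpP F fun a => f a = g a := by
  refine Cmp.congr (Cmp.ifEq hf hg Cmp.one Cmp.zero) fun a _ => ?_
  by_cases h : f a = g a <;> simp [h]

theorem not (h : CmpP F Q) : CmpP F fun a => ¬ Q a := by
  refine Cmp.congr (Cmp.ifEq h Cmp.zero Cmp.one Cmp.zero) fun a _ => ?_
  by_cases h : Q a <;> simp [h]

end CmpP

namespace Cmp

variable {J A : Type} {F : Ctx J A} {f g : A → ℕ}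

open Classical in
theorem ite {Q : A → Prop} (hQ : CmpP F Q) (hf : Cmp (F.restrict Q) f)
    (hg : Cmp (F.restrict fun a => ¬ Q a) g) : Cmp F fun a => if Q a then f a else g a := by
  refine congr (ifEq hQ one (hf.mono fun a _ h => ?_) (hg.mono fun a _ h => ?_)) fun a _ => ?_
  · by_contra h'; simp [h'] at h
  · intro h'; simp [h'] at h
  · by_cases h : Q a <;> simp [h]

/-- Unbounded search. -/
theorem mu {Q : A → ℕ → Prop} {r : A → ℕ} (hr : ∀ a, F.P a → r a ≤ F.b a)
    (hrQ : ∀ a, F.P a → Q a (r a)) (hne : ∀ a, F.P a → ∀ i < r a, ¬ Q a i)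
    (hQ : ∀ e, F.d ≤ e → CmpP (F.ext e fun a i => i ≤ r a) fun p => Q p.1 p.2) : Cmp F r := by
  classical
  -- The candidate is the second component of the pair; the first is idle.
  refine loop (f₁ := fun _ => 0) (f₂ := fun _ => 0) (c := fun a _ t => if ¬ Q a t then 1 else 0)
    (h₁ := fun _ _ _ => 0) (h₂ := fun _ _ t => t + 1) (fun a _ t => t ≤ r a) zero zero
    (fun e he => ?_) (fun e he => zero) (fun e he => var.succ ?_) fun a ha => ?_
  · refine map (F := F.ext (e + 1) fun a i => i ≤ r a) (hQ (e + 1) (by lia)).not.cmp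
      (fun p : (A × ℕ) × ℕ => (p.1.1, p.2)) ?_ ?_ ?_ ?_ ?_
    · simp only [Ctx.ext]; lia
    · exact fun p hp => ⟨hp.1.1, hp.2.1, hp.2.2⟩
    · exact fun p st _ hR => ⟨hR.1.1, hR.2⟩
    · exact fun p => rfl
    · exact fun p => rfl
  · rintro ⟨⟨a, s⟩, t⟩ ⟨⟨ha, -, -⟩, ⟨h1, h2⟩, -⟩
    have h3 : t ≠ r a := by
      rintro rfl
      simp [hrQ a ha] at h2
    have := hr a ha
    simp only [Ctx.ext]
    lia
  · have key : ∀ k t, t + k = r a → LoopTo (fun _ t => if ¬ Q a t then 1 else 0) (fun _ _ => 0)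
        (fun _ t => t + 1) (fun _ t => t ≤ r a) 0 t (r a) := by
      intro k
      induction k with
      | zero =>
        rintro t ht
        obtain rfl : t = r a := by lia
        exact .halt le_rfl (by simp [hrQ a ha])
      | succ k ih =>
        intro t ht
        exact .next (by lia) (by simp [hne a ha t (by lia)]) (ih (t + 1) (by lia))
    exact key (r a) 0 (by lia)

end Cmp

namespace CmpP

variable {J A : Type} {F : Ctx J A} {f g : A → ℕ} {Q Q' : A → Prop}

theorem and (h : CmpP F Q) (h' : CmpP (F.restrict Q) Q') : CmpP F fun a => Q a ∧ Q' a := by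
  refine Cmp.congr (Cmp.ite h h' Cmp.zero) fun a _ => ?_
  by_cases h : Q a <;> by_cases h' : Q' a <;> simp [h, h']

theorem or (h : CmpP F Q) (h' : CmpP (F.restrict fun a => ¬ Q a) Q') :
    CmpP F fun a => Q a ∨ Q' a := by
  refine Cmp.congr (Cmp.ite h Cmp.one h') fun a _ => ?_
  by_cases h : Q a <;> by_cases h' : Q' a <;> simp [h, h']

/-- Registers can only be tested for equality. A search that stops at the first of the two values
yields their minimum, and `f a < g a` means that the values differ and the minimum is `f a`. That
the values fit below the bound is known only if some registers represent `a`. This is therefore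
assumed for a while, and discharged at the end by the registers from which the program starts. -/
theorem lt (hf : Cmp F f) (hg : Cmp F g) : CmpP F fun a => f a < g a := by
  have hmin : Cmp (F.restrict fun a => (∃ st, F.R a st)) fun a => min (f a) (g a) := by
    refine Cmp.mu (Q := fun a i => i = f a ∨ i = g a) ?_ ?_ ?_ fun e he => ?_
    · rintro a ⟨ha, st, hst⟩
      exact (min_le_left _ _).trans (hf.le ha hst)
    · intro a _
      rcases le_total (f a) (g a) with h | h <;> simp [h]
    · intro a _ i hi
      lia
    · exact (eq Cmp.var hf.restrict.ext).or (eq Cmp.var hg.restrict.ext).restrict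
  have h := (eq hf.restrict hg.restrict).not.and (eq hmin hf.restrict).restrict
  have h' : CmpP (F.restrict fun a => (∃ st, F.R a st)) fun a => f a < g a :=
    h.congr fun a _ => by lia
  obtain ⟨c, hc⟩ := h'
  exact ⟨c, fun e he a st ha hst => hc e he a st ⟨ha, st, hst⟩ hst⟩

/-- Bounded quantification. -/
theorem bex {Q : A → ℕ → Prop} (hf : Cmp F f)
    (hQ : ∀ e, F.d ≤ e → CmpP (F.ext e fun a x => x < f a) fun p => Q p.1 p.2) :
    CmpP F fun a => ∃ x < f a, Q a x := by
  classical
  -- The alternative `x = f a` stops the search in any case; a witness below `f a` exists exactly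
  -- when the search stops earlier.
  have hex : ∀ a, ∃ x, x = f a ∨ Q a x := fun a => ⟨f a, .inl rfl⟩
  have hle : ∀ a, Nat.find (hex a) ≤ f a := fun a => Nat.find_min' _ (.inl rfl)
  have hmu : Cmp (F.restrict fun a => (∃ st, F.R a st)) fun a => Nat.find (hex a) := by
    refine Cmp.mu (Q := fun a i => i = f a ∨ Q a i) ?_ ?_ ?_ fun e he => ?_
    · rintro a ⟨ha, st, hst⟩
      exact (hle a).trans (hf.le ha hst)
    · exact fun a _ => Nat.find_spec (hex a)
    · exact fun a _ i hi => Nat.find_min (hex a) hi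
    · refine (eq Cmp.var hf.restrict.ext).or ?_
      refine Cmp.map (hQ e he) id ?_ ?_ ?_ ?_ ?_
      · exact le_rfl
      · rintro ⟨a, x⟩ ⟨⟨ha, hx, hb⟩, hxf⟩
        exact ⟨ha.1, lt_of_le_of_ne (hx.trans (hle a)) hxf, hb⟩
      · exact fun _ _ _ h => h
      · exact fun _ => rfl
      · exact fun _ => rfl
  have h' : CmpP (F.restrict fun a => (∃ st, F.R a st)) fun a => ∃ x < f a, Q a x := by
    refine (eq hmu hf.restrict).not.congr fun a _ => ?_
    constructor
    · intro h
      have h1 := lt_of_le_of_ne (hle a) h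
      exact ⟨_, h1, (Nat.find_spec (hex a)).resolve_left h⟩
    · rintro ⟨x, hx, hQx⟩
      have := Nat.find_min' (hex a) (.inr hQx)
      lia
  obtain ⟨c, hc⟩ := h'
  exact ⟨c, fun e he a st ha hst => hc e he a st ⟨ha, st, hst⟩ hst⟩

theorem ball {Q : A → ℕ → Prop} (hf : Cmp F f)
    (hQ : ∀ e, F.d ≤ e → CmpP (F.ext e fun a x => x < f a) fun p => Q p.1 p.2) :
    CmpP F fun a => ∀ x < f a, Q a x := by
  refine (bex (Q := fun a x => ¬ Q a x) hf fun e he => (hQ e he).not).not.congr fun a _ => ?_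
  push Not
  rfl

end CmpP

/-! ### Arithmetic -/

namespace Cmp

variable {J A : Type} {F : Ctx J A} {f g : A → ℕ}

theorem add (hf : Cmp F f) (hg : Cmp F g) (h : ∀ a, F.P a → f a + g a ≤ F.b a) :
    Cmp F fun a => f a + g a := by
  classical
  refine loop (f₁ := fun _ => 0) (f₂ := f) (c := fun a s _ => if ¬ s = g a then 1 else 0)
    (h₁ := fun _ s _ => s + 1) (h₂ := fun _ _ t => t + 1) (fun a s t => s ≤ g a ∧ t = f a + s) zero hf
    (fun e he => (CmpP.eq var.ext hg.ext.ext).not.cmp) (fun e he => var.ext.succ ?_)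
    (fun e he => var.succ ?_) fun a ha => ?_
  · rintro ⟨⟨a, s⟩, t⟩ ⟨⟨ha, -, -⟩, ⟨⟨h1, h2⟩, h3⟩, -⟩
    have := h a ha
    simp at h3
    simp only [Ctx.ext]
    lia
  · rintro ⟨⟨a, s⟩, t⟩ ⟨⟨ha, -, -⟩, ⟨⟨h1, h2⟩, h3⟩, -⟩
    have := h a ha
    simp at h3 h2
    simp only [Ctx.ext]
    lia
  · have key : ∀ k s, s + k = g a → LoopTo (fun s _ => if ¬ s = g a then 1 else 0) (fun s _ => s + 1)
        (fun _ t => t + 1) (fun s t => s ≤ g a ∧ t = f a + s) s (f a + s) (f a + g a) := by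
      intro k
      induction k with
      | zero =>
        rintro s rfl
        exact .halt (by simp) (by simp)
      | succ k ih =>
        intro s hs
        have h1 : ¬ s = g a := by lia
        exact .next ⟨by lia, rfl⟩ (by simp [h1]) (ih (s + 1) (by lia))
    exact key (g a) 0 (by lia)

theorem mul (hf : Cmp F f) (hg : Cmp F g) (h : ∀ a, F.P a → f a * g a ≤ F.b a) :
    Cmp F fun a => f a * g a := by
  classical
  have hgb : Cmp (F.restrict fun a => ∃ st, F.R a st) fun a => f a * g a := by
    refine loop (f₁ := fun _ => 0) (f₂ := fun _ => 0) (c := fun a s _ => if ¬ s = g a then 1 else 0)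
      (h₁ := fun _ s _ => s + 1) (h₂ := fun a _ t => t + f a) (fun a s t => s ≤ g a ∧ t = f a * s)
      zero zero (fun e he => (CmpP.eq var.ext hg.restrict.ext.ext).not.cmp) (fun e he => var.ext.succ ?_)
      (fun e he => var.add hf.restrict.ext.ext ?_) fun a ha => ?_
    · rintro ⟨⟨a, s⟩, t⟩ ⟨⟨⟨ha, st, hst⟩, -, -⟩, ⟨⟨h1, h2⟩, h3⟩, -⟩
      have h4 : s < g a := lt_of_le_of_ne h1 (by simpa using h3)
      exact le_trans (Nat.succ_le_of_lt h4) (hg.le ha hst)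
    · rintro ⟨⟨a, s⟩, t⟩ ⟨⟨⟨ha, -⟩, -, -⟩, ⟨⟨h1, h2⟩, h3⟩, -⟩
      have h4 : s < g a := lt_of_le_of_ne h1 (by simpa using h3)
      refine le_trans ?_ (h a ha)
      calc t + f a = f a * (s + 1) := by simp at h2; rw [h2]; ring
        _ ≤ _ := Nat.mul_le_mul_left _ h4
    · have key : ∀ k s, s + k = g a → LoopTo (fun s _ => if ¬ s = g a then 1 else 0)
          (fun s _ => s + 1) (fun _ t => t + f a) (fun s t => s ≤ g a ∧ t = f a * s) s (f a * s)
          (f a * g a) := by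
        intro k
        induction k with
        | zero =>
          rintro s rfl
          exact .halt (by simp) (by simp)
        | succ k ih =>
          intro s hs
          have h1 : ¬ s = g a := by lia
          refine .next ⟨by lia, rfl⟩ (by simp [h1]) ?_
          have := ih (s + 1) (by lia)
          rwa [Nat.mul_succ] at this
      exact key (g a) 0 (by lia)
  obtain ⟨c, hc⟩ := hgb
  exact ⟨c, fun e he a st ha hst => hc e he a st ⟨ha, st, hst⟩ hst⟩

theorem div (hf : Cmp F f) (hg : Cmp F g) (h0 : ∀ a, F.P a → 0 < g a)
    (h : ∀ a, F.P a → f a + g a ≤ F.b a) : Cmp F fun a => f a / g a := by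
  -- The quotient is the least `i` with `f a < (i + 1) * g a`. No product computed in this search
  -- exceeds `f a + g a`, which explains the hypothesis `h`.
  have hb : ∀ a, F.P a → ∀ i ≤ f a / g a, (i + 1) * g a ≤ F.b a := fun a ha i hi => by
    refine le_trans ?_ (h a ha)
    rw [Nat.le_div_iff_mul_le (h0 a ha)] at hi
    lia
  refine mu (Q := fun a i => f a < (i + 1) * g a) ?_ ?_ ?_ fun e he => ?_
  · exact fun a ha => le_trans (Nat.div_le_self _ _) (le_trans (by lia) (h a ha))
  · intro a ha
    have := Nat.lt_mul_div_succ (f a) (h0 a ha)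
    lia
  · intro a ha i hi h1
    rw [Nat.lt_iff_add_one_le, Nat.le_div_iff_mul_le (h0 a ha)] at hi
    lia
  · refine CmpP.lt hf.ext ((var.succ ?_).mul hg.ext ?_)
    · rintro ⟨a, i⟩ ⟨ha, hi, -⟩
      exact le_trans (Nat.le_mul_of_pos_right _ (h0 a ha)) (hb a ha i hi)
    · rintro ⟨a, i⟩ ⟨ha, hi, -⟩
      exact hb a ha i hi

theorem mod (hf : Cmp F f) (hg : Cmp F g) (h0 : ∀ a, F.P a → 0 < g a)
    (h : ∀ a, F.P a → f a + g a ≤ F.b a) : Cmp F fun a => f a % g a := by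
  have hmul : ∀ a, g a * (f a / g a) ≤ f a := fun a => Nat.mul_div_le _ _
  refine mu (Q := fun a i => g a * (f a / g a) + i = f a) ?_ ?_ ?_ fun e he => ?_
  · exact fun a ha => le_trans (Nat.mod_le _ _) (le_trans (by lia) (h a ha))
  · exact fun a _ => Nat.div_add_mod _ _
  · intro a _ i hi h1
    have := Nat.div_add_mod (f a) (g a)
    lia
  · refine CmpP.eq (((hg.mul (hf.div hg h0 h) ?_).ext).add var ?_) hf.ext
    · exact fun a ha => le_trans (hmul a) (le_trans (by lia) (h a ha))
    · rintro ⟨a, i⟩ ⟨ha, hi, -⟩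
      refine le_trans ?_ (h a ha)
      have := Nat.div_add_mod (f a) (g a)
      simp only at hi ⊢
      lia

end Cmp

/-! ### Reachability in small space -/

/-- Reachability by recursive halving: `E` at level `0`, and at level `l + 1` there is a midpoint. -/
def Halving (E : ℕ → ℕ → Prop) (N : ℕ) : ℕ → ℕ → ℕ → Prop
  | 0, u, v => E u v
  | l + 1, u, v => ∃ w < N, Halving E N l u w ∧ Halving E N l w v

/-- A list of digits as a number. -/
def stackCode (D : ℕ) : List ℕ → ℕ
  | [] => 0
  | x :: l => x + D * stackCode D l

theorem stackCode_lt {D : ℕ} {l : List ℕ} (hl : ∀ x ∈ l, x < D) : stackCode D l < D ^ l.length := by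
  induction l with
  | nil => simp [stackCode]
  | cons x l ih =>
    have h1 := ih fun y hy => hl y (by simp [hy])
    have h2 := hl x (by simp)
    rw [stackCode, List.length_cons, pow_succ]
    calc x + D * stackCode D l < D + D * stackCode D l := by lia
      _ = (stackCode D l + 1) * D := by ring
      _ ≤ _ := Nat.mul_le_mul_right _ h1

open Classical in
/-- One step of the depth-first evaluation of `Halving`. The stack is a list of digits: either
`0, i, u, v, …`, when `u` and `v` are to be connected at depth `i`, or the result `1` (false) or `2`
(true) of such an evaluation, on top of a frame `p, w, i, u, v` for the search for a midpoint, where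
`p` tells which half is being evaluated. -/
noncomputable def halvingStep (E : ℕ → ℕ → Prop) (N L D t : ℕ) : ℕ :=
  if t % D = 0 then
    if t / D % D < L then
      0 + D * (t / D % D + 1 + D * (t / D / D % D + D * (0 + D * (1 + D * (0 + D * (t / D % D + 1 + D *
        (t / D / D % D + D * (t / D / D / D % D + D * (t / D / D / D / D)))))))))
    else
      (if t / D / D % D < N ∧ t / D / D / D % D < N ∧ E (t / D / D % D) (t / D / D / D % D) then 2
        else 1) + D * (t / D / D / D / D)
  else if t % D = 2 then
    if t / D % D = 1 then
      0 + D * (t / D / D / D % D + D * (t / D / D % D + D * (t / D / D / D / D / D % D + D * (2 + D *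
        (t / D / D)))))
    else 2 + D * (t / D / D / D / D / D / D)
  else if t / D / D % D + 1 < N then
    0 + D * (t / D / D / D % D + D * (t / D / D / D / D % D + D * (t / D / D % D + 1 + D *
      (1 + D * (t / D / D % D + 1 + D * (t / D / D / D))))))
  else 1 + D * (t / D / D / D / D / D / D)

/-! ### Correctness of the evaluation on a stack -/

section correctness

variable {E : ℕ → ℕ → Prop} {N L D : ℕ}

/-- The evaluation loop. -/
abbrev HalvingLoop (E : ℕ → ℕ → Prop) (N L D : ℕ) : ℕ → ℕ → Prop :=
  LoopTo (fun _ t => if ¬ (t = 1 ∨ t = 2) then 1 else 0) (fun _ _ => 0)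
    (fun _ t => halvingStep E N L D t) (fun _ t => t < D ^ (5 * L + 10)) 0

theorem add_mul_mod_of_lt {x y : ℕ} (h : x < D) : (x + D * y) % D = x := by
  simp [Nat.mod_eq_of_lt h]

theorem add_mul_div_of_lt {x y : ℕ} (h : x < D) : (x + D * y) / D = y := by
  rw [Nat.add_mul_div_left _ _ (by lia), Nat.div_eq_of_lt h, zero_add]

theorem zero_add_mul_mod {y : ℕ} : (D * y) % D = 0 := by simp

theorem HalvingLoop.next {l l' : List ℕ} {r : ℕ} (hl : ∀ x ∈ l, x < D) (hD : 0 < D)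
    (hlen : l.length ≤ 5 * L + 10) (h1 : stackCode D l ≠ 1) (h2 : stackCode D l ≠ 2)
    (hs : halvingStep E N L D (stackCode D l) = stackCode D l')
    (h : HalvingLoop E N L D (stackCode D l') r) : HalvingLoop E N L D (stackCode D l) r := by
  refine LoopTo.next ?_ ?_ ?_
  · exact (stackCode_lt hl).trans_le (Nat.pow_le_pow_right hD hlen)
  · simp [h1, h2]
  · rw [hs]; exact h

open Classical in
-- In continuation form: if the loop ends in `r` from the value of a request on top of `S`, it does
-- so from the request itself. The outer induction is on the number `k` of levels left, the inner
-- one on the midpoints left. Each level above has left a frame of five digits, whence `S.length ≤ 5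
-- * i`. The base `N + L + 3` exceeds all vertices, depths and tags.
theorem HalvingLoop.call (hD : D = N + L + 3) :
    ∀ (k i u v : ℕ) (S : List ℕ) (r : ℕ), i + k = L → u < N → v < N → (∀ x ∈ S, x < D) →
      S.length ≤ 5 * i →
      HalvingLoop E N L D (stackCode D ((if Halving E N k u v then 2 else 1) :: S)) r →
      HalvingLoop E N L D (stackCode D (0 :: i :: u :: v :: S)) r := by
  have hD0 : 0 < D := by lia
  -- The loop stops only at the codes `1` and `2`; the lowest digit of a request is `0`.
  have hcall : ∀ l : List ℕ, stackCode D (0 :: l) ≠ 1 ∧ stackCode D (0 :: l) ≠ 2 := by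
    intro l
    have h1 : stackCode D (0 :: l) % D = 0 := add_mul_mod_of_lt hD0
    constructor <;> intro h <;> rw [h, Nat.mod_eq_of_lt (by lia)] at h1 <;> simp at h1
  -- An intermediate result is not mistaken for the final one, because the tag `p` of the frame
  -- below it is positive and makes the code at least `D`.
  have hret : ∀ x p (l : List ℕ), 0 < p → stackCode D (x :: p :: l) ≠ 1 ∧
      stackCode D (x :: p :: l) ≠ 2 := by
    intro x p l hp
    have h1 : 3 ≤ stackCode D (x :: p :: l) := by
      have : D ≤ D * (p + D * stackCode D l) := Nat.le_mul_of_pos_right _ (by lia)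
      simp only [stackCode]
      lia
    lia
  intro k
  induction k with
  | zero =>
    intro i u v S r hi hu hv hS hlen h
    obtain rfl : i = L := by lia
    refine HalvingLoop.next (by
      intro x hx
      simp only [List.mem_cons] at hx
      rcases hx with rfl | rfl | rfl | rfl | hx
      iterate 4 lia
      exact hS x hx) hD0 (by simp only [List.length_cons]; lia) (hcall _).1 (hcall _).2 ?_ h
    have a1 : i < D := by lia
    have a2 : u < D := by lia
    have a3 : v < D := by lia
    simp only [halvingStep, stackCode, zero_add, add_mul_mod_of_lt, add_mul_div_of_lt, a1, a2, a3,
      zero_add_mul_mod, Nat.mul_div_cancel_left _ hD0, lt_irrefl, if_false, if_true, hu, hv, true_and,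
      Halving]
    congr
  | succ k ih =>
    intro i u v S r hi hu hv hS hlen h
    have a1 : i < D := by lia
    have a1' : i + 1 < D := by lia
    have a2 : u < D := by lia
    have a3 : v < D := by lia
    have a4 : 1 < D := by lia
    have a5 : 2 < D := by lia
    have a6 : i < L := by lia
    have hfr : ∀ p w, p < 3 → w < N → ∀ x ∈ p :: w :: (i + 1) :: u :: v :: S, x < D := by
      intro p w hp hw x hx
      simp only [List.mem_cons] at hx
      rcases hx with rfl | rfl | rfl | rfl | rfl | hx
      iterate 5 lia
      exact hS x hx
    -- Here `w` is the midpoint under examination, `j` more will follow, and all smaller ones have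
    -- failed.
    have inner : ∀ j w, w + j + 1 = N →
        (∀ w' < w, ¬ (Halving E N k u w' ∧ Halving E N k w' v)) →
        HalvingLoop E N L D
          (stackCode D (0 :: (i + 1) :: u :: w :: 1 :: w :: (i + 1) :: u :: v :: S)) r := by
      intro j
      induction j with
      | zero =>
        intro w hw hno
        have b1 : w < N := by lia
        have b2 : w < D := by lia
        have b3 : ¬ w + 1 < N := by lia
        have hfail : ¬ (Halving E N k u w ∧ Halving E N k w v) →
            (if Halving E N (k + 1) u v then 2 else 1) = 1 := by
          intro h'
          rw [if_neg]
          rintro ⟨w', hw', h''⟩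
          rcases Nat.lt_succ_iff_lt_or_eq.1 (show w' < w + 1 by lia) with h1 | rfl
          exacts [hno w' h1 h'', h' h'']
        refine ih (i + 1) u w _ r (by lia) hu b1 (hfr 1 w (by lia) b1)
          (by simp only [List.length_cons]; lia) ?_
        by_cases c1 : Halving E N k u w
        · rw [if_pos c1]
          refine HalvingLoop.next (l' := 0 :: (i + 1) :: w :: v :: 2 :: w :: (i + 1) :: u :: v :: S) (by
            intro x hx
            rcases List.mem_cons.1 hx with rfl | hx
            exacts [a5, hfr 1 w (by lia) b1 x hx]) hD0 (by simp only [List.length_cons]; lia)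
            (hret _ _ _ (by lia)).1 (hret _ _ _ (by lia)).2 ?_ ?_
          · simp only [halvingStep, stackCode, zero_add, add_mul_mod_of_lt, add_mul_div_of_lt, a1', a2,
              a3, a4, a5, b2, if_true, OfNat.ofNat_ne_zero, if_false]
          refine ih (i + 1) w v _ r (by lia) b1 hv (hfr 2 w (by lia) b1)
            (by simp only [List.length_cons]; lia) ?_
          by_cases c2 : Halving E N k w v
          · rw [if_pos c2]
            rw [if_pos ⟨w, b1, c1, c2⟩] at h
            refine HalvingLoop.next (by
              intro x hx
              rcases List.mem_cons.1 hx with rfl | hx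
              exacts [a5, hfr 2 w (by lia) b1 x hx]) hD0 (by simp only [List.length_cons]; lia)
              (hret _ _ _ (by lia)).1 (hret _ _ _ (by lia)).2 ?_ h
            simp only [halvingStep, stackCode, add_mul_mod_of_lt, add_mul_div_of_lt, a1', a2,
              a3, a5, b2, if_true, OfNat.ofNat_ne_zero, OfNat.ofNat_ne_one, if_false]
          · rw [if_neg c2]
            rw [hfail fun h => c2 h.2] at h
            refine HalvingLoop.next (by
              intro x hx
              rcases List.mem_cons.1 hx with rfl | hx
              exacts [a4, hfr 2 w (by lia) b1 x hx]) hD0 (by simp only [List.length_cons]; lia)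
              (hret _ _ _ (by lia)).1 (hret _ _ _ (by lia)).2 ?_ h
            simp only [halvingStep, stackCode, add_mul_mod_of_lt, add_mul_div_of_lt, a1', a2,
              a3, a4, a5, b2, b3, one_ne_zero, OfNat.one_ne_ofNat, if_false]
        · rw [if_neg c1]
          rw [hfail fun h => c1 h.1] at h
          refine HalvingLoop.next (by
            intro x hx
            rcases List.mem_cons.1 hx with rfl | hx
            exacts [a4, hfr 1 w (by lia) b1 x hx]) hD0 (by simp only [List.length_cons]; lia)
            (hret _ _ _ (by lia)).1 (hret _ _ _ (by lia)).2 ?_ h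
          simp only [halvingStep, stackCode, add_mul_mod_of_lt, add_mul_div_of_lt, a1', a2,
            a3, a4, b2, b3, one_ne_zero, OfNat.one_ne_ofNat, if_false]
      | succ j ihj =>
        intro w hw hno
        have b1 : w < N := by lia
        have b2 : w < D := by lia
        have b3 : w + 1 < N := by lia
        have hnext : ¬ (Halving E N k u w ∧ Halving E N k w v) →
            HalvingLoop E N L D (stackCode D
              (0 :: (i + 1) :: u :: (w + 1) :: 1 :: (w + 1) :: (i + 1) :: u :: v :: S)) r := by
          intro h'
          refine ihj (w + 1) (by lia) fun w' hw' => ?_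
          rcases Nat.lt_succ_iff_lt_or_eq.1 hw' with h1 | rfl
          exacts [hno w' h1, h']
        refine ih (i + 1) u w _ r (by lia) hu b1 (hfr 1 w (by lia) b1)
          (by simp only [List.length_cons]; lia) ?_
        by_cases c1 : Halving E N k u w
        · rw [if_pos c1]
          refine HalvingLoop.next (l' := 0 :: (i + 1) :: w :: v :: 2 :: w :: (i + 1) :: u :: v :: S) (by
            intro x hx
            rcases List.mem_cons.1 hx with rfl | hx
            exacts [a5, hfr 1 w (by lia) b1 x hx]) hD0 (by simp only [List.length_cons]; lia)
            (hret _ _ _ (by lia)).1 (hret _ _ _ (by lia)).2 ?_ ?_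
          · simp only [halvingStep, stackCode, zero_add, add_mul_mod_of_lt, add_mul_div_of_lt, a1', a2,
              a3, a4, a5, b2, if_true, OfNat.ofNat_ne_zero, if_false]
          refine ih (i + 1) w v _ r (by lia) b1 hv (hfr 2 w (by lia) b1)
            (by simp only [List.length_cons]; lia) ?_
          by_cases c2 : Halving E N k w v
          · rw [if_pos c2]
            rw [if_pos ⟨w, b1, c1, c2⟩] at h
            refine HalvingLoop.next (by
              intro x hx
              rcases List.mem_cons.1 hx with rfl | hx
              exacts [a5, hfr 2 w (by lia) b1 x hx]) hD0 (by simp only [List.length_cons]; lia)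
              (hret _ _ _ (by lia)).1 (hret _ _ _ (by lia)).2 ?_ h
            simp only [halvingStep, stackCode, add_mul_mod_of_lt, add_mul_div_of_lt, a1', a2,
              a3, a5, b2, if_true, OfNat.ofNat_ne_zero, OfNat.ofNat_ne_one, if_false]
          · rw [if_neg c2]
            refine HalvingLoop.next (by
              intro x hx
              rcases List.mem_cons.1 hx with rfl | hx
              exacts [a4, hfr 2 w (by lia) b1 x hx]) hD0 (by simp only [List.length_cons]; lia)
              (hret _ _ _ (by lia)).1 (hret _ _ _ (by lia)).2 ?_ (hnext fun h => c2 h.2)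
            simp only [halvingStep, stackCode, add_mul_mod_of_lt, add_mul_div_of_lt, a1', a2,
              a4, a5, b2, b3, one_ne_zero, OfNat.one_ne_ofNat, if_false, if_true]
        · rw [if_neg c1]
          refine HalvingLoop.next (by
            intro x hx
            rcases List.mem_cons.1 hx with rfl | hx
            exacts [a4, hfr 1 w (by lia) b1 x hx]) hD0 (by simp only [List.length_cons]; lia)
            (hret _ _ _ (by lia)).1 (hret _ _ _ (by lia)).2 ?_ (hnext fun h => c1 h.1)
          simp only [halvingStep, stackCode, add_mul_mod_of_lt, add_mul_div_of_lt, a1', a2,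
            a4, b2, b3, one_ne_zero, OfNat.one_ne_ofNat, if_false, if_true]
    refine HalvingLoop.next (by
      intro x hx
      simp only [List.mem_cons] at hx
      rcases hx with rfl | rfl | rfl | rfl | hx
      iterate 4 lia
      exact hS x hx) hD0 (by simp only [List.length_cons]; lia) (hcall _).1 (hcall _).2 ?_
      (inner (N - 1) 0 (by lia) (by simp))
    simp only [halvingStep, stackCode, zero_add, add_mul_mod_of_lt, add_mul_div_of_lt, a1, a2, a3,
      zero_add_mul_mod, Nat.mul_div_cancel_left _ hD0, if_true, a6]

end correctness

/-- The context `G` refines the context `F`. -/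
structure Extends {J A A' : Type} (G : Ctx J A') (F : Ctx J A) (π : A' → A) : Prop where
  d_le : F.d ≤ G.d
  P_of : ∀ a, G.P a → F.P (π a)
  R_of : ∀ a st, G.P a → G.R a st → F.R (π a) st
  O_eq : ∀ a, F.O (π a) = G.O a
  b_eq : ∀ a, F.b (π a) = G.b a

namespace Extends

variable {J A A' A'' : Type} {F : Ctx J A} {G : Ctx J A'} {H : Ctx J A''} {π : A' → A} {ρ : A'' → A'}

theorem refl : Extends F F id :=
  ⟨le_rfl, fun _ h => h, fun _ _ _ h => h, fun _ => rfl, fun _ => rfl⟩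

theorem restrict (h : Extends G F π) {Q : A' → Prop} : Extends (G.restrict Q) F π :=
  ⟨h.d_le, fun a ha => h.P_of a ha.1, fun a st ha => h.R_of a st ha.1, h.O_eq, h.b_eq⟩

theorem ext (h : Extends G F π) {e : ℕ} {I : A' → ℕ → Prop} :
    Extends (G.ext e I) F fun p => π p.1 :=
  ⟨h.d_le.trans (le_max_left _ _), fun _ hp => h.P_of _ hp.1, fun _ st hp hst => h.R_of _ st hp.1 hst.1,
    fun p => h.O_eq p.1, fun p => h.b_eq p.1⟩

theorem trans (h : Extends H G ρ) (h' : Extends G F π) : Extends H F (π ∘ ρ) :=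
  ⟨h'.d_le.trans h.d_le, fun a ha => h'.P_of _ (h.P_of a ha),
    fun a st ha hst => h'.R_of _ st (h.P_of a ha) (h.R_of a st ha hst),
    fun a => (h'.O_eq _).trans (h.O_eq a), fun a => (h'.b_eq _).trans (h.b_eq a)⟩

theorem cmp (h : Extends G F π) {f : A → ℕ} (hf : Cmp F f) : Cmp G fun a => f (π a) :=
  hf.map π h.d_le h.P_of h.R_of h.O_eq h.b_eq

end Extends

/-- The relation `E`, on the numbers below `N`, can be decided in all refinements of `F`. -/
def CmpR {J A : Type} (F : Ctx J A) (N : A → ℕ) (E : A → ℕ → ℕ → Prop) : Prop :=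
  ∀ (A' : Type) (G : Ctx J A') (π : A' → A), Extends G F π → ∀ u v : A' → ℕ, Cmp G u → Cmp G v →
    (∀ a, G.P a → u a < N (π a)) → (∀ a, G.P a → v a < N (π a)) → CmpP G fun a => E (π a) (u a) (v a)

theorem CmpR.lift {J A A' : Type} {F : Ctx J A} {N : A → ℕ} {E : A → ℕ → ℕ → Prop} {G : Ctx J A'}
    {π : A' → A} (hE : CmpR F N E) (h : Extends G F π) :
    CmpR G (fun a => N (π a)) fun a => E (π a) :=
  fun A'' G' ρ h' u v hu hv huN hvN => hE A'' G' (π ∘ ρ) (h'.trans h) u v hu hv huN hvN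

theorem Cmp.ite_of_decidable {J A : Type} {F : Ctx J A} {f g : A → ℕ} {Q : A → Prop}
    {_ : ∀ a, Decidable (Q a)} (hQ : CmpP F Q) (hf : Cmp (F.restrict Q) f)
    (hg : Cmp (F.restrict fun a => ¬ Q a) g) : Cmp F fun a => if Q a then f a else g a :=
  (Cmp.ite hQ hf hg).congr fun _ _ => by congr

/-! ### The evaluation step in digit arithmetic -/

section digits

variable {J A : Type} {F : Ctx J A} {D K : A → ℕ} {f x : A → ℕ} {k : ℕ} {Q : A → Prop}

/-- Computations with at most `K + 12` digits in base `D` are possible in the context `F`. -/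
structure Base (F : Ctx J A) (D K : A → ℕ) : Prop where
  cmp : Cmp F D
  le : ∀ a, F.P a → 3 ≤ D a
  pow_le : ∀ a, F.P a → D a ^ (K a + 12) ≤ F.b a

/-- A computable number of `K + k` digits. -/
structure Fits (F : Ctx J A) (D K : A → ℕ) (k : ℕ) (f : A → ℕ) : Prop where
  cmp : Cmp F f
  lt : ∀ a, F.P a → f a < D a ^ (K a + k)

/-- A computable digit. -/
structure Digit (F : Ctx J A) (D : A → ℕ) (f : A → ℕ) : Prop where
  cmp : Cmp F f
  lt : ∀ a, F.P a → f a < D a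

theorem Base.restrict (h : Base F D K) : Base (F.restrict Q) D K :=
  ⟨h.cmp.restrict, fun a ha => h.le a ha.1, fun a ha => h.pow_le a ha.1⟩

theorem Fits.restrict (h : Fits F D K k f) : Fits (F.restrict Q) D K k f :=
  ⟨h.cmp.restrict, fun a ha => h.lt a ha.1⟩

theorem Digit.restrict (h : Digit F D f) : Digit (F.restrict Q) D f :=
  ⟨h.cmp.restrict, fun a ha => h.lt a ha.1⟩

theorem Base.le_b (hB : Base F D K) {a : A} (ha : F.P a) : D a ≤ F.b a := by
  refine le_trans ?_ (hB.pow_le a ha)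
  exact Nat.le_self_pow (by lia) _

theorem Base.const (hB : Base F D K) {n : ℕ} (hn : n < 3) : Digit F D fun _ => n :=
  ⟨Cmp.const n fun a ha => by have := hB.le a ha; have := hB.le_b ha; lia,
    fun a ha => by have := hB.le a ha; lia⟩

theorem Fits.add_le (hB : Base F D K) (hf : Fits F D K k f) (hk : k < 12) {a : A} (ha : F.P a) :
    f a + D a ≤ F.b a := by
  have h3 := hB.le a ha
  have h1 : f a < D a ^ (K a + 11) :=
    (hf.lt a ha).trans_le (Nat.pow_le_pow_right (by lia) (by lia))
  have h2 : D a ≤ D a ^ (K a + 11) := Nat.le_self_pow (by lia) _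
  refine le_trans ?_ (hB.pow_le a ha)
  calc f a + D a ≤ D a ^ (K a + 11) * 2 := by lia
    _ ≤ D a ^ (K a + 11) * D a := Nat.mul_le_mul_left _ (by lia)
    _ = _ := by rw [← pow_succ]

theorem Fits.div (hB : Base F D K) (hf : Fits F D K k f) (hk : k < 12 := by norm_num) :
    Fits F D K k fun a => f a / D a :=
  ⟨hf.cmp.div hB.cmp (fun a ha => by have := hB.le a ha; lia) fun a ha => hf.add_le hB hk ha,
    fun a ha => (Nat.div_le_self _ _).trans_lt (hf.lt a ha)⟩

theorem Fits.mod (hB : Base F D K) (hf : Fits F D K k f) (hk : k < 12 := by norm_num) :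
    Digit F D fun a => f a % D a :=
  ⟨hf.cmp.mod hB.cmp (fun a ha => by have := hB.le a ha; lia) fun a ha => hf.add_le hB hk ha,
    fun a ha => Nat.mod_lt _ (by have := hB.le a ha; lia)⟩

theorem Fits.cons (hB : Base F D K) (hx : Digit F D x) (hf : Fits F D K k f)
    (hk : k < 12 := by norm_num) : Fits F D K (k + 1) fun a => x a + D a * f a := by
  have hlt : ∀ a, F.P a → x a + D a * f a < D a ^ (K a + (k + 1)) := fun a ha => by
    have h1 := hf.lt a ha
    have h2 := hx.lt a ha
    calc x a + D a * f a < D a * (f a + 1) := by lia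
      _ ≤ D a * D a ^ (K a + k) := Nat.mul_le_mul_left _ h1
      _ = _ := by rw [← add_assoc, pow_succ, mul_comm]
  have hle : ∀ a, F.P a → x a + D a * f a ≤ F.b a := fun a ha => by
    have := hB.le a ha
    exact (hlt a ha).le.trans ((Nat.pow_le_pow_right (by lia) (by lia)).trans (hB.pow_le a ha))
  exact ⟨hx.cmp.add (hB.cmp.mul hf.cmp fun a ha => (Nat.le_add_left _ _).trans (hle a ha)) hle, hlt⟩

theorem Digit.succ (hB : Base F D K) (hx : Digit F D x) (h : ∀ a, F.P a → x a + 1 < D a) :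
    Digit F D fun a => x a + 1 :=
  ⟨hx.cmp.succ fun a ha => (h a ha).le.trans (hB.le_b ha), h⟩

/-- At most nine digits are put on top of a code below `D ^ K`, which the twelve spare digits of
`Base` allow. The comparisons with `N` that precede the test of `E` supply the range conditions of
`CmpR`. -/
theorem Cmp.halvingStep {E : A → ℕ → ℕ → Prop} {N L t : A → ℕ} (hB : Base F D K)
    (hE : CmpR F N E) (hN : Cmp F N) (hL : Cmp F L) (hD : ∀ a, F.P a → N a + L a < D a)
    (ht : Fits F D K 0 t) :
    Cmp F fun a => MudStreaming.halvingStep (E a) (N a) (L a) (D a) (t a) := by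
  unfold MudStreaming.halvingStep
  have d1 := ht.div hB
  have d2 := d1.div hB
  have d3 := d2.div hB
  have d4 := d3.div hB
  have d6 := (d4.div hB).div hB
  have x0 := ht.mod hB
  have x1 := d1.mod hB
  have x2 := d2.mod hB
  have x3 := d3.mod hB
  have x4 := d4.mod hB
  have c0 := hB.const (n := 0) (by norm_num)
  have c1 := hB.const (n := 1) (by norm_num)
  have c2 := hB.const (n := 2) (by norm_num)
  refine Cmp.ite_of_decidable (CmpP.eq x0.cmp c0.cmp) ?_ ?_
  · refine Cmp.ite_of_decidable (CmpP.lt x1.restrict.cmp hL.restrict) ?_ ?_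
    · have hB' : Base ((F.restrict fun a => t a % D a = 0).restrict
        fun a => t a / D a % D a < L a) D K := hB.restrict.restrict
      have x1' := x1.restrict.restrict.succ hB' fun a ha => by
        have h1 := hD a ha.1.1
        have h2 : t a / D a % D a < L a := ha.2
        lia
      exact (Fits.cons hB' c0.restrict.restrict <| Fits.cons hB' x1' <|
        Fits.cons hB' x2.restrict.restrict <| Fits.cons hB' c0.restrict.restrict <|
        Fits.cons hB' c1.restrict.restrict <| Fits.cons hB' c0.restrict.restrict <|
        Fits.cons hB' x1' <| Fits.cons hB' x2.restrict.restrict <|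
        Fits.cons hB' x3.restrict.restrict d4.restrict.restrict).cmp
    · have hB' : Base ((F.restrict fun a => t a % D a = 0).restrict
        fun a => ¬ t a / D a % D a < L a) D K := hB.restrict.restrict
      refine (Fits.cons (k := 0) hB' ⟨?_, ?_⟩ d4.restrict.restrict).cmp
      · refine Cmp.ite_of_decidable ?_ c2.restrict.restrict.restrict.cmp c1.restrict.restrict.restrict.cmp
        refine (CmpP.lt x2.restrict.restrict.cmp hN.restrict.restrict).and
          ((CmpP.lt x3.restrict.restrict.restrict.cmp hN.restrict.restrict.restrict).and ?_)
        exact hE _ _ id Extends.refl.restrict.restrict.restrict.restrict _ _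
          x2.restrict.restrict.restrict.restrict.cmp x3.restrict.restrict.restrict.restrict.cmp
          (fun a ha => ha.1.2) (fun a ha => ha.2)
      · intro a ha
        have := hB'.le a ha
        split_ifs <;> lia
  · refine Cmp.ite_of_decidable (CmpP.eq x0.restrict.cmp c2.restrict.cmp) ?_ ?_
    · refine Cmp.ite_of_decidable (CmpP.eq x1.restrict.restrict.cmp c1.restrict.restrict.cmp) ?_ ?_
      · have hB' : Base (((F.restrict fun a => ¬ t a % D a = 0).restrict fun a => t a % D a = 2).restrict
          fun a => t a / D a % D a = 1) D K := hB.restrict.restrict.restrict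
        exact (Fits.cons hB' c0.restrict.restrict.restrict <|
          Fits.cons hB' x3.restrict.restrict.restrict <| Fits.cons hB' x2.restrict.restrict.restrict <|
          Fits.cons hB' ((d4.div hB).mod hB).restrict.restrict.restrict <|
          Fits.cons hB' c2.restrict.restrict.restrict d2.restrict.restrict.restrict).cmp
      · exact (Fits.cons hB.restrict.restrict.restrict c2.restrict.restrict.restrict
          d6.restrict.restrict.restrict).cmp
    · have hx2 : CmpP ((F.restrict fun a => ¬ t a % D a = 0).restrict fun a => ¬ t a % D a = 2)
          fun a => t a / D a / D a % D a + 1 < N a := by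
        refine (CmpP.lt (x2.restrict.restrict.cmp.succ fun a ha => ?_) hN.restrict.restrict)
        exact (x2.lt a ha.1.1).trans_le (hB.le_b ha.1.1)
      refine Cmp.ite_of_decidable hx2 ?_ ?_
      · have hB' : Base (((F.restrict fun a => ¬ t a % D a = 0).restrict
          fun a => ¬ t a % D a = 2).restrict fun a => t a / D a / D a % D a + 1 < N a) D K :=
          hB.restrict.restrict.restrict
        have x2' := x2.restrict.restrict.restrict.succ hB' fun a ha => by
          have h1 := hD a ha.1.1.1
          have h2 : t a / D a / D a % D a + 1 < N a := ha.2
          lia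
        exact (Fits.cons hB' c0.restrict.restrict.restrict <|
          Fits.cons hB' x3.restrict.restrict.restrict <| Fits.cons hB' x4.restrict.restrict.restrict <|
          Fits.cons hB' x2' <| Fits.cons hB' c1.restrict.restrict.restrict <|
          Fits.cons hB' x2' d3.restrict.restrict.restrict).cmp
      · exact (Fits.cons hB.restrict.restrict.restrict c1.restrict.restrict.restrict
          d6.restrict.restrict.restrict).cmp

end digits

/-- Savitch's argument: the whole recursion is held in one number with `5 * L + 10` digits in base
`N + L + 3`. Twelve more digits are reserved for the arithmetic of a single step. -/
theorem CmpP.halving {J A : Type} {F : Ctx J A} {E : A → ℕ → ℕ → Prop} {N L u v : A → ℕ}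
    (hE : CmpR F N E) (hN : Cmp F N) (hL : Cmp F L) (hu : Cmp F u) (hv : Cmp F v)
    (huN : ∀ a, F.P a → u a < N a) (hvN : ∀ a, F.P a → v a < N a)
    (hb : ∀ a, F.P a → (N a + L a + 3) ^ (5 * L a + 22) ≤ F.b a) :
    CmpP F fun a => Halving (E a) (N a) (L a) (u a) (v a) := by
  classical
  let D : A → ℕ := fun a => N a + L a + 3
  let K : A → ℕ := fun a => 5 * L a + 10
  have hDb : ∀ a, F.P a → D a ≤ F.b a := fun a ha =>
    le_trans (Nat.le_self_pow (by lia) _) (hb a ha)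
  have hD : Cmp F D := (((hN.add hL fun a ha => le_trans (by simp only [D]; lia) (hDb a ha)).succ
    fun a ha => le_trans (by simp only [D]; lia) (hDb a ha)).succ
    fun a ha => le_trans (by simp only [D]; lia) (hDb a ha)).succ fun a ha => hDb a ha
  have hB : Base F D K := ⟨hD, fun a _ => by simp only [D]; lia, hb⟩
  have h1b : ∀ a, F.P a → ∀ n < 3, n ≤ F.b a := fun a ha n hn =>
    le_trans (by simp only [D]; lia) (hDb a ha)
  have hstart : ∀ a, F.P a → stackCode (D a) [0, 0, u a, v a] < D a ^ K a := fun a ha => by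
    have h1 := huN a ha
    have h2 := hvN a ha
    refine (stackCode_lt ?_).trans_le (Nat.pow_le_pow_right (by simp only [D]; lia)
      (by simp only [List.length_cons, List.length_nil, K]; lia))
    simp only [List.mem_cons, List.not_mem_nil, or_false, D]
    lia
  have hDlt : ∀ a, D a ^ K a ≤ D a ^ (K a + 12) := fun a =>
    Nat.pow_le_pow_right (by simp only [D]; lia) (by lia)
  have hf₂ : Cmp F fun a => stackCode (D a) [0, 0, u a, v a] := by
    have c0 := hB.const (n := 0) (by norm_num)
    have hu' : Digit F D u := ⟨hu, fun a ha => by have := huN a ha; simp only [D]; lia⟩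
    have hv' : Digit F D v := ⟨hv, fun a ha => by have := hvN a ha; simp only [D]; lia⟩
    have hz : Fits F D K 0 fun _ => 0 := ⟨Cmp.zero, fun a _ => pow_pos (by simp only [D]; lia) _⟩
    exact (Fits.cons hB c0 <| Fits.cons hB c0 <| Fits.cons hB hu' <| Fits.cons hB hv' hz).cmp
  have hres : Cmp F fun a => if Halving (E a) (N a) (L a) (u a) (v a) then 2 else 1 := by
    refine Cmp.loop (f₁ := fun _ => 0) (c := fun _ _ t => if ¬ (t = 1 ∨ t = 2) then 1 else 0)
      (h₁ := fun _ _ _ => 0) (h₂ := fun a _ t => halvingStep (E a) (N a) (L a) (D a) t)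
      (fun a _ t => t < D a ^ K a) Cmp.zero hf₂ (fun e he => ?_) (fun e he => Cmp.zero)
      (fun e he => ?_) fun a ha => ?_
    · refine ((CmpP.eq Cmp.var Cmp.one).or (CmpP.eq Cmp.var.restrict (Cmp.const 2 ?_))).not.cmp
      exact fun a ha => h1b _ ha.1.1.1 2 (by norm_num)
    · let X : Ctx J ((A × ℕ) × ℕ) := F.ext₂ e fun a s t => t < D a ^ K a ∧
        (if ¬ (t = 1 ∨ t = 2) then 1 else 0) ≠ 0
      have hX : Extends X F fun p => p.1.1 := Extends.refl.ext.ext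
      have hB' : Base X (fun p => D p.1.1) fun p => K p.1.1 :=
        ⟨hX.cmp hD, fun p hp => hB.le _ hp.1.1, fun p hp => hB.pow_le _ hp.1.1⟩
      have ht : Fits X (fun p => D p.1.1) (fun p => K p.1.1) 0 fun p => p.2 :=
        ⟨Cmp.var, fun p hp => hp.2.1.1⟩
      exact Cmp.halvingStep hB' (hE.lift hX) (hX.cmp hN) (hX.cmp hL)
        (fun p hp => by simp only [D]; lia) ht
    · refine HalvingLoop.call (D := D a) rfl (L a) 0 (u a) (v a) [] _ (by lia) (huN a ha) (hvN a ha)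
        (by simp) (by simp) ?_
      simp only [stackCode, mul_zero, add_zero]
      refine LoopTo.halt ?_ ?_
      · have h3 : 3 ≤ D a ^ (5 * L a + 10) :=
          (hB.le a ha).trans (Nat.le_self_pow (by lia) _)
        split_ifs <;> lia
      · split_ifs <;> simp_all
  refine (CmpP.eq hres (Cmp.const 2 fun a ha => h1b a ha 2 (by norm_num))).congr fun a _ => ?_
  split_ifs with h <;> simp [h]

/-! ### Walks and recursive halving -/

/-- Reachability in at most `m` steps. -/
def ReachIn (E : ℕ → ℕ → Prop) : ℕ → ℕ → ℕ → Prop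
  | 0, u, v => u = v
  | m + 1, u, v => ∃ w, E u w ∧ ReachIn E m w v

theorem ReachIn.add {E : ℕ → ℕ → Prop} {l m u w v : ℕ} (h₁ : ReachIn E l u w) (h₂ : ReachIn E m w v) :
    ReachIn E (l + m) u v := by
  induction l generalizing u with
  | zero => obtain rfl : u = w := h₁; simpa using h₂
  | succ l ih =>
    obtain ⟨x, hx, h⟩ := h₁
    rw [Nat.succ_add]
    exact ⟨x, hx, ih h⟩

theorem ReachIn.split {E : ℕ → ℕ → Prop} {l m u v : ℕ} (h : ReachIn E (l + m) u v) :
    ∃ w, ReachIn E l u w ∧ ReachIn E m w v := by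
  induction l generalizing u with
  | zero => exact ⟨u, rfl, by simpa using h⟩
  | succ l ih =>
    rw [Nat.succ_add] at h
    obtain ⟨x, hx, h⟩ := h
    obtain ⟨w, h1, h2⟩ := ih h
    exact ⟨w, ⟨x, hx, h1⟩, h2⟩

theorem Halving.reachIn {E : ℕ → ℕ → Prop} {N : ℕ} : ∀ {l u v : ℕ}, Halving E N l u v →
    ReachIn E (2 ^ l) u v
  | 0, _, v, h => ⟨v, h, rfl⟩
  | l + 1, _, _, ⟨_, _, h₁, h₂⟩ => by
    rw [pow_succ, mul_two]
    exact (reachIn h₁).add (reachIn h₂)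

/-- Cutting a walk of length `2 ^ (l + 1)` in the middle gives the midpoint; it lies below `N`
because edges do not leave that range. -/
theorem ReachIn.halving {E : ℕ → ℕ → Prop} {N : ℕ} (hE : ∀ u v, E u v → u < N → v < N) :
    ∀ {l u v : ℕ}, u < N → ReachIn E (2 ^ l) u v → Halving E N l u v
  | 0, u, v, _, ⟨w, h, hw⟩ => by
    obtain rfl : w = v := hw
    exact h
  | l + 1, u, v, hu, h => by
    rw [pow_succ, mul_two] at h
    obtain ⟨w, h1, h2⟩ := h.split
    have hw : w < N := by
      clear h h2
      generalize 2 ^ l = m at h1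
      induction m generalizing u with
      | zero => obtain rfl : u = w := h1; exact hu
      | succ m ih =>
        obtain ⟨x, hx, h⟩ := h1
        exact ih x (hE u x hx hu) h
    exact ⟨w, hw, halving hE hu h1, halving hE hw h2⟩

/-! ### Merging two messages -/

/-- A state together with the number of the items read, coded as `m = state * (n + 1) + number`, after
one more item `x`. -/
def countedStep (n : ℕ) (σ : ℕ → ℕ → ℕ) (m x : ℕ) : ℕ :=
  σ (m / (n + 1)) x * (n + 1) + (m % (n + 1) + 1)

/-- Two coded messages below `S`, together coded as `W`, stay or read the same item. -/
def PairStep (n K S : ℕ) (σ : ℕ → ℕ → ℕ) (W W' : ℕ) : Prop :=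
  W = W' ∨ W / S % (n + 1) < n ∧ W % S % (n + 1) < n ∧
    ∃ x < K, countedStep n σ (W / S) x = W' / S ∧ countedStep n σ (W % S) x = W' % S

/-- The least message that `u` can reach by reading a string on which the initial state reaches `v`. -/
noncomputable def merge (n K S L : ℕ) (σ : ℕ → ℕ → ℕ) (u v : ℕ) : ℕ :=
  sInf {w | w + 1 = S ∨ Halving (PairStep n K S σ) (S * S) L u (v * S + w)}

section merge

variable {n K S L b : ℕ} {σ : ℕ → ℕ → ℕ}

theorem coded_div {p i : ℕ} (hi : i ≤ n) : (p * (n + 1) + i) / (n + 1) = p := by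
  rw [add_comm, Nat.add_mul_div_right _ _ (by lia), Nat.div_eq_of_lt (by lia), zero_add]

theorem coded_mod {p i : ℕ} (hi : i ≤ n) : (p * (n + 1) + i) % (n + 1) = i := by
  rw [add_comm, Nat.add_mul_mod_self_right, Nat.mod_eq_of_lt (by lia)]

theorem countedStep_coded {p i x : ℕ} (hi : i ≤ n) :
    countedStep n σ (p * (n + 1) + i) x = σ p x * (n + 1) + (i + 1) := by
  rw [countedStep, coded_div hi, coded_mod hi]

theorem coded_lt {p i : ℕ} (hp : p ≤ b) (hi : i ≤ n) : p * (n + 1) + i < (b + 1) * (n + 1) := by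
  have : p * (n + 1) ≤ b * (n + 1) := Nat.mul_le_mul_right _ hp
  lia

theorem pair_div {m₁ m₂ : ℕ} (h : m₂ < S) : (m₁ * S + m₂) / S = m₁ := by
  rw [add_comm, Nat.add_mul_div_right _ _ (by lia), Nat.div_eq_of_lt h, zero_add]

theorem pair_mod {m₁ m₂ : ℕ} (h : m₂ < S) : (m₁ * S + m₂) % S = m₂ := by
  rw [add_comm, Nat.add_mul_mod_self_right, Nat.mod_eq_of_lt h]

theorem countedStep_lt (hb : ∀ p ≤ b, ∀ x < K, σ p x ≤ b) {m x : ℕ} (hx : x < K)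
    (hm : m < (b + 1) * (n + 1)) (hmn : m % (n + 1) < n) :
    countedStep n σ m x < (b + 1) * (n + 1) := by
  refine coded_lt (hb _ ?_ x hx) hmn
  rw [← Nat.lt_succ_iff, Nat.div_lt_iff_lt_mul (by lia)]
  exact hm

theorem PairStep.lt (hS : S = (b + 1) * (n + 1)) (hb : ∀ p ≤ b, ∀ x < K, σ p x ≤ b) {W W' : ℕ}
    (h : PairStep n K S σ W W') (hW : W < S * S) : W' < S * S := by
  rcases h with rfl | ⟨h1, -, x, hx, h3, -⟩
  · exact hW
  · have hS0 : 0 < S := by rw [hS]; positivity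
    rw [← Nat.div_lt_iff_lt_mul hS0] at hW ⊢
    rw [← h3]
    rw [hS] at hW h1 ⊢
    exact countedStep_lt hb hx hW h1

theorem foldl_le (hb : ∀ p ≤ b, ∀ x < K, σ p x ≤ b) {l : List ℕ} (hl : ∀ x ∈ l, x < K) {p : ℕ}
    (hp : p ≤ b) : l.foldl σ p ≤ b := by
  induction l generalizing p with
  | nil => exact hp
  | cons x l ih => exact ih (fun y hy => hl y (by simp [hy])) (hb p hp x (hl x (by simp)))

/-- Each item gives one edge, and the remaining steps are spent staying. Since `ReachIn` prescribes
the exact number of steps, it is the possibility to stay that makes a power of two as good as any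
shorter length. -/
theorem reachIn_pair (hS : S = (b + 1) * (n + 1)) (hb : ∀ p ≤ b, ∀ x < K, σ p x ≤ b) {l : List ℕ}
    (hl : ∀ x ∈ l, x < K) {m : ℕ} (hm : l.length ≤ m) {p i q j : ℕ} (hp : p ≤ b) (hq : q ≤ b)
    (hi : i + l.length ≤ n) (hj : j + l.length ≤ n) :
    ReachIn (PairStep n K S σ) m ((p * (n + 1) + i) * S + (q * (n + 1) + j))
      ((l.foldl σ p * (n + 1) + (i + l.length)) * S + (l.foldl σ q * (n + 1) + (j + l.length))) := by
  induction l generalizing m p i q j with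
  | nil =>
    clear hm
    induction m with
    | zero => exact rfl
    | succ m ih => exact ⟨_, .inl rfl, ih⟩
  | cons x l ih =>
    obtain ⟨m, rfl⟩ : ∃ m', m = m' + 1 := ⟨m - 1, by simp at hm; lia⟩
    simp only [List.length_cons] at hi hj hm
    have hx := hl x (by simp)
    have h1 : q * (n + 1) + j < S := hS ▸ coded_lt hq (by lia)
    have h2 : σ q x * (n + 1) + (j + 1) < S := hS ▸ coded_lt (hb q hq x hx) (by lia)
    refine ⟨(σ p x * (n + 1) + (i + 1)) * S + (σ q x * (n + 1) + (j + 1)), .inr ⟨?_, ?_, x, hx, ?_, ?_⟩,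
      ?_⟩
    · rw [pair_div h1, coded_mod (by lia)]; lia
    · rw [pair_mod h1, coded_mod (by lia)]; lia
    · rw [pair_div h1, pair_div h2, countedStep_coded (by lia)]
    · rw [pair_mod h1, pair_mod h2, countedStep_coded (by lia)]
    · have := ih (fun y hy => hl y (by simp [hy])) (m := m) (by lia) (hb p hp x hx) (hb q hq x hx)
        (i := i + 1) (j := j + 1) (by lia) (by lia)
      simpa only [List.foldl_cons, List.length_cons, add_assoc, add_comm 1] using this

/-- The edges that move spell a string that both components have read. Steps are allowed only while
both counts are below `n`, so the counts never overflow into the states and the codes remain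
legible. -/
theorem exists_of_reachIn_pair (hS : S = (b + 1) * (n + 1)) (hb : ∀ p ≤ b, ∀ x < K, σ p x ≤ b) {m : ℕ}
    {p i q j W : ℕ} (hp : p ≤ b) (hq : q ≤ b) (hi : i ≤ n) (hj : j ≤ n)
    (h : ReachIn (PairStep n K S σ) m ((p * (n + 1) + i) * S + (q * (n + 1) + j)) W) :
    ∃ l : List ℕ, (∀ x ∈ l, x < K) ∧ i + l.length ≤ n ∧ j + l.length ≤ n ∧
      W = (l.foldl σ p * (n + 1) + (i + l.length)) * S +
        (l.foldl σ q * (n + 1) + (j + l.length)) := by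
  induction m generalizing p i q j with
  | zero =>
    obtain rfl : _ = W := h
    exact ⟨[], by simp, by simpa, by simpa, by simp⟩
  | succ m ih =>
    obtain ⟨W', h, hW⟩ := h
    rcases h with rfl | ⟨h1, h2, x, hx, h3, h4⟩
    · exact ih hp hq hi hj hW
    · have h5 : q * (n + 1) + j < S := hS ▸ coded_lt hq hj
      rw [pair_div h5, coded_mod hi] at h1
      rw [pair_mod h5, coded_mod hj] at h2
      rw [pair_div h5, countedStep_coded hi] at h3
      rw [pair_mod h5, countedStep_coded hj] at h4
      have h6 : W' = (σ p x * (n + 1) + (i + 1)) * S + (σ q x * (n + 1) + (j + 1)) := by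
        rw [h3, h4, mul_comm, Nat.div_add_mod]
      rw [h6] at hW
      obtain ⟨l, l1, l2, l3, l4⟩ := ih (hb p hp x hx) (hb q hq x hx) (by lia) (by lia) hW
      refine ⟨x :: l, ?_, ?_, ?_, ?_⟩
      · intro y hy
        rcases List.mem_cons.1 hy with rfl | hy
        exacts [hx, l1 y hy]
      · simp only [List.length_cons]; lia
      · simp only [List.length_cons]; lia
      · rw [l4]
        simp only [List.length_cons, List.foldl_cons, add_assoc, add_comm 1]

theorem merge_lt (hS : 0 < S) (u v : ℕ) : merge n K S L σ u v < S := by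
  have : merge n K S L σ u v ≤ S - 1 := Nat.sInf_le (.inl (by lia))
  lia

/-- The string `z` itself yields a walk from the initial message paired with `u` to `v` paired with
`w₀`, so the search succeeds. The least `w` may come from another string `z'`, but the component
that started at the initial message ends in `v`, which fixes both the final state and the length of
`z'`. -/
theorem merge_spec (hS : S = (b + 1) * (n + 1)) (hb : ∀ p ≤ b, ∀ x < K, σ p x ≤ b) (hL : n ≤ 2 ^ L)
    {y z : List ℕ} (hy : ∀ x ∈ y, x < K) (hz : ∀ x ∈ z, x < K) (hyz : y.length + z.length ≤ n) :
    ∃ z' : List ℕ, (∀ x ∈ z', x < K) ∧ z'.length = z.length ∧ z'.foldl σ 0 = z.foldl σ 0 ∧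
      merge n K S L σ (y.foldl σ 0 * (n + 1) + y.length) (z.foldl σ 0 * (n + 1) + z.length)
        = (y ++ z').foldl σ 0 * (n + 1) + (y ++ z').length := by
  have hS0 : 0 < S := by rw [hS]; positivity
  set p := y.foldl σ 0 with hp
  have hpb : p ≤ b := foldl_le hb hy (Nat.zero_le _)
  set u := p * (n + 1) + y.length with hu
  set v := z.foldl σ 0 * (n + 1) + z.length with hv
  have hvS : v < S := hS ▸ coded_lt (foldl_le hb hz (Nat.zero_le _)) (by lia)
  have huS : u < S := hS ▸ coded_lt hpb (by lia)
  set w₀ := z.foldl σ p * (n + 1) + (y.length + z.length) with hw₀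
  have hw₀S : w₀ < S := hS ▸ coded_lt (foldl_le hb hz hpb) hyz
  -- The initial state with count `0` has the code `0`, so its pair with `u` has the code `u`. This
  -- is why the walks in `merge` start at `u`.
  have hu0 : (0 * (n + 1) + 0) * S + (p * (n + 1) + y.length) = u := by simp [hu]
  have hreach : ReachIn (PairStep n K S σ) (2 ^ L) u (v * S + w₀) := by
    have h := reachIn_pair hS hb hz (m := 2 ^ L) (by lia) (Nat.zero_le b) hpb (i := 0)
      (j := y.length) (by lia) hyz
    rwa [hu0, zero_add] at h
  have hhalf : Halving (PairStep n K S σ) (S * S) L u (v * S + w₀) :=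
    hreach.halving (fun _ _ h => h.lt hS hb) (huS.trans_le (Nat.le_mul_of_pos_left _ hS0))
  set w := merge n K S L σ u v with hw
  have hww : w ≤ w₀ := Nat.sInf_le (.inr hhalf)
  have hwS : w < S := hww.trans_lt hw₀S
  have hmem : w + 1 = S ∨ Halving (PairStep n K S σ) (S * S) L u (v * S + w) :=
    Nat.sInf_mem (s := {w | w + 1 = S ∨ Halving (PairStep n K S σ) (S * S) L u (v * S + w)})
      ⟨w₀, .inr hhalf⟩
  -- The default value `S - 1` is harmless: as `w ≤ w₀ < S`, the minimum can only be `S - 1` if `w₀`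
  -- is, and `w₀` is reachable.
  have hw' : Halving (PairStep n K S σ) (S * S) L u (v * S + w) := by
    rcases hmem with h | h
    · have : w = w₀ := by lia
      rwa [this]
    · exact h
  have hr := hw'.reachIn
  rw [← hu0] at hr
  obtain ⟨l, l1, l2, l3, l4⟩ := exists_of_reachIn_pair hS hb (Nat.zero_le b) hpb (Nat.zero_le n)
    (by lia) hr
  have hlS : l.foldl σ p * (n + 1) + (y.length + l.length) < S :=
    hS ▸ coded_lt (foldl_le hb l1 hpb) l3
  have e1 : v = l.foldl σ 0 * (n + 1) + (0 + l.length) := by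
    rw [← pair_div (m₁ := v) hwS, l4, pair_div hlS]
  have e2 : w = l.foldl σ p * (n + 1) + (y.length + l.length) := by
    rw [← pair_mod (m₁ := v) hwS, l4, pair_mod hlS]
  rw [zero_add] at e1
  refine ⟨l, l1, ?_, ?_, ?_⟩
  · rw [← coded_mod (n := n) (i := l.length) (p := l.foldl σ 0) (by lia), ← e1, hv,
      coded_mod (by lia)]
  · rw [← coded_div (n := n) (i := l.length) (p := l.foldl σ 0) (by lia), ← e1, hv,
      coded_div (by lia)]
  · rw [e2, List.foldl_append, ← hp, List.length_append]

/-- The message `m` stands for a list of items that can replace the list `a`. -/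
def Represents (n K : ℕ) (σ : ℕ → ℕ → ℕ) (η : ℕ → ℕ) (m : ℕ) (a : List ℕ) : Prop :=
  ∃ y : List ℕ, (∀ x ∈ y, x < K) ∧ y.length = a.length ∧ m = y.foldl σ 0 * (n + 1) + y.length ∧
    ∀ z : List ℕ, (∀ x ∈ z, x < K) → y.length + z.length = n →
      η ((y ++ z).foldl σ 0) = η ((a ++ z).foldl σ 0)

variable {η : ℕ → ℕ}

theorem represents_singleton {x : ℕ} (hx : x < K) :
    Represents n K σ η (countedStep n σ 0 x) [x] :=
  ⟨[x], by simpa using hx, rfl, by simp [countedStep], fun _ _ _ => rfl⟩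

/-- For a completion `t`, first `y` is replaced by `a` in `y z' t`, with `z' t` as the completion.
Symmetry brings `z'` to the front, where `z` can take its place because both lead from the initial
state to the same state. Then `z` is replaced by `c`, and symmetry restores the order. All strings
involved have length `n`. -/
theorem Represents.merge (hS : S = (b + 1) * (n + 1)) (hb : ∀ p ≤ b, ∀ x < K, σ p x ≤ b)
    (hL : n ≤ 2 ^ L) (hperm : ∀ l l' : List ℕ, (∀ x ∈ l, x < K) → l.length = n → l.Perm l' →
      η (l.foldl σ 0) = η (l'.foldl σ 0)) {u v : ℕ} {a c : List ℕ} (ha : ∀ x ∈ a, x < K)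
    (hc : ∀ x ∈ c, x < K) (hac : a.length + c.length ≤ n) (hu : Represents n K σ η u a)
    (hv : Represents n K σ η v c) :
    Represents n K σ η (MudStreaming.merge n K S L σ u v) (a ++ c) := by
  obtain ⟨y, y1, y2, rfl, y3⟩ := hu
  obtain ⟨z, z1, z2, rfl, z3⟩ := hv
  obtain ⟨z', w1, w2, w3, w4⟩ := merge_spec hS hb hL y1 z1 (by lia)
  have happ : ∀ {l l' : List ℕ}, (∀ x ∈ l, x < K) → (∀ x ∈ l', x < K) → ∀ x ∈ l ++ l', x < K := by
    intro l l' h h' x hx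
    rcases List.mem_append.1 hx with hx | hx
    exacts [h x hx, h' x hx]
  refine ⟨y ++ z', happ y1 w1, by simp; lia, w4, fun t ht hlen => ?_⟩
  simp only [List.length_append] at hlen
  calc η ((y ++ z' ++ t).foldl σ 0) = η ((a ++ (z' ++ t)).foldl σ 0) := by
        rw [List.append_assoc]
        exact y3 _ (happ w1 ht) (by simp; lia)
    _ = η ((z' ++ (a ++ t)).foldl σ 0) := by
        refine hperm _ _ (happ ha (happ w1 ht)) (by simp; lia) ?_
        rw [← List.append_assoc, ← List.append_assoc]
        exact List.Perm.append_right _ List.perm_append_comm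
    _ = η ((z ++ (a ++ t)).foldl σ 0) := by
        rw [List.foldl_append, List.foldl_append (l := z), w3]
    _ = η ((c ++ (a ++ t)).foldl σ 0) := z3 _ (happ ha ht) (by simp; lia)
    _ = η ((a ++ c ++ t).foldl σ 0) := by
        refine hperm _ _ (happ hc (happ ha ht)) (by simp; lia) ?_
        rw [← List.append_assoc]
        exact List.Perm.append_right _ List.perm_append_comm

end merge

/-! ### A range of states that a machine can determine -/

/-- The least `b` such that the states up to `b` are closed under the steps of `σ`. -/
noncomputable def closureBound (K : ℕ) (σ : ℕ → ℕ → ℕ) : ℕ :=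
  sInf {b | ∀ p ≤ b, ∀ x < K, σ p x ≤ b}

section closureBound

variable {K q : ℕ} {σ : ℕ → ℕ → ℕ}

/-- The machine for `⊕` is told `n` and the alphabet size but not the number `q` of states, which
need not be computable from these. The bound `closureBound` replaces it: it can be found by calls of
`σ`, and since `0` is below it, all states that occur are. -/
theorem closureBound_lt (hq : 0 < q) (hσ : ∀ p x, σ p x < q) : closureBound K σ < q := by
  have : closureBound K σ ≤ q - 1 := Nat.sInf_le fun p _ x _ => by
    have := hσ p x
    lia
  lia

theorem closureBound_spec (hσ : ∀ p x, σ p x < q) :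
    ∀ p ≤ closureBound K σ, ∀ x < K, σ p x ≤ closureBound K σ :=
  Nat.sInf_mem (s := {b | ∀ p ≤ b, ∀ x < K, σ p x ≤ b}) ⟨q, fun p _ x _ => (hσ p x).le⟩

end closureBound

/-- The number of coded messages. -/
noncomputable def numMessages (n K : ℕ) (σ : ℕ → ℕ → ℕ) : ℕ := (closureBound K σ + 1) * (n + 1)

theorem numMessages_pos (n K : ℕ) (σ : ℕ → ℕ → ℕ) : 0 < numMessages n K σ := by
  unfold numMessages
  positivity

theorem lt_numMessages (n K : ℕ) (σ : ℕ → ℕ → ℕ) : n < numMessages n K σ := by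
  have : 1 * (n + 1) ≤ numMessages n K σ := Nat.mul_le_mul_right _ (by lia)
  lia

/-- The operation `σ`, on pairs below `q` and `K`, can be computed in all refinements of `F`. -/
def CmpOp {J A : Type} (F : Ctx J A) (q K : A → ℕ) (σ : A → ℕ → ℕ → ℕ) : Prop :=
  ∀ (A' : Type) (G : Ctx J A') (π : A' → A), Extends G F π → ∀ u v : A' → ℕ, Cmp G u → Cmp G v →
    (∀ a, G.P a → u a < q (π a)) → (∀ a, G.P a → v a < K (π a)) → Cmp G fun a => σ (π a) (u a) (v a)

/-- What is needed to compute `merge`. -/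
structure Mergeable {J A : Type} (F : Ctx J A) (n K q : A → ℕ) (σ : A → ℕ → ℕ → ℕ) : Prop where
  n_cmp : Cmp F n
  K_cmp : Cmp F K
  σ_cmp : CmpOp F q K σ
  σ_lt : ∀ a p x, σ a p x < q a
  q_pos : ∀ a, 0 < q a
  bound : ∀ a, F.P a →
    (q a * (n a + 1) * (q a * (n a + 1)) + Nat.clog 2 (n a) + 3) ^ (5 * Nat.clog 2 (n a) + 22) ≤ F.b a

/-- The exponent of the least power of two that is at least `f` is found by doubling. -/
theorem Cmp.clog {J A : Type} {F : Ctx J A} {f : A → ℕ} (hf : Cmp F f)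
    (h : ∀ a, F.P a → f a + f a ≤ F.b a) : Cmp F fun a => Nat.clog 2 (f a) := by
  classical
  have hlt : ∀ {a t : ℕ}, 2 ^ t < a ↔ t < Nat.clog 2 a := fun {a t} =>
    (Nat.lt_clog_iff_pow_lt (by norm_num)).symm
  refine Cmp.loop (f₁ := fun _ => 1) (f₂ := fun _ => 0) (c := fun a s _ => if s < f a then 1 else 0)
    (h₁ := fun _ s _ => s + s) (h₂ := fun _ _ t => t + 1)
    (fun a s t => s = 2 ^ t) Cmp.one Cmp.zero
    (fun e he => (CmpP.lt Cmp.var.ext hf.ext.ext).cmp) (fun e he => Cmp.var.ext.add Cmp.var.ext ?_)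
    (fun e he => Cmp.var.succ ?_) fun a ha => ?_
  · rintro ⟨⟨a, s⟩, t⟩ ⟨⟨ha, -, -⟩, ⟨-, h3⟩, -⟩
    have h4 : s < f a := by by_contra h'; simp [h'] at h3
    have := h a ha
    simp only [Ctx.ext]
    lia
  · rintro ⟨⟨a, s⟩, t⟩ ⟨⟨ha, -, -⟩, ⟨h2, h3⟩, -⟩
    have h4 : s < f a := by by_contra h'; simp [h'] at h3
    simp only at h2
    have h5 : t < s := h2 ▸ Nat.lt_two_pow_self
    have := h a ha
    simp only [Ctx.ext]
    lia
  · have key : ∀ k t, t + k = Nat.clog 2 (f a) → LoopTo (fun s _ => if s < f a then 1 else 0)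
        (fun s _ => s + s) (fun _ t => t + 1) (fun s t => s = 2 ^ t) (2 ^ t) t
        (Nat.clog 2 (f a)) := by
      intro k
      induction k with
      | zero =>
        intro t ht
        obtain rfl : t = _ := by simpa using ht
        refine LoopTo.halt rfl ?_
        rw [if_neg]
        rw [hlt]
        exact lt_irrefl _
      | succ k ih =>
        intro t ht
        refine LoopTo.next rfl ?_ ?_
        · rw [if_pos (hlt.2 (by lia))]; exact one_ne_zero
        · rw [← mul_two, ← pow_succ]
          exact ih (t + 1) (by lia)
    exact key _ 0 (zero_add _)

namespace Mergeable

variable {J A : Type} {F : Ctx J A} {n K q : A → ℕ} {σ : A → ℕ → ℕ → ℕ}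

section bounds

variable (h : Mergeable F n K q σ) {a : A}
include h

theorem num_le : numMessages (n a) (K a) (σ a) ≤ q a * (n a + 1) :=
  Nat.mul_le_mul_right _ (closureBound_lt (h.q_pos a) (h.σ_lt a))

theorem sq_le (ha : F.P a) : numMessages (n a) (K a) (σ a) * numMessages (n a) (K a) (σ a) +
    numMessages (n a) (K a) (σ a) + 3 ≤ F.b a := by
  refine le_trans ?_ (h.bound a ha)
  have h1 := h.num_le (a := a)
  set S := numMessages (n a) (K a) (σ a)
  set T := q a * (n a + 1)
  set L := Nat.clog 2 (n a)
  have h2 : S * S ≤ T * T := Nat.mul_le_mul h1 h1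
  have h3 : T ≤ T * T := Nat.le_mul_self T
  calc S * S + S + 3 ≤ (T * T + L + 3) * (T * T + L + 3) := by nlinarith
    _ = (T * T + L + 3) ^ 2 := by ring
    _ ≤ _ := Nat.pow_le_pow_right (by lia) (by lia)

end bounds

/-- The test of a candidate `i` calls `σ` only on states up to `i`. No candidate exceeds the value
sought, which is below `q`, so all calls concern genuine states. -/
theorem closure_cmp (h : Mergeable F n K q σ) : Cmp F fun a => closureBound (K a) (σ a) := by
  have hS : ∀ a, closureBound (K a) (σ a) + 1 ≤ numMessages (n a) (K a) (σ a) := fun a =>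
    Nat.le_mul_of_pos_right _ (Nat.succ_pos _)
  have hlt : ∀ a, closureBound (K a) (σ a) < q a := fun a => closureBound_lt (h.q_pos a) (h.σ_lt a)
  have hb : ∀ a, F.P a → closureBound (K a) (σ a) + 1 ≤ F.b a := fun a ha =>
    (hS a).trans (le_trans (by lia) (h.sq_le ha))
  refine Cmp.mu (Q := fun a i => ∀ p < i + 1, ∀ x < K a, ¬ i < σ a p x) (fun a ha => (hb a ha).trans' (by lia)) (fun a _ => ?_)
    (fun a _ i hi hQ => ?_) fun e he => ?_
  · intro p hp x hx
    exact (closureBound_spec (h.σ_lt a) p (by lia) x hx).not_gt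
  · exact Nat.notMem_of_lt_sInf hi fun p hp x hx => not_lt.1 (hQ p (by lia) x hx)
  · refine CmpP.ball (Cmp.var.succ ?_) fun e' he' => CmpP.ball (Extends.refl.ext.ext.cmp h.K_cmp)
      fun e'' he'' => (CmpP.lt Cmp.var.ext.ext ?_).not
    · rintro ⟨a, i⟩ ⟨ha, hi, -⟩
      exact le_trans (Nat.succ_le_succ hi) (hb a ha)
    · refine h.σ_cmp _ _ (fun p : ((A × ℕ) × ℕ) × ℕ => p.1.1.1) Extends.refl.ext.ext.ext
        (fun p => p.1.2) (fun p => p.2) Cmp.var.ext Cmp.var ?_ (fun p hp => hp.2.1)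
      rintro ⟨⟨⟨a, i⟩, p⟩, x⟩ ⟨⟨⟨-, hi, -⟩, hp, -⟩, -⟩
      have := hlt a
      simp only at hi hp ⊢
      lia

theorem n_succ_cmp (h : Mergeable F n K q σ) : Cmp F fun a => n a + 1 :=
  h.n_cmp.succ fun a ha => by
    have h1 := h.sq_le ha
    have h2 := lt_numMessages (n a) (K a) (σ a)
    lia

theorem num_cmp (h : Mergeable F n K q σ) : Cmp F fun a => numMessages (n a) (K a) (σ a) := by
  have hle : ∀ a, F.P a → numMessages (n a) (K a) (σ a) ≤ F.b a := fun a ha =>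
    le_trans (by lia) (h.sq_le ha)
  refine (h.closure_cmp.succ fun a ha => ?_).mul h.n_succ_cmp hle
  exact le_trans (Nat.le_mul_of_pos_right _ (Nat.succ_pos _)) (hle a ha)

/-- Steps of coded messages can be computed. -/
theorem countedStep_cmp (h : Mergeable F n K q σ) {A' : Type} {G : Ctx J A'} {π : A' → A}
    (hG : Extends G F π) {m x : A' → ℕ} (hm : Cmp G m) (hx : Cmp G x)
    (hmS : ∀ a, G.P a → m a < numMessages (n (π a)) (K (π a)) (σ (π a)))
    (hmn : ∀ a, G.P a → m a % (n (π a) + 1) < n (π a)) (hxK : ∀ a, G.P a → x a < K (π a)) :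
    Cmp G fun a => countedStep (n (π a)) (σ (π a)) (m a) (x a) := by
  have hn := hG.cmp h.n_succ_cmp
  have hadd : ∀ a, G.P a → m a + (n (π a) + 1) ≤ G.b a := fun a ha => by
    have h1 := h.sq_le (hG.P_of a ha)
    have h2 := lt_numMessages (n (π a)) (K (π a)) (σ (π a))
    have h3 := hmS a ha
    rw [← hG.b_eq]
    have := Nat.le_mul_self (numMessages (n (π a)) (K (π a)) (σ (π a)))
    lia
  have hdiv : ∀ a, G.P a → m a / (n (π a) + 1) ≤ closureBound (K (π a)) (σ (π a)) := fun a ha => by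
    rw [← Nat.lt_succ_iff, Nat.div_lt_iff_lt_mul (Nat.succ_pos _)]
    exact hmS a ha
  have hle : ∀ a, G.P a → countedStep (n (π a)) (σ (π a)) (m a) (x a) ≤ G.b a := fun a ha => by
    have h1 := countedStep_lt (closureBound_spec (h.σ_lt (π a))) (hxK a ha) (hmS a ha) (hmn a ha)
    have h2 := h.sq_le (hG.P_of a ha)
    rw [← hG.b_eq]
    exact h1.le.trans (le_trans (by unfold numMessages; lia) h2)
  refine Cmp.add (Cmp.mul (h.σ_cmp _ _ π hG _ _ (hm.div hn (fun _ _ => Nat.succ_pos _) hadd) hx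
    (fun a ha => (hdiv a ha).trans_lt (closureBound_lt (h.q_pos _) (h.σ_lt _))) hxK) hn ?_)
    ((hm.mod hn (fun _ _ => Nat.succ_pos _) hadd).succ ?_) hle
  · exact fun a ha => (Nat.le_add_right _ _).trans (hle a ha)
  · exact fun a ha => (Nat.le_add_left _ _).trans (hle a ha)

/-- The common item is found by search through the alphabet. The counts are tested first, since only
below `n` does a step of a coded message stay in the range of codes. -/
theorem pairStep_cmp (h : Mergeable F n K q σ) :
    CmpR F (fun a => numMessages (n a) (K a) (σ a) * numMessages (n a) (K a) (σ a))
      fun a => PairStep (n a) (K a) (numMessages (n a) (K a) (σ a)) (σ a) := by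
  intro A' G π hG u v hu hv huN hvN
  unfold PairStep
  let S : A' → ℕ := fun a => numMessages (n (π a)) (K (π a)) (σ (π a))
  have hS : Cmp G S := hG.cmp h.num_cmp
  have hS0 : ∀ a, 0 < S a := fun a => numMessages_pos _ _ _
  have hb : ∀ a, G.P a → S a * S a + S a + 3 ≤ G.b a := fun a ha => by
    rw [← hG.b_eq]
    exact h.sq_le (hG.P_of a ha)
  have hn := hG.cmp h.n_cmp
  have hn' := hG.cmp h.n_succ_cmp
  have hdiv : ∀ {f : A' → ℕ}, Cmp G f → (∀ a, G.P a → f a < S a * S a) →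
      Cmp G (fun a => f a / S a) ∧ Cmp G (fun a => f a % S a) := fun hf hlt =>
    ⟨hf.div hS (fun a _ => hS0 a) fun a ha => by have := hb a ha; have := hlt a ha; lia,
      hf.mod hS (fun a _ => hS0 a) fun a ha => by have := hb a ha; have := hlt a ha; lia⟩
  have hmod : ∀ {f : A' → ℕ}, Cmp G f → (∀ a, G.P a → f a < S a) →
      CmpP G fun a => f a % (n (π a) + 1) < n (π a) := fun hf hlt =>
    CmpP.lt (hf.mod hn' (fun _ _ => Nat.succ_pos _) fun a ha => by
      have h1 := hb a ha
      have h2 := hlt a ha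
      have h3 : n (π a) < S a := lt_numMessages _ _ _
      have h4 := Nat.le_mul_self (S a)
      lia) hn
  obtain ⟨hu1, hu2⟩ := hdiv hu huN
  obtain ⟨hv1, hv2⟩ := hdiv hv hvN
  have hu1S : ∀ a, G.P a → u a / S a < S a := fun a ha => by
    rw [Nat.div_lt_iff_lt_mul (hS0 a)]; exact huN a ha
  have hu2S : ∀ a, u a % S a < S a := fun a => Nat.mod_lt _ (hS0 a)
  refine (CmpP.eq hu hv).or (CmpP.restrict ?_)
  refine (hmod hu1 hu1S).and ?_
  refine (hmod hu2 fun a _ => hu2S a).restrict.and ?_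
  refine CmpP.bex (hG.cmp h.K_cmp).restrict.restrict fun e he => ?_
  have hX : Extends (((G.restrict fun a => u a / S a % (n (π a) + 1) < n (π a)).restrict
      fun a => u a % S a % (n (π a) + 1) < n (π a)).ext e fun a x => x < K (π a)) F fun p => π p.1 :=
    hG.restrict.restrict.ext
  refine (CmpP.eq (h.countedStep_cmp hX hu1.restrict.restrict.ext Cmp.var ?_ ?_ ?_)
    hv1.restrict.restrict.ext).and (CmpP.restrict
      (CmpP.eq (h.countedStep_cmp hX hu2.restrict.restrict.ext Cmp.var ?_ ?_ ?_)
        hv2.restrict.restrict.ext))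
  · exact fun p hp => hu1S _ hp.1.1.1
  · exact fun p hp => hp.1.1.2
  · exact fun p hp => hp.2.1
  · exact fun p hp => hu2S _
  · exact fun p hp => hp.1.2
  · exact fun p hp => hp.2.1

/-- The candidates `w` are tried in increasing order, each by a fresh evaluation of `Halving`. The
default `w + 1 = S` ends the search also for messages `u`, `v` that never meet in a computation, for
which `⊕` must be computed as well. -/
theorem merge_cmp (h : Mergeable F n K q σ) {u v : A → ℕ} (hu : Cmp F u) (hv : Cmp F v)
    (huS : ∀ a, F.P a → u a < numMessages (n a) (K a) (σ a))
    (hvS : ∀ a, F.P a → v a < numMessages (n a) (K a) (σ a)) :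
    Cmp F fun a => merge (n a) (K a) (numMessages (n a) (K a) (σ a)) (Nat.clog 2 (n a)) (σ a) (u a)
      (v a) := by
  let S : A → ℕ := fun a => numMessages (n a) (K a) (σ a)
  have hS : Cmp F S := h.num_cmp
  have hS0 : ∀ a, 0 < S a := fun a => numMessages_pos _ _ _
  have hb : ∀ a, F.P a → S a * S a + S a + 3 ≤ F.b a := fun a ha => h.sq_le ha
  have hL : Cmp F fun a => Nat.clog 2 (n a) := h.n_cmp.clog fun a ha => by
    have h1 := hb a ha
    have h3 : n a < S a := lt_numMessages _ _ _
    have h4 := Nat.le_mul_self (S a)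
    lia
  have hlt : ∀ a, merge (n a) (K a) (S a) (Nat.clog 2 (n a)) (σ a) (u a) (v a) < S a := fun a =>
    merge_lt (hS0 a) _ _
  refine Cmp.mu (Q := fun a w => w + 1 = S a ∨
      Halving (PairStep (n a) (K a) (S a) (σ a)) (S a * S a) (Nat.clog 2 (n a)) (u a) (v a * S a + w))
    ?_ ?_ ?_ fun e he => ?_
  · intro a ha
    have := hb a ha
    have := hlt a
    simp only [S] at *
    lia
  · intro a ha
    exact Nat.sInf_mem (s := {w | w + 1 = S a ∨ Halving (PairStep (n a) (K a) (S a) (σ a)) (S a * S a)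
      (Nat.clog 2 (n a)) (u a) (v a * S a + w)})
      ⟨S a - 1, .inl (by have := hS0 a; lia)⟩
  · exact fun a ha w hw => Nat.notMem_of_lt_sInf hw
  · let X : Ctx J (A × ℕ) := F.ext e fun a i =>
      i ≤ merge (n a) (K a) (numMessages (n a) (K a) (σ a)) (Nat.clog 2 (n a)) (σ a) (u a) (v a)
    have hX : Extends X F Prod.fst := Extends.refl.ext
    have hvS' : ∀ a, F.P a → v a * S a + S a ≤ S a * S a := fun a ha => by
      have h1 : (v a + 1) * S a ≤ S a * S a := Nat.mul_le_mul_right _ (hvS a ha)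
      lia
    have hw : ∀ p : A × ℕ, X.P p → p.2 < S p.1 := fun p hp => hp.2.1.trans_lt (hlt _)
    refine CmpP.or (F := X) (CmpP.eq (Cmp.var.succ fun p hp => ?_) (hX.cmp hS)) (CmpP.restrict ?_)
    · have h1 := hw p hp
      have h2 : S p.1 * S p.1 + S p.1 + 3 ≤ X.b p := hb _ hp.1
      exact h1.trans_le (by lia)
    · refine CmpP.halving (h.pairStep_cmp.lift hX) ?_ (hX.cmp hL) (hX.cmp hu)
        (((hX.cmp hv).mul (hX.cmp hS) fun p hp => ?_).add Cmp.var fun p hp => ?_) ?_ ?_ ?_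
      · refine (hX.cmp hS).mul (hX.cmp hS) fun p hp => ?_
        have h2 : S p.1 * S p.1 + S p.1 + 3 ≤ X.b p := hb _ hp.1
        lia
      · have h2 : S p.1 * S p.1 + S p.1 + 3 ≤ X.b p := hb _ hp.1
        have h3 := hvS' p.1 hp.1
        lia
      · have h1 := hw p hp
        have h2 : S p.1 * S p.1 + S p.1 + 3 ≤ X.b p := hb _ hp.1
        have h3 := hvS' p.1 hp.1
        lia
      · exact fun p hp => (huS _ hp.1).trans_le (Nat.le_mul_self _)
      · intro p hp
        have h1 := hw p hp
        have h3 := hvS' p.1 hp.1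
        simp only [S] at h1 h3 ⊢
        lia
      · intro p hp
        refine le_trans ?_ (h.bound p.1 hp.1)
        refine Nat.pow_le_pow_left ?_ _
        have := Nat.mul_le_mul (h.num_le (a := p.1)) (h.num_le (a := p.1))
        lia

end Mergeable

/-! ### Space bounds for machines obtained from programs -/

theorem RunsInSpace.mono {M : Machine} {l : List ℕ} {r : ℕ} {g g' : ℝ} (h : RunsInSpace M l r g)
    (hg : g ≤ g') : RunsInSpace M l r g' :=
  ⟨h.1, fun c hc => (h.2 c hc).trans hg⟩

/-- The input counts towards the space, so its numbers have at most `G` binary digits. -/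
theorem lt_two_pow_of_runsInSpace {M : Machine} {l : List ℕ} {r : ℕ} {g : ℝ}
    (h : RunsInSpace M l r g) {x G : ℕ} (hx : x ∈ l) (hG : g ≤ G) : x < 2 ^ G := by
  have h1 : (encodeNats l).length ≤ G := by exact_mod_cast h.length_le.trans hG
  rw [← Nat.size_le, ← Nat.size_eq_bits_len]
  refine le_trans ?_ h1
  clear h h1
  induction l with
  | nil => simp at hx
  | cons a l ih =>
    rw [encodeNats_cons, List.length_append]
    rcases List.mem_cons.1 hx with rfl | hx
    · simp [encodeNats]; lia
    · exact (ih hx).trans (by lia)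

theorem length_encodeNats_le {l : List ℕ} {k : ℕ} (hl : ∀ x ∈ l, x < 2 ^ k) :
    (encodeNats l).length ≤ l.length * (k + 1) := by
  induction l with
  | nil => simp [encodeNats]
  | cons a l ih =>
    have h1 := ih fun x hx => hl x (by simp [hx])
    have h2 : (Nat.bits a).length ≤ k := by
      rw [Nat.size_eq_bits_len, Nat.size_le]; exact hl a (by simp)
    rw [encodeNats_cons, List.length_append, List.length_cons, Nat.succ_mul]
    have h3 : (encodeNats [a]).length = (Nat.bits a).length + 1 := by simp [encodeNats]
    lia

/-- The context of a program that is started on the inputs `ins a` in the first `m` registers. -/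
def Ctx.inputs {J A : Type} (O : A → J → List ℕ → ℕ → Prop) (b : A → ℕ) (m : ℕ) (ins : A → List ℕ) :
    Ctx J A where
  O := O
  b := b
  P a := 1 ≤ b a ∧ ∀ x ∈ ins a, x ≤ b a
  d := m
  R a st := ∀ i < m, st i = (ins a).getD i 0
  R_congr a st st' h hR i hi := by rw [h i hi, hR i hi]
  one_le a h := h.1

theorem Cmp.input {J A : Type} {O : A → J → List ℕ → ℕ → Prop} {b : A → ℕ} {m : ℕ}
    {ins : A → List ℕ} (i : ℕ) (hi : i < m) : Cmp (Ctx.inputs O b m ins) fun a => (ins a).getD i 0 := by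
  refine Cmp.of_register i hi (fun a ha => ?_) fun a st _ hst => hst i hi
  by_cases h : i < (ins a).length
  · rw [List.getD_eq_getElem _ _ h]
    exact ha.2 _ (List.getElem_mem h)
  · rw [List.getD_eq_default _ _ (by lia)]
    exact Nat.zero_le _

/-- Values up to `2 ^ (200 * G ^ 2)` can be used in space `O(G ^ 2)`. -/
theorem Cmp.exists_machine {J A : Type} [DecidableEq J] [Fintype J] (M : J → Machine)
    {O : A → J → List ℕ → ℕ → Prop} {ins : A → List ℕ} {m : ℕ} {G : A → ℕ} {γ : A → ℝ} {f : A → ℕ}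
    (hf : Cmp (Ctx.inputs O (fun a => 2 ^ (200 * G a ^ 2)) m ins) f) (hm : ∀ a, (ins a).length = m)
    (hG : ∀ a, 1 ≤ G a) (hγ : ∀ a, γ a ≤ G a) (hins : ∀ a, ∀ x ∈ ins a, x < 2 ^ (4 * G a))
    (hO : ∀ a j l r, O a j l r → RunsInSpace (M j) l r (γ a)) :
    ∃ (X : Machine) (C : ℕ), ∀ a, RunsInSpace X (ins a) (f a) (C * G a ^ 2 : ℕ) := by
  obtain ⟨c, hc⟩ := hf
  obtain ⟨X, C, hX⟩ := Cmd.exists_machine M (c m) m m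
  refine ⟨X, C * (202 + 5 * m), fun a => ?_⟩
  have hsq : G a ≤ G a ^ 2 := Nat.le_self_pow (by lia) _
  have h1 : 1 ≤ G a ^ 2 := (hG a).trans hsq
  have hle : ∀ x ∈ ins a, x ≤ 2 ^ (200 * G a ^ 2) := fun x hx =>
    (hins a x hx).le.trans (Nat.pow_le_pow_right (by lia) (by lia))
  obtain ⟨-, st', r, -, h⟩ := hc m le_rfl a (fun v => (ins a).getD v 0)
    ⟨Nat.one_le_two_pow, hle⟩ fun i _ => rfl
  rw [← h, mul_assoc]
  -- The term `202 * G ^ 2` leaves room for the `200 * G ^ 2 + 1` digits of the bound and a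
  -- separator, `5 * m * G ^ 2` for `m` inputs of at most `4 * G` digits with their separators.
  refine hX (O a) (2 ^ (200 * G a ^ 2)) ((202 + 5 * m) * G a ^ 2) (γ a) (ins a) st' (hm a) (hO a) ?_ ?_
    ?_ hle r
  · refine (hγ a).trans ?_
    rw [Nat.cast_le]
    nlinarith
  · rw [Nat.size_eq_bits_len, Nat.size_pow]
    nlinarith
  · refine (length_encodeNats_le (hins a)).trans ?_
    rw [hm a]
    have h2 : m * (4 * G a + 1) ≤ m * (5 * G a ^ 2) := Nat.mul_le_mul_left _ (by lia)
    calc m * (4 * G a + 1) ≤ m * (5 * G a ^ 2) := h2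
      _ = 5 * m * G a ^ 2 := by ring
      _ ≤ _ := Nat.mul_le_mul_right _ (by lia)

/-! ### The mud algorithm of a streaming algorithm -/

namespace StreamAlg

variable {k : ℕ → ℕ} (s : StreamAlg k)

/-- The operator of a streaming algorithm on natural numbers. -/
def stepNat (n p x : ℕ) : ℕ :=
  if h : p < s.size n ∧ x < k n then (s.σ n ⟨p, h.1⟩ ⟨x, h.2⟩ : ℕ) else 0

/-- The output of a streaming algorithm on natural numbers. -/
def outNat (n p : ℕ) : ℕ :=
  if h : p < s.size n then (s.η n ⟨p, h⟩ : ℕ) else 0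

theorem stepNat_lt (n p x : ℕ) : s.stepNat n p x < s.size n := by
  unfold stepNat
  split_ifs
  exacts [Fin.is_lt _, s.size_pos n]

theorem card_pos {k : ℕ → ℕ} (s : StreamAlg k) (n : ℕ) : 0 < k n := (Nat.zero_le _).trans_lt (s.η n ⟨0, s.size_pos n⟩).is_lt

theorem outNat_lt (n p : ℕ) : s.outNat n p < k n := by
  unfold outNat
  split_ifs
  exacts [Fin.is_lt _, s.card_pos n]

theorem foldl_stepNat {n : ℕ} (l : List (Fin (k n))) (p : Fin (s.size n)) :
    (l.map Fin.val).foldl (s.stepNat n) p = s.run n p l := by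
  induction l generalizing p with
  | nil => rfl
  | cons x l ih =>
    have h : s.stepNat n p x = s.σ n p x := by simp [stepNat]
    rw [List.map_cons, List.foldl_cons, h, ih]
    rfl

/-- The number of the coded messages in which a state is counted with the number of items read. -/
noncomputable def messages (n : ℕ) : ℕ := numMessages n (k n) (s.stepNat n)

/-- The mud algorithm that simulates a streaming algorithm. -/
noncomputable def toMud : MudAlg k where
  size := s.messages
  Φ n x := if h : countedStep n (s.stepNat n) 0 x < s.messages n then ⟨_, h⟩
    else ⟨0, numMessages_pos _ _ _⟩
  op n u v := ⟨merge n (k n) (s.messages n) (Nat.clog 2 n) (s.stepNat n) u v,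
    merge_lt (numMessages_pos _ _ _) _ _⟩
  η n m := ⟨s.outNat n (m / (n + 1)), s.outNat_lt _ _⟩

/-- The fallback in the definition of `Φ` can matter only for `n = 0`, where no count `1` is
available. -/
theorem val_Φ_toMud {n : ℕ} (hn : 0 < n) (x : Fin (k n)) :
    (s.toMud.Φ n x : ℕ) = countedStep n (s.stepNat n) 0 x := by
  have h : countedStep n (s.stepNat n) 0 x < s.messages n :=
    countedStep_lt (closureBound_spec (s.stepNat_lt n)) x.2 (numMessages_pos _ _ _) (by simpa)
  simp [toMud, h]

end StreamAlg

/-- Sorting is a permutation of the arguments, and rearrangements of each other have the same sorted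
tuple. -/
theorem SymmFun.eq_of_perm (f : SymmFun) {n : ℕ} {x y : Fin n → Fin (f.card n)}
    (h : (List.ofFn x).Perm (List.ofFn y)) : f.toFun n x = f.toFun n y := by
  have h1 : x ∘ Tuple.sort x = y ∘ Tuple.sort y :=
    List.ofFn_injective <|
      ((Equiv.Perm.ofFn_comp_perm _ x).trans (h.trans (Equiv.Perm.ofFn_comp_perm _ y).symm)).eq_of_pairwise'
        (List.sortedLE_ofFn_iff.2 (Tuple.monotone_sort x)).pairwise
        (List.sortedLE_ofFn_iff.2 (Tuple.monotone_sort y)).pairwise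
  rw [← f.symm n (Tuple.sort x) x, h1, f.symm]

theorem StreamAlg.Computes.outNat_foldl {f : SymmFun} {s : StreamAlg f.card} (h : s.Computes f.toFun)
    {n : ℕ} (hn : 0 < n) (x : Fin n → Fin (f.card n)) :
    s.outNat n (((List.ofFn x).map Fin.val).foldl (s.stepNat n) 0) = f.toFun n x := by
  have h1 := s.foldl_stepNat (List.ofFn x) ⟨0, s.size_pos n⟩
  simp only at h1
  rw [h1, StreamAlg.outNat, dif_pos (Fin.is_lt _), ← h n hn x]

theorem StreamAlg.Computes.outNat_perm {f : SymmFun} {s : StreamAlg f.card} (h : s.Computes f.toFun)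
    {n : ℕ} (hn : 0 < n) (l l' : List ℕ) (hl : ∀ x ∈ l, x < f.card n) (hlen : l.length = n)
    (hp : l.Perm l') :
    s.outNat n (l.foldl (s.stepNat n) 0) = s.outNat n (l'.foldl (s.stepNat n) 0) := by
  have key : ∀ l : List ℕ, (∀ x ∈ l, x < f.card n) → l.length = n →
      ∃ x : Fin n → Fin (f.card n), l = (List.ofFn x).map Fin.val := by
    rintro l hl rfl
    refine ⟨fun i => ⟨l.get i, hl _ (l.get_mem i)⟩, ?_⟩
    rw [List.map_ofFn]
    exact (List.ofFn_get l).symm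
  obtain ⟨x, rfl⟩ := key l hl hlen
  obtain ⟨y, rfl⟩ := key l' (fun x hx => hl x (hp.mem_iff.2 hx)) (by rw [← hp.length_eq, hlen])
  rw [h.outNat_foldl hn, h.outNat_foldl hn]
  congr 1
  exact f.eq_of_perm ((List.map_perm_map_iff Fin.val_injective).1 hp)

/-- By induction the message of each subtree represents the items at its leaves. At the root the
count is `n`, so the empty completion is admissible, and symmetry accounts for the assignment of
positions. -/
theorem StreamAlg.Computes.toMud {f : SymmFun} {s : StreamAlg f.card} (h : s.Computes f.toFun) :
    s.toMud.Computes f.toFun := by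
  intro n hn x T hT
  have hb := closureBound_spec (K := f.card n) (s.stepNat_lt n)
  have key : ∀ T : BinTree (Fin n), T.leaves.length ≤ n →
      Represents n (f.card n) (s.stepNat n) (s.outNat n) (s.toMud.run n T x)
        (T.leaves.map fun i => (x i : ℕ)) := by
    intro T
    induction T with
    | leaf i =>
      intro _
      have := represents_singleton (n := n) (σ := s.stepNat n) (η := s.outNat n) (x i).2
      rw [← s.val_Φ_toMud hn] at this
      exact this
    | node l r ihl ihr =>
      intro hT
      rw [BinTree.leaves, List.length_append] at hT
      have hlt : ∀ T : BinTree (Fin n), ∀ y ∈ T.leaves.map fun i => (x i : ℕ), y < f.card n := by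
        intro T y hy
        obtain ⟨i, -, rfl⟩ := List.mem_map.1 hy
        exact (x i).2
      rw [BinTree.leaves, List.map_append]
      exact Represents.merge rfl hb (Nat.le_pow_clog (by norm_num) n) (h.outNat_perm hn) (hlt l) (hlt r)
        (by simpa using hT) (ihl (by lia)) (ihr (by lia))
  have hlen : T.leaves.length = n := by simpa using hT.length_eq
  obtain ⟨y, y1, y2, y3, y4⟩ := key T hlen.le
  rw [List.length_map, hlen] at y2
  have h4 := y4 [] (by simp) (by simpa using y2)
  rw [List.append_nil, List.append_nil] at h4
  ext
  change s.outNat n (s.toMud.run n T x / (n + 1)) = _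
  rw [y3, coded_div (by lia), h4, ← h.outNat_foldl hn]
  refine h.outNat_perm hn _ _ ?_ (by simpa using hlen) ?_
  · intro y hy
    obtain ⟨i, -, rfl⟩ := List.mem_map.1 hy
    exact (x i).2
  · rw [List.ofFn_eq_map, List.map_map]
    exact hT.map _

theorem sq_le_of_le_add_one {g : ℝ} (hg : 1 ≤ g) (C : ℕ) :
    ((C * (⌊g⌋₊ + 1) ^ 2 : ℕ) : ℝ) ≤ 4 * C * g ^ 2 := by
  have h1 : (⌊g⌋₊ : ℝ) ≤ g := Nat.floor_le (by linarith)
  have h2 : ((⌊g⌋₊ : ℝ) + 1) ^ 2 ≤ (2 * g) ^ 2 :=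
    pow_le_pow_left₀ (by positivity) (by linarith) 2
  push_cast
  nlinarith [Nat.cast_nonneg (α := ℝ) C]

theorem one_le_of_runsInSpace {M : Machine} {a r : ℕ} {l : List ℕ} {g : ℝ}
    (h : RunsInSpace M (a :: l) r g) : 1 ≤ g := by
  refine le_trans ?_ h.length_le
  rw [Nat.one_le_cast, encodeNats_cons, List.length_append]
  simp [encodeNats]
  lia

theorem add_three_le_two_pow {G : ℕ} (hG : 1 ≤ G) : G + 3 ≤ 2 ^ (4 * G) :=
  calc G + 3 ≤ 4 * G := by lia
    _ ≤ _ := Nat.lt_two_pow_self.le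

namespace StreamAlg

variable {k : ℕ → ℕ} {s : StreamAlg k} {g : ℕ → ℝ}

/-- The machine for `σ` must be able to hold `n`, `k n` and the largest state `s.size n - 1` in its
input. -/
theorem HasSpace.bounds (h : s.HasSpace g) {n : ℕ} (hn : 0 < n) :
    1 ≤ g n ∧ n < 2 ^ (⌊g n⌋₊ + 1) ∧ k n < 2 ^ (⌊g n⌋₊ + 1) ∧ s.size n ≤ 2 ^ (⌊g n⌋₊ + 1) := by
  obtain ⟨⟨M, hM⟩, -⟩ := h
  have hq := s.size_pos n
  have h1 := hM n hn ⟨s.size n - 1, by lia⟩ ⟨0, s.card_pos n⟩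
  have hg : g n ≤ (⌊g n⌋₊ + 1 : ℕ) := by push_cast; exact (Nat.lt_floor_add_one _).le
  have key := fun {x} (hx : x ∈ [n, k n, s.size n - 1, 0]) => lt_two_pow_of_runsInSpace h1 hx hg
  refine ⟨one_le_of_runsInSpace h1, key (by simp), key (by simp), ?_⟩
  have := key (x := s.size n - 1) (by simp)
  lia

theorem messages_le (n : ℕ) : s.messages n ≤ s.size n * (n + 1) :=
  Nat.mul_le_mul_right _ (closureBound_lt (s.size_pos n) (s.stepNat_lt n))

theorem HasSpace.messages_le (h : s.HasSpace g) {n : ℕ} (hn : 0 < n) :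
    s.messages n ≤ 2 ^ (2 * (⌊g n⌋₊ + 1)) := by
  obtain ⟨-, h1, -, h2⟩ := h.bounds hn
  rw [two_mul, pow_add]
  exact (StreamAlg.messages_le n).trans (Nat.mul_le_mul h2 h1)

/-- The answers of a machine for `σ`. -/
def StepOracle (s : StreamAlg k) (n : ℕ) (l : List ℕ) (r : ℕ) : Prop :=
  ∃ (q : Fin (s.size n)) (x : Fin (k n)), l = [n, k n, q, x] ∧ r = s.σ n q x

/-- The answers of a machine for `η`. -/
def OutOracle (s : StreamAlg k) (n : ℕ) (l : List ℕ) (r : ℕ) : Prop :=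
  ∃ q : Fin (s.size n), l = [n, k n, q] ∧ r = s.η n q

theorem HasSpace.mergeable (h : s.HasSpace g) {A : Type} {ν : A → ℕ} (hν : ∀ a, 0 < ν a)
    {rest : A → List ℕ} {m : ℕ} (hm : 2 ≤ m) :
    Mergeable (Ctx.inputs (fun a (_ : Unit) => s.StepOracle (ν a))
      (fun a => 2 ^ (200 * (⌊g (ν a)⌋₊ + 1) ^ 2)) m fun a => ν a :: k (ν a) :: rest a)
      ν (fun a => k (ν a)) (fun a => s.size (ν a)) (fun a => s.stepNat (ν a)) where
  n_cmp := Cmp.input 0 (by lia)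
  K_cmp := Cmp.input 1 (by lia)
  σ_cmp := by
    intro A' G π hG u v hu hv huq hvK
    refine Cmp.call () [fun a => ν (π a), fun a => k (ν (π a)), u, v] (by simp) ?_ ?_ ?_
    · intro f hf
      simp only [List.mem_cons, List.not_mem_nil, or_false] at hf
      rcases hf with rfl | rfl | rfl | rfl
      exacts [hG.cmp (f := ν) (Cmp.input 0 (by lia)),
        hG.cmp (f := fun a => k (ν a)) (Cmp.input 1 (by lia)), hu, hv]
    · intro a ha
      rw [← hG.O_eq]
      exact ⟨⟨u a, huq a ha⟩, ⟨v a, hvK a ha⟩, rfl, by simp [stepNat, huq a ha, hvK a ha]⟩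
    · intro a ha
      rw [← hG.b_eq]
      obtain ⟨-, -, -, h1⟩ := h.bounds (hν (π a))
      refine (s.stepNat_lt _ _ _).le.trans (h1.trans (Nat.pow_le_pow_right (by lia) ?_))
      nlinarith
  σ_lt a p x := s.stepNat_lt _ p x
  q_pos a := s.size_pos _
  bound := by
    intro a _
    obtain ⟨-, h1, -, h2⟩ := h.bounds (hν a)
    change _ ≤ 2 ^ (200 * (⌊g (ν a)⌋₊ + 1) ^ 2)
    set G := ⌊g (ν a)⌋₊ + 1
    have hG : 1 ≤ G := by simp only [G]; lia
    have hL : Nat.clog 2 (ν a) ≤ G := Nat.clog_le_of_le_pow h1.le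
    have hT : s.size (ν a) * (ν a + 1) ≤ 2 ^ (2 * G) := by
      rw [two_mul, pow_add]
      exact Nat.mul_le_mul h2 h1
    have hTT := Nat.mul_le_mul hT hT
    rw [← pow_add] at hTT
    have h3 := add_three_le_two_pow hG
    have hbase : s.size (ν a) * (ν a + 1) * (s.size (ν a) * (ν a + 1)) + Nat.clog 2 (ν a) + 3
        ≤ 2 ^ (5 * G) :=
      calc _ ≤ 2 ^ (2 * G + 2 * G) + 2 ^ (4 * G) := by lia
        _ = 2 ^ (4 * G + 1) := by rw [pow_succ, mul_two]; congr 2; ring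
        _ ≤ _ := Nat.pow_le_pow_right (by lia) (by lia)
    -- The depth is at most `G`, so the exponent is at most `27 * G`, and `5 * 27 = 135`. The bound
    -- `200` leaves room to spare.
    calc _ ≤ (2 ^ (5 * G)) ^ (5 * Nat.clog 2 (ν a) + 22) := Nat.pow_le_pow_left hbase _
      _ ≤ (2 ^ (5 * G)) ^ (27 * G) := Nat.pow_le_pow_right (by positivity) (by lia)
      _ = 2 ^ (135 * G ^ 2) := by rw [← pow_mul]; congr 1; ring
      _ ≤ _ := Nat.pow_le_pow_right (by lia) (Nat.mul_le_mul_right _ (by lia))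

theorem HasSpace.toMud (h : s.HasSpace g) :
    ∃ C : ℝ, s.toMud.HasSpace fun n => C * g n ^ 2 := by
  have hγ : ∀ n, g n ≤ (⌊g n⌋₊ + 1 : ℕ) := fun n => by
    push_cast; exact (Nat.lt_floor_add_one _).le
  have hb := fun {n} (hn : 0 < n) => h.bounds hn
  have hlt : ∀ {n x : ℕ}, x < 2 ^ (⌊g n⌋₊ + 1) → x < 2 ^ (4 * (⌊g n⌋₊ + 1)) := fun hx =>
    hx.trans_le (Nat.pow_le_pow_right (by lia) (by lia))
  have hlt' : ∀ {n : ℕ}, 0 < n → ∀ x : Fin (s.messages n), (x : ℕ) < 2 ^ (4 * (⌊g n⌋₊ + 1)) :=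
    fun hn x => x.2.trans_le ((h.messages_le hn).trans (Nat.pow_le_pow_right (by lia) (by lia)))
  obtain ⟨⟨Mσ, hMσ⟩, Mη, hMη⟩ := id h
  have hσ : ∀ n, 0 < n → ∀ l r, s.StepOracle n l r → RunsInSpace Mσ l r (g n) := by
    rintro n hn l r ⟨q, x, rfl, rfl⟩
    exact hMσ n hn q x
  have hη : ∀ n, 0 < n → ∀ l r, s.OutOracle n l r → RunsInSpace Mη l r (g n) := by
    rintro n hn l r ⟨q, rfl, rfl⟩
    exact hMη n hn q
  -- the local function
  obtain ⟨X₁, C₁, h₁⟩ : ∃ (X : Machine) (C : ℕ), ∀ a : (n : {n : ℕ // 0 < n}) × Fin (k n),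
      RunsInSpace X [a.1.1, k a.1.1, a.2] (s.toMud.Φ a.1.1 a.2) (C * (⌊g a.1.1⌋₊ + 1) ^ 2 : ℕ) := by
    have hF := h.mergeable (A := (n : {n : ℕ // 0 < n}) × Fin (k n)) (ν := fun a => a.1.1)
      (fun a => a.1.2) (rest := fun a => [(a.2 : ℕ)]) (m := 3) (by lia)
    have hx := Cmp.input (O := fun (a : (n : {n : ℕ // 0 < n}) × Fin (k n)) (_ : Unit) =>
      s.StepOracle a.1.1) (b := fun a => 2 ^ (200 * (⌊g a.1.1⌋₊ + 1) ^ 2)) (m := 3)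
      (ins := fun a => [a.1.1, k a.1.1, a.2]) 2 (by lia)
    have hf := (hF.countedStep_cmp Extends.refl Cmp.zero hx (fun a _ => numMessages_pos _ _ _)
      (fun a _ => by simpa using a.1.2) (fun a _ => a.2.2)).congr
      fun a _ => (s.val_Φ_toMud a.1.2 a.2).symm
    refine Cmp.exists_machine (fun _ => Mσ) (γ := fun a => g a.1.1) hf (fun _ => rfl)
      (fun a => Nat.succ_pos _) (fun a => hγ _) ?_ fun a _ l r hl => hσ _ a.1.2 l r hl
    rintro ⟨⟨n, hn⟩, x⟩ y hy
    simp only [List.mem_cons, List.not_mem_nil, or_false] at hy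
    rcases hy with rfl | rfl | rfl
    exacts [hlt (hb hn).2.1, hlt (hb hn).2.2.1, hlt (x.2.trans (hb hn).2.2.1)]
  -- the aggregator
  obtain ⟨X₂, C₂, h₂⟩ : ∃ (X : Machine) (C : ℕ),
      ∀ a : (n : {n : ℕ // 0 < n}) × Fin (s.messages n) × Fin (s.messages n),
      RunsInSpace X [a.1.1, k a.1.1, a.2.1, a.2.2] (s.toMud.op a.1.1 a.2.1 a.2.2)
        (C * (⌊g a.1.1⌋₊ + 1) ^ 2 : ℕ) := by
    have hF := h.mergeable (A := (n : {n : ℕ // 0 < n}) × Fin (s.messages n) × Fin (s.messages n))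
      (ν := fun a => a.1.1) (fun a => a.1.2) (rest := fun a => [(a.2.1 : ℕ), (a.2.2 : ℕ)]) (m := 4)
      (by lia)
    have hu := fun i hi => Cmp.input (O := fun (a : (n : {n : ℕ // 0 < n}) × Fin (s.messages n) ×
      Fin (s.messages n)) (_ : Unit) => s.StepOracle a.1.1)
      (b := fun a => 2 ^ (200 * (⌊g a.1.1⌋₊ + 1) ^ 2)) (m := 4)
      (ins := fun a => [a.1.1, k a.1.1, a.2.1, a.2.2]) i hi
    have hf := hF.merge_cmp (hu 2 (by lia)) (hu 3 (by lia)) (fun a _ => a.2.1.2) (fun a _ => a.2.2.2)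
    refine Cmp.exists_machine (fun _ => Mσ) (γ := fun a => g a.1.1) hf (fun _ => rfl)
      (fun a => Nat.succ_pos _) (fun a => hγ _) ?_ fun a _ l r hl => hσ _ a.1.2 l r hl
    rintro ⟨⟨n, hn⟩, u, v⟩ y hy
    simp only [List.mem_cons, List.not_mem_nil, or_false] at hy
    rcases hy with rfl | rfl | rfl | rfl
    exacts [hlt (hb hn).2.1, hlt (hb hn).2.2.1, hlt' hn u, hlt' hn v]
  -- the post-processing operator
  obtain ⟨X₃, C₃, h₃⟩ : ∃ (X : Machine) (C : ℕ),
      ∀ a : (n : {n : ℕ // 0 < n}) × Fin (s.messages n),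
      RunsInSpace X [a.1.1, k a.1.1, a.2] (s.toMud.η a.1.1 a.2) (C * (⌊g a.1.1⌋₊ + 1) ^ 2 : ℕ) := by
    have hu := fun i hi => Cmp.input (O := fun (a : (n : {n : ℕ // 0 < n}) × Fin (s.messages n))
      (_ : Unit) => s.OutOracle a.1.1) (b := fun a => 2 ^ (200 * (⌊g a.1.1⌋₊ + 1) ^ 2)) (m := 3)
      (ins := fun a => [a.1.1, k a.1.1, a.2]) i hi
    have hle : ∀ {n : ℕ}, ∀ x ≤ 2 ^ (4 * (⌊g n⌋₊ + 1)), x ≤ 2 ^ (200 * (⌊g n⌋₊ + 1) ^ 2) :=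
      fun x hx => hx.trans (Nat.pow_le_pow_right (by lia) (by nlinarith))
    have hn1 : ∀ {n : ℕ}, 0 < n → n + 1 ≤ 2 ^ (⌊g n⌋₊ + 1) := fun hn => (hb hn).2.1
    -- The machine for `η` may only be called on a genuine state, and the state part of every
    -- message is one.
    have hdiv : ∀ a : (n : {n : ℕ // 0 < n}) × Fin (s.messages n),
        (a.2 : ℕ) / (a.1.1 + 1) < s.size a.1.1 := fun a => by
      rw [Nat.div_lt_iff_lt_mul (Nat.succ_pos _)]
      exact a.2.2.trans_le (StreamAlg.messages_le _)
    have hp := (hu 2 (by lia)).div ((hu 0 (by lia)).succ fun a _ =>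
      hle _ ((hn1 a.1.2).trans (Nat.pow_le_pow_right (by lia) (by lia)))) (fun a _ => Nat.succ_pos _)
      fun a _ => by
        change (a.2 : ℕ) + (a.1.1 + 1) ≤ 2 ^ (200 * (⌊g a.1.1⌋₊ + 1) ^ 2)
        refine hle _ ?_
        have h1 := a.2.2.trans_le (h.messages_le a.1.2)
        have h2 := (hn1 a.1.2).trans (Nat.pow_le_pow_right (by lia)
          (show ⌊g a.1.1⌋₊ + 1 ≤ 2 * (⌊g a.1.1⌋₊ + 1) by lia))
        calc _ ≤ 2 ^ (2 * (⌊g a.1.1⌋₊ + 1)) * 2 := by lia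
          _ = 2 ^ (2 * (⌊g a.1.1⌋₊ + 1) + 1) := by rw [pow_succ]
          _ ≤ _ := Nat.pow_le_pow_right (by lia) (by lia)
    have hf : Cmp (Ctx.inputs (fun (a : (n : {n : ℕ // 0 < n}) × Fin (s.messages n)) (_ : Unit) =>
        s.OutOracle a.1.1) (fun a => 2 ^ (200 * (⌊g a.1.1⌋₊ + 1) ^ 2)) 3
        fun a => [a.1.1, k a.1.1, a.2]) fun a => (s.toMud.η a.1.1 a.2 : ℕ) := by
      refine Cmp.call () _ (List.cons_ne_nil _ _) (List.forall_mem_cons.2 ⟨hu 0 (by lia),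
        List.forall_mem_cons.2 ⟨hu 1 (by lia), List.forall_mem_cons.2 ⟨hp, List.forall_mem_nil _⟩⟩⟩) ?_ ?_
      · intro a _
        refine ⟨⟨_, hdiv a⟩, rfl, ?_⟩
        change s.outNat _ _ = _
        rw [outNat, dif_pos (hdiv a)]
      · intro a _
        exact hle _ (hlt ((s.toMud.η a.1.1 a.2).2.trans (hb a.1.2).2.2.1)).le
    refine Cmp.exists_machine (fun _ => Mη) (γ := fun a => g a.1.1) hf (fun _ => rfl)
      (fun a => Nat.succ_pos _) (fun a => hγ _) ?_ fun a _ l r hl => hη _ a.1.2 l r hl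
    rintro ⟨⟨n, hn⟩, u⟩ y hy
    simp only [List.mem_cons, List.not_mem_nil, or_false] at hy
    rcases hy with rfl | rfl | rfl
    exacts [hlt (hb hn).2.1, hlt (hb hn).2.2.1, hlt' hn u]
  have hC : ∀ {n C : ℕ}, 0 < n → C ≤ C₁ + C₂ + C₃ →
      ((C * (⌊g n⌋₊ + 1) ^ 2 : ℕ) : ℝ) ≤ 4 * (C₁ + C₂ + C₃ : ℕ) * g n ^ 2 := fun hn hC => by
    refine (sq_le_of_le_add_one (hb hn).1 _).trans (mul_le_mul_of_nonneg_right ?_ (sq_nonneg _))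
    have : (_ : ℝ) ≤ _ := Nat.cast_le.2 hC
    linarith
  exact ⟨4 * (C₁ + C₂ + C₃ : ℕ), ⟨X₁, fun n hn x => (h₁ ⟨⟨n, hn⟩, x⟩).mono (hC hn (by lia))⟩,
    ⟨X₂, fun n hn p q => (h₂ ⟨⟨n, hn⟩, p, q⟩).mono (hC hn (by lia))⟩,
    ⟨X₃, fun n hn q => (h₃ ⟨⟨n, hn⟩, q⟩).mono (hC hn (by lia))⟩⟩

theorem HasCommunication.toMud {c : ℕ → ℝ} (h : s.HasCommunication c) :
    s.toMud.HasCommunication fun n => c n + Real.logb 2 (n + 1) := by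
  intro n hn
  have h1 : (s.messages n : ℝ) ≤ s.size n * (n + 1) := by exact_mod_cast StreamAlg.messages_le n
  have h2 : (0 : ℝ) < s.messages n := by exact_mod_cast numMessages_pos _ _ _
  have h3 : (0 : ℝ) < s.size n := by exact_mod_cast s.size_pos n
  have h4 : (0 : ℝ) < n + 1 := by positivity
  calc Real.logb 2 (s.messages n) ≤ Real.logb 2 (s.size n * (n + 1)) :=
        Real.logb_le_logb_of_le (by norm_num) h2 h1
    _ = Real.logb 2 (s.size n) + Real.logb 2 (n + 1) := Real.logb_mul h3.ne' h4.ne'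
    _ ≤ _ := by
        have := h n hn
        linarith

end StreamAlg

/-! ### Mud algorithms as streaming algorithms -/

theorem Cmp.pred {J A : Type} {F : Ctx J A} {f : A → ℕ} (hf : Cmp F f)
    (h : ∀ a, F.P a → f a ≤ F.b a) : Cmp F fun a => f a - 1 := by
  -- The second alternative accounts for the truncated difference `0 - 1 = 0`.
  refine Cmp.mu (Q := fun a i => f a = i + 1 ∨ f a = 0) (fun a ha => (Nat.sub_le _ _).trans (h a ha))
    (fun a _ => by lia) (fun a _ i hi => by lia) fun e he => ?_
  refine (CmpP.eq hf.ext (Cmp.var.succ ?_)).or (CmpP.eq hf.ext Cmp.zero).restrict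
  rintro ⟨a, i⟩ ⟨ha, hi, -⟩
  have h1 := h a ha
  have h2 := F.one_le a ha
  simp only [Ctx.ext] at hi ⊢
  lia

theorem Cmp.of_cases {J A : Type} {F : Ctx J A} {f : A → ℕ} {Q : A → Prop} (hQ : CmpP F Q)
    (h : Cmp (F.restrict Q) f) (h' : Cmp (F.restrict fun a => ¬ Q a) f) : Cmp F f :=
  (Cmp.ite hQ h h').congr fun _ _ => ite_self _

namespace MudAlg

variable {k : ℕ → ℕ}

/-- The streaming algorithm that merges the items one by one into a message. Its starting state `0`
stands for the absence of a message. -/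
def toStream (m : MudAlg k) (hk : ∀ n, 0 < k n) : StreamAlg k where
  size n := m.size n + 1
  size_pos _ := Nat.succ_pos _
  σ n q x := Fin.succ (Fin.cases (motive := fun _ => Fin (m.size n)) (m.Φ n x)
    (fun p => m.op n p (m.Φ n x)) q)
  η n q := Fin.cases (motive := fun _ => Fin (k n)) ⟨0, hk n⟩ (m.η n) q

variable {m : MudAlg k} {hk : ∀ n, 0 < k n}

/-- Reading one more item hangs a new leaf to the right of the tree built so far, so the tree grows
as a left comb on top of `T`. -/
theorem run_toStream {n : ℕ} (x : Fin n → Fin (k n)) (l : List (Fin n)) (T : BinTree (Fin n)) :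
    ∃ T' : BinTree (Fin n), T'.leaves = T.leaves ++ l ∧
      (m.toStream hk).run n (Fin.succ (m.run n T x)) (l.map x) = Fin.succ (m.run n T' x) := by
  induction l generalizing T with
  | nil => exact ⟨T, by simp, rfl⟩
  | cons i l ih =>
    obtain ⟨T', h1, h2⟩ := ih (.node T (.leaf i))
    exact ⟨T', by simp [h1, BinTree.leaves], h2⟩

theorem Computes.toStream {f : ∀ n, (Fin n → Fin (k n)) → Fin (k n)} (h : m.Computes f) :
    (m.toStream hk).Computes f := by
  intro n hn x
  obtain ⟨n, rfl⟩ : ∃ n', n = n' + 1 := ⟨n - 1, by lia⟩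
  rw [List.ofFn_eq_map, List.finRange_succ, List.map_cons]
  obtain ⟨T, h1, h2⟩ := run_toStream (m := m) (hk := hk) x ((List.finRange n).map Fin.succ) (.leaf 0)
  have h3 : (m.toStream hk).run (n + 1) ⟨0, (m.toStream hk).size_pos (n + 1)⟩
      (x 0 :: ((List.finRange n).map Fin.succ).map x) = Fin.succ (m.run (n + 1) T x) := by
    rw [← h2]
    rfl
  rw [h3]
  refine h (n + 1) hn x T ?_
  rw [BinTree.IsComputationTree, h1, List.finRange_succ]
  exact List.Perm.refl _

theorem size_pos (m : MudAlg k) (hk : ∀ n, 0 < k n) (n : ℕ) : 0 < m.size n :=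
  (Nat.zero_le _).trans_lt (m.Φ n ⟨0, hk n⟩).is_lt

theorem HasCommunication.toStream {c : ℕ → ℝ} (h : m.HasCommunication c) :
    (m.toStream hk).HasCommunication fun n => c n + 1 := by
  intro n hn
  have h1 : (1 : ℝ) ≤ m.size n := by exact_mod_cast m.size_pos hk n
  have h2 : ((m.toStream hk).size n : ℝ) = m.size n + 1 := by simp [MudAlg.toStream]
  rw [h2]
  calc Real.logb 2 (m.size n + 1) ≤ Real.logb 2 (m.size n * 2) :=
        Real.logb_le_logb_of_le (by norm_num) (by linarith) (by linarith)
    _ = Real.logb 2 (m.size n) + 1 := by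
        rw [Real.logb_mul (by linarith) (by norm_num), Real.logb_self_eq_one (by norm_num)]
    _ ≤ _ := by
        have := h n hn
        linarith

/-- The answers of a machine for `Φ` (`false`) and of a machine for `⊕` (`true`). -/
def MessageOracle (m : MudAlg k) (n : ℕ) : Bool → List ℕ → ℕ → Prop
  | false, l, r => ∃ x : Fin (k n), l = [n, k n, x] ∧ r = m.Φ n x
  | true, l, r => ∃ p q : Fin (m.size n), l = [n, k n, p, q] ∧ r = m.op n p q

/-- The answers of a machine for `η`. -/
def OutOracle (m : MudAlg k) (n : ℕ) (l : List ℕ) (r : ℕ) : Prop :=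
  ∃ q : Fin (m.size n), l = [n, k n, q] ∧ r = m.η n q

/-- A nonzero state is a message shifted by one, so a step is one subtraction, calls of the machines
for `Φ` and `⊕`, and one increment. The square comes from reusing `Cmp.exists_machine`; it does no
harm to polylogarithmic bounds. -/
theorem HasSpace.toStream {g : ℕ → ℝ} (h : m.HasSpace g) :
    ∃ C : ℝ, (m.toStream hk).HasSpace fun n => C * g n ^ 2 := by
  have hγ : ∀ n, g n ≤ (⌊g n⌋₊ + 1 : ℕ) := fun n => by
    push_cast; exact (Nat.lt_floor_add_one _).le
  obtain ⟨⟨MΦ, hMΦ⟩, ⟨Mop, hMop⟩, Mη, hMη⟩ := h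
  have hb : ∀ {n : ℕ}, 0 < n → 1 ≤ g n ∧ n < 2 ^ (⌊g n⌋₊ + 1) ∧ k n < 2 ^ (⌊g n⌋₊ + 1) ∧
      m.size n ≤ 2 ^ (⌊g n⌋₊ + 1) := by
    intro n hn
    have hq := m.size_pos hk n
    have h1 := hMη n hn ⟨m.size n - 1, by lia⟩
    have key := fun {x} (hx : x ∈ [n, k n, m.size n - 1]) => lt_two_pow_of_runsInSpace h1 hx (hγ n)
    refine ⟨one_le_of_runsInSpace h1, key (by simp), key (by simp), ?_⟩
    have := key (x := m.size n - 1) (by simp)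
    lia
  have hlt : ∀ {n x : ℕ}, x < 2 ^ (⌊g n⌋₊ + 1) → x < 2 ^ (4 * (⌊g n⌋₊ + 1)) := fun hx =>
    hx.trans_le (Nat.pow_le_pow_right (by lia) (by lia))
  have hsize : ∀ {n : ℕ}, 0 < n → m.size n < 2 ^ (4 * (⌊g n⌋₊ + 1)) := fun hn =>
    (hb hn).2.2.2.trans_lt (Nat.pow_lt_pow_right (by norm_num) (by lia))
  have hle : ∀ {n x : ℕ}, x < 2 ^ (4 * (⌊g n⌋₊ + 1)) → x ≤ 2 ^ (200 * (⌊g n⌋₊ + 1) ^ 2) :=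
    fun hx => hx.le.trans (Nat.pow_le_pow_right (by lia) (by nlinarith))
  let M : Bool → Machine := fun j => bif j then Mop else MΦ
  have hM : ∀ n, 0 < n → ∀ j l r, m.MessageOracle n j l r → RunsInSpace (M j) l r (g n) := by
    rintro n hn (_ | _) l r
    · rintro ⟨x, rfl, rfl⟩
      exact hMΦ n hn x
    · rintro ⟨p, q, rfl, rfl⟩
      exact hMop n hn p q
  have hη : ∀ n, 0 < n → ∀ l r, m.OutOracle n l r → RunsInSpace Mη l r (g n) := by
    rintro n hn l r ⟨q, rfl, rfl⟩
    exact hMη n hn q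
  obtain ⟨X₁, C₁, h₁⟩ : ∃ (X : Machine) (C : ℕ),
      ∀ a : (n : {n : ℕ // 0 < n}) × Fin (m.size n + 1) × Fin (k n),
      RunsInSpace X [a.1.1, k a.1.1, a.2.1, a.2.2] ((m.toStream hk).σ a.1.1 a.2.1 a.2.2)
        (C * (⌊g a.1.1⌋₊ + 1) ^ 2 : ℕ) := by
    let F : Ctx Bool ((n : {n : ℕ // 0 < n}) × Fin (m.size n + 1) × Fin (k n)) :=
      Ctx.inputs (fun a => m.MessageOracle a.1.1) (fun a => 2 ^ (200 * (⌊g a.1.1⌋₊ + 1) ^ 2)) 4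
        fun a => [a.1.1, k a.1.1, a.2.1, a.2.2]
    have hn : Cmp F fun a => a.1.1 := Cmp.input 0 (by lia)
    have hk' : Cmp F fun a => k a.1.1 := Cmp.input 1 (by lia)
    have hq : Cmp F fun a => (a.2.1 : ℕ) := Cmp.input 2 (by lia)
    have hx : Cmp F fun a => (a.2.2 : ℕ) := Cmp.input 3 (by lia)
    have hmess : ∀ a : (n : {n : ℕ // 0 < n}) × Fin (m.size n + 1) × Fin (k n), ∀ y ≤ m.size a.1.1,
        y ≤ F.b a := fun a y hy => hle (hy.trans_lt (hsize a.1.2))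
    have hΦ : Cmp F fun a => (m.Φ a.1.1 a.2.2 : ℕ) := by
      refine Cmp.call false _ (List.cons_ne_nil _ _) (List.forall_mem_cons.2 ⟨hn,
        List.forall_mem_cons.2 ⟨hk', List.forall_mem_cons.2 ⟨hx, List.forall_mem_nil _⟩⟩⟩)
        (fun a _ => ⟨a.2.2, rfl, rfl⟩) fun a _ => hmess a _ (Fin.is_lt _).le
    have hp : Cmp F fun a => (a.2.1 : ℕ) - 1 :=
      hq.pred fun a _ => hmess a _ (Nat.lt_succ_iff.1 (Fin.is_lt _))
    let r : (n : {n : ℕ // 0 < n}) × Fin (m.size n + 1) × Fin (k n) → ℕ := fun a =>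
      (Fin.cases (motive := fun _ => Fin (m.size a.1.1)) (m.Φ a.1.1 a.2.2)
        (fun p => m.op a.1.1 p (m.Φ a.1.1 a.2.2)) a.2.1 : Fin (m.size a.1.1))
    have hr : ∀ a, r a < m.size a.1.1 := fun a => Fin.is_lt _
    have hf : Cmp F r := by
      have hq0 : CmpP F fun a => (a.2.1 : ℕ) = 0 := CmpP.eq hq Cmp.zero
      refine Cmp.of_cases hq0 (hΦ.restrict.congr ?_) ?_
      · rintro ⟨n, q, x⟩ ⟨-, hq⟩
        obtain rfl : q = 0 := Fin.ext hq
        rfl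
      · refine Cmp.call true _ (List.cons_ne_nil _ _) (List.forall_mem_cons.2 ⟨hn.restrict,
          List.forall_mem_cons.2 ⟨hk'.restrict, List.forall_mem_cons.2 ⟨hp.restrict,
          List.forall_mem_cons.2 ⟨hΦ.restrict, List.forall_mem_nil _⟩⟩⟩⟩) ?_
          fun a _ => hmess a _ (hr a).le
        rintro ⟨n, q, x⟩ ⟨-, hq⟩
        obtain ⟨p, rfl⟩ := Fin.exists_succ_eq.2 (show q ≠ 0 from fun h => hq (by simp [h]))
        exact ⟨p, m.Φ n.1 x, by simp, rfl⟩
    refine Cmp.exists_machine M (γ := fun a => g a.1.1)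
      (hf.succ fun a _ => hmess a _ (hr a)) (fun _ => rfl)
      (fun a => Nat.succ_pos _) (fun a => hγ _) ?_ fun a j l r hl => hM _ a.1.2 j l r hl
    rintro ⟨⟨n, hn⟩, q, x⟩ y hy
    simp only [List.mem_cons, List.not_mem_nil, or_false] at hy
    rcases hy with rfl | rfl | rfl | rfl
    exacts [hlt (hb hn).2.1, hlt (hb hn).2.2.1, (Nat.lt_succ_iff.1 q.2).trans_lt (hsize hn),
      hlt (x.2.trans (hb hn).2.2.1)]
  obtain ⟨X₂, C₂, h₂⟩ : ∃ (X : Machine) (C : ℕ),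
      ∀ a : (n : {n : ℕ // 0 < n}) × Fin (m.size n + 1),
      RunsInSpace X [a.1.1, k a.1.1, a.2] ((m.toStream hk).η a.1.1 a.2)
        (C * (⌊g a.1.1⌋₊ + 1) ^ 2 : ℕ) := by
    let F : Ctx Unit ((n : {n : ℕ // 0 < n}) × Fin (m.size n + 1)) :=
      Ctx.inputs (fun a _ => m.OutOracle a.1.1) (fun a => 2 ^ (200 * (⌊g a.1.1⌋₊ + 1) ^ 2)) 3
        fun a => [a.1.1, k a.1.1, a.2]
    have hn : Cmp F fun a => a.1.1 := Cmp.input 0 (by lia)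
    have hk' : Cmp F fun a => k a.1.1 := Cmp.input 1 (by lia)
    have hq : Cmp F fun a => (a.2 : ℕ) := Cmp.input 2 (by lia)
    have hp : Cmp F fun a => (a.2 : ℕ) - 1 :=
      hq.pred fun a _ => hle ((Nat.lt_succ_iff.1 (Fin.is_lt _)).trans_lt (hsize a.1.2))
    have hf : Cmp F fun a => ((m.toStream hk).η a.1.1 a.2 : ℕ) := by
      have hq0 : CmpP F fun a => (a.2 : ℕ) = 0 := CmpP.eq hq Cmp.zero
      refine Cmp.of_cases hq0 (Cmp.zero.congr ?_) ?_
      · rintro ⟨n, q⟩ ⟨-, hq⟩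
        obtain rfl : q = 0 := Fin.ext hq
        rfl
      · refine Cmp.call () _ (List.cons_ne_nil _ _) (List.forall_mem_cons.2 ⟨hn.restrict,
          List.forall_mem_cons.2 ⟨hk'.restrict, List.forall_mem_cons.2 ⟨hp.restrict,
          List.forall_mem_nil _⟩⟩⟩) ?_
          fun a _ => hle (hlt ((Fin.is_lt _).trans (hb a.1.2).2.2.1))
        rintro ⟨n, q⟩ ⟨-, hq⟩
        obtain ⟨p, rfl⟩ := Fin.exists_succ_eq.2 (show q ≠ 0 from fun h => hq (by simp [h]))
        exact ⟨p, by simp, rfl⟩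
    refine Cmp.exists_machine (fun _ => Mη) (γ := fun a => g a.1.1) hf (fun _ => rfl)
      (fun a => Nat.succ_pos _) (fun a => hγ _) ?_ fun a _ l r hl => hη _ a.1.2 l r hl
    rintro ⟨⟨n, hn⟩, q⟩ y hy
    simp only [List.mem_cons, List.not_mem_nil, or_false] at hy
    rcases hy with rfl | rfl | rfl
    exacts [hlt (hb hn).2.1, hlt (hb hn).2.2.1, (Nat.lt_succ_iff.1 q.2).trans_lt (hsize hn)]
  have hC : ∀ {n C : ℕ}, 0 < n → C ≤ C₁ + C₂ →
      ((C * (⌊g n⌋₊ + 1) ^ 2 : ℕ) : ℝ) ≤ 4 * (C₁ + C₂ : ℕ) * g n ^ 2 := fun hn hC => by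
    refine (sq_le_of_le_add_one (hb hn).1 _).trans (mul_le_mul_of_nonneg_right ?_ (sq_nonneg _))
    have : (_ : ℝ) ≤ _ := Nat.cast_le.2 hC
    linarith
  exact ⟨4 * (C₁ + C₂ : ℕ), ⟨X₁, fun n hn q x => (h₁ ⟨⟨n, hn⟩, q, x⟩).mono (hC hn (by lia))⟩,
    ⟨X₂, fun n hn q => (h₂ ⟨⟨n, hn⟩, q⟩).mono (hC hn (by lia))⟩⟩

end MudAlg

/-! ### Polylogarithmic bounds -/

theorem isBigO_log_pow {d d' : ℕ} (h : d ≤ d') :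
    (fun n : ℕ => Real.log n ^ d) =O[atTop] fun n : ℕ => Real.log n ^ d' := by
  refine IsBigO.of_bound 1 ?_
  filter_upwards [eventually_ge_atTop 3] with n hn
  have h1 : 1 ≤ Real.log n := by
    rw [Real.le_log_iff_exp_le (by positivity)]
    have : (3 : ℝ) ≤ n := by exact_mod_cast hn
    linarith [Real.exp_one_lt_d9]
  rw [Real.norm_of_nonneg (by positivity), Real.norm_of_nonneg (by positivity), one_mul]
  exact pow_le_pow_right₀ h1 h

theorem isBigO_logb_add_one :
    (fun n : ℕ => Real.logb 2 (n + 1)) =O[atTop] fun n : ℕ => Real.log n := by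
  refine IsBigO.of_bound (2 / Real.log 2) ?_
  filter_upwards [eventually_ge_atTop 2] with n hn
  have h2 : (2 : ℝ) ≤ n := by exact_mod_cast hn
  have h3 : 0 < Real.log 2 := Real.log_pos (by norm_num)
  have h4 : 0 ≤ Real.log n := Real.log_nonneg (by linarith)
  -- For `n ≥ 2` one has `n + 1 ≤ n ^ 2`.
  have h5 : Real.log (n + 1) ≤ 2 * Real.log n := by
    have := Real.log_le_log (by linarith) (show (n : ℝ) + 1 ≤ n ^ 2 by nlinarith)
    rwa [Real.log_pow, Nat.cast_ofNat] at this
  have h6 : 0 ≤ Real.log (n + 1) := Real.log_nonneg (by linarith)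
  rw [Real.logb, Real.norm_of_nonneg (div_nonneg h6 h3.le), Real.norm_of_nonneg h4,
    div_mul_eq_mul_div]
  exact div_le_div_of_nonneg_right h5 h3.le

namespace IsPolylog

variable {h h' : ℕ → ℝ}

theorem add (hh : IsPolylog h) (hh' : IsPolylog h') : IsPolylog fun n => h n + h' n := by
  obtain ⟨d, hd⟩ := hh
  obtain ⟨d', hd'⟩ := hh'
  exact ⟨max d d', (hd.trans (isBigO_log_pow (le_max_left _ _))).add
    (hd'.trans (isBigO_log_pow (le_max_right _ _)))⟩

theorem const_mul_sq (hh : IsPolylog h) (C : ℝ) : IsPolylog fun n => C * h n ^ 2 := by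
  obtain ⟨d, hd⟩ := hh
  refine ⟨d * 2, IsBigO.const_mul_left ?_ C⟩
  simpa only [pow_mul] using hd.pow 2

theorem one : IsPolylog fun _ => 1 := ⟨0, by simpa using isBigO_refl (fun _ : ℕ => (1 : ℝ)) atTop⟩

theorem logb_add_one : IsPolylog fun n => Real.logb 2 (n + 1) :=
  ⟨1, by simpa using isBigO_logb_add_one⟩

end IsPolylog

end MudStreaming

theorem theorem1 :
    (∀ (f : MudStreaming.SymmFun) (s : MudStreaming.StreamAlg f.card) (g c : ℕ → ℝ),
      s.Computes f.toFun → s.HasSpace g → s.HasCommunication c →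
      (fun n : ℕ => Real.log n) =O[atTop] g →
      (fun n : ℕ => Real.log n) =O[atTop] c →
      ∃ m : MudStreaming.MudAlg f.card, m.Computes f.toFun ∧
        (∃ c' : ℕ → ℝ, c' =O[atTop] c ∧ m.HasCommunication c') ∧
        (∃ g' : ℕ → ℝ, g' =O[atTop] (fun n : ℕ => g n ^ 2) ∧ m.HasSpace g')) ∧
    MudStreaming.MUD = MudStreaming.SS := by
  refine ⟨fun f s g c hs hg hc _ hlc => ?_, Set.Subset.antisymm ?_ ?_⟩
  · obtain ⟨C, hC⟩ := hg.toMud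
    exact ⟨s.toMud, hs.toMud,
      -- The count adds `logb 2 (n + 1)` to the communication, which is `O(c)` because `log n` is.
      ⟨_, (isBigO_refl c atTop).add (MudStreaming.isBigO_logb_add_one.trans hlc), hc.toMud⟩,
      ⟨_, (isBigO_refl (fun n => g n ^ 2) atTop).const_mul_left C, hC⟩⟩
  · rintro f ⟨m, hm, ⟨c, hc, hmc⟩, g, hg, hmg⟩
    obtain ⟨C, hC⟩ := hmg.toStream (hk := f.card_pos)
    exact ⟨m.toStream f.card_pos, hm.toStream, ⟨_, hc.add .one, hmc.toStream⟩, _,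
      hg.const_mul_sq C, hC⟩
  · rintro f ⟨s, hs, ⟨c, hc, hsc⟩, g, hg, hsg⟩
    obtain ⟨C, hC⟩ := hsg.toMud
    exact ⟨s.toMud, hs.toMud, ⟨_, hc.add .logb_add_one, hsc.toMud⟩, _, hg.const_mul_sq C, hC⟩
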